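/- A \emph{graph} is a locally finite $1$-dimensional CW complex, and a \emph{graph map} is a continuous map sending vertices to vertices and each edge to an edge path (possibly of length $0$). Let $\Gamma$ be an infinite connected graph with finitely many ends. A \emph{neighborhood basis} for an end is a sequence $V_0\supseteq V_1\supseteq\cdots$ of sets, each $V_n$ a connected component of $\Gamma\setminus K_n$ for some exhaustion $K_0\subseteq K_1\subseteq\cdots$ of $\Gamma$ by compact sets; two such sequences represent the same \emph{end} if each is cofinal in the other, and a \emph{neighborhood} of an end is an open set that contains the tail of each of its neighborhood bases and meets only finitely many terms of any neighborhood basis of any other end. A graph map $g:\Gamma\to\Gamma$ is \emph{end-periodic} if each end $E$ has a neighborhood $U_E$ such that $g$ restricts to a homeomorphism onto its image sending edges to edges on the largest subgraph contained in $\bigcup_E U_E$, and for some $p>0$ every $U_E$ satisfies one of the following: $g^p(U_E)\subsetneq U_E$ and $(g^{pn}(U_E))_{n\ge 0}$ is a neighborhood basis for $E$; or $g^{-p}(U_E)\subsetneq U_E$ and $(g^{-pn}(U_E))_{n\ge 0}$ is a neighborhood basis for $E$. Let $Z_g=\Gamma\times[0,1]/\big((x,1)\sim(g(x),0)\big)$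 be the mapping torus of $g$, with its suspension semiflow $\psi$. The \emph{compactified mapping torus} is $W_g=Z_g\sqcup\partial_+W_g\sqcup\partial_-W_g$. The points of $\partial_+W_g$ are the forward flowlines of $\psi$ that leave every compact set, two being identified if they ever meet. The points of $\partial_-W_g$ are the flowlines $\ell:\mathbb R\to Z_g$, $\psi_s(\ell(t))=\ell(t+s)$ for $s\ge 0$, that leave every compact set as $t\to-\infty$, modulo translation of time. The topology restricts to the given one on the open subset $Z_g$; the neighborhoods of a positive (respectively negative) ideal point are the sets containing some set obtained by flowing, for all times in $(T,\infty]$, a neighborhood of a point $z$ of the corresponding flowline forward (respectively backward), where $T\geq 0$ and $z$ lies sufficiently far forward (respectively back) on the flowline. \textbf{Lemma.} Let $g:\Gamma\to\Gamma$ be an end-periodic map of an infinite connected graph with finitely many ends. If $g$ induces an injection on $\pi_1(\Gamma)$, then for every connected component $\Sigma$ of $\partial_+W_g$ or of $\partial_-W_g$ the inclusion $\Sigma\to W_g$ is $\pi_1$-injective. -/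

import Mathlib

open Set Filter Topology
open scoped NNReal unitInterval

namespace EPGraph

universe u

/-! ### Graphs, subgraphs and graph maps -/

section Graphs

variable (Γ : Type u) [TopologicalSpace Γ] [CWComplex (univ : Set Γ)]

/-- The indexing type of the cells of all dimensions of the cell complex `Γ`. -/
abbrev AnyCell : Type u := Σ n : ℕ, RelCWComplex.cell (univ : Set Γ) n

/-- The indexing type of the edges (that is, of the 1-cells) of `Γ`. -/
abbrev Edge : Type u := RelCWComplex.cell (univ : Set Γ) 1

/-- A CW complex is a graph if it has no cells of dimension at least two and is locally finite,
i.e. every point has a neighbourhood which meets only finitely many cells. -/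
structure IsGraph : Prop where
  dim_le_one : ∀ n : ℕ, 2 ≤ n → IsEmpty (RelCWComplex.cell (univ : Set Γ) n)
  locallyFinite : ∀ x : Γ, ∃ N ∈ 𝓝 x,
    {c : AnyCell Γ | (RelCWComplex.openCell (C := (univ : Set Γ)) c.1 c.2 ∩ N).Nonempty}.Finite

/-- The set of vertices (points which are 0-cells) of `Γ`. -/
def vertices : Set Γ :=
  ⋃ i : RelCWComplex.cell (univ : Set Γ) 0, RelCWComplex.openCell (C := (univ : Set Γ)) 0 i

variable {Γ}

/-- The open edge (as a set of points) with index `e`. -/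
def openEdge (e : Edge Γ) : Set Γ := RelCWComplex.openCell (C := (univ : Set Γ)) 1 e

/-- The characteristic map of the edge `e`, as a function on the interval `[-1, 1]`. -/
def edgeMap (e : Edge Γ) (t : ℝ) : Γ := RelCWComplex.map (C := (univ : Set Γ)) 1 e (fun _ => t)

/-- The largest subcomplex of `Γ` contained in `U`. -/
def largestSubgraph (U : Set Γ) : Set Γ :=
  ⋃₀ {K : Set Γ | K ⊆ U ∧
    ∃ S : RelCWComplex.Subcomplex (univ : Set Γ), (S : Set Γ) = K}

/-- A (continuous) path `ρ`, considered on `[a, b]`, is an edge path if it is either constant at a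
vertex (length zero), or there is a subdivision `a = t₀ < t₁ < ⋯ < tᵣ = b`, `r ≥ 1`, such that `ρ`
maps each open interval `(tᵢ, tᵢ₊₁)` bijectively onto an open edge. For a continuous `ρ` these
bijections are homeomorphisms. -/
def IsEdgePath (ρ : ℝ → Γ) (a b : ℝ) : Prop :=
  (∃ v ∈ vertices Γ, ∀ t ∈ Icc a b, ρ t = v) ∨
  ∃ (r : ℕ) (t : ℕ → ℝ), 0 < r ∧ t 0 = a ∧ t r = b ∧
    ∀ i < r, t i < t (i + 1) ∧
      ∃ e : Edge Γ, BijOn ρ (Ioo (t i) (t (i + 1))) (openEdge e)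

/-- A graph map: a continuous map sending vertices to vertices and edges to edge paths. -/
structure IsGraphMap (g : C(Γ, Γ)) : Prop where
  vertex : MapsTo g (vertices Γ) (vertices Γ)
  edge : ∀ e : Edge Γ, IsEdgePath (fun t => g (edgeMap e t)) (-1) 1

end Graphs

/-! ### Ends -/

section Ends

variable (Γ : Type u) [TopologicalSpace Γ]

/-- Exhaustions of `Γ` by an increasing sequence of compact sets (whose interiors cover `Γ`). -/
structure IsExhaustion {Γ : Type u} [TopologicalSpace Γ] (K : ℕ → Set Γ) : Prop where
  isCompact : ∀ n, IsCompact (K n)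
  mono : Monotone K
  iUnion_interior : ⋃ n, interior (K n) = univ

/-- A neighbourhood basis for an end: a decreasing sequence of nonempty sets `U n`, each of which
is a connected component of `Γ - K n`, for some exhaustion `K` of `Γ` by compact sets. -/
def IsEndBasis {Γ : Type u} [TopologicalSpace Γ] (U : ℕ → Set Γ) : Prop :=
  Antitone U ∧ ∃ K : ℕ → Set Γ, IsExhaustion K ∧
    ∀ n, ∃ x ∈ (K n)ᶜ, U n = connectedComponentIn (K n)ᶜ x

/-- Two neighbourhood bases represent the same end if each is cofinal in the other. -/
def endSetoid : Setoid {U : ℕ → Set Γ // IsEndBasis U} where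
  r U V := ∀ n, (∃ i, U.1 i ⊆ V.1 n) ∧ ∃ j, V.1 j ⊆ U.1 n
  iseqv :=
    { refl := fun _ n => ⟨⟨n, Subset.rfl⟩, ⟨n, Subset.rfl⟩⟩
      symm := fun h n => ⟨(h n).2, (h n).1⟩
      trans := by
        intro U V W h h' n
        obtain ⟨i, hi⟩ := (h' n).1
        obtain ⟨i', hi'⟩ := (h i).1
        obtain ⟨j, hj⟩ := (h n).2
        obtain ⟨j', hj'⟩ := (h' j).2
        exact ⟨⟨i', hi'.trans hi⟩, ⟨j', hj'.trans hj⟩⟩ }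

/-- The set of ends of `Γ`. -/
def GraphEnd : Type u := Quotient (endSetoid Γ)

variable {Γ}

/-- `U` is a neighbourhood basis for the end `E`. -/
def IsEndBasisOf (U : ℕ → Set Γ) (E : GraphEnd Γ) : Prop :=
  ∃ h : IsEndBasis U, Quotient.mk (endSetoid Γ) ⟨U, h⟩ = E

/-- An open set is a neighbourhood of the end `E` if it contains the tail of every neighbourhood
basis for `E`, but meets only finitely many terms of a neighbourhood basis of any other end. -/
structure IsEndNhd (U : Set Γ) (E : GraphEnd Γ) : Prop where
  isOpen : IsOpen U
  tail : ∀ V : ℕ → Set Γ, IsEndBasisOf V E → ∃ k, ∀ n ≥ k, V n ⊆ U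
  other : ∀ (E' : GraphEnd Γ) (V : ℕ → Set Γ), E' ≠ E → IsEndBasisOf V E' →
    {n | (V n ∩ U).Nonempty}.Finite

end Ends

/-! ### End-periodic maps -/

/-- End-periodic graph maps. There are neighbourhoods `U E` of all ends such that `g` restricts to
a homeomorphism (onto its image) sending edges to edges on the largest subgraph contained in their
union, and, for some `p > 0`, every end is attracting or repelling under the `p`-th power of `g`. -/
structure IsEndPeriodic {Γ : Type u} [TopologicalSpace Γ] [CWComplex (univ : Set Γ)]
    (g : C(Γ, Γ)) : Prop where
  isGraphMap : IsGraphMap g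
  exists_nhds : ∃ U : GraphEnd Γ → Set Γ,
    (∀ E, IsEndNhd (U E) E) ∧
    IsEmbedding ((largestSubgraph (⋃ E, U E)).domRestrict g) ∧
    (∀ e : Edge Γ, openEdge e ⊆ largestSubgraph (⋃ E, U E) →
      ∃ e' : Edge Γ, g '' openEdge e = openEdge e') ∧
    ∃ p : ℕ, 0 < p ∧ ∀ E,
      (g^[p] '' U E ⊂ U E ∧ IsEndBasisOf (fun n => g^[p * n] '' U E) E) ∨
      (g^[p] ⁻¹' U E ⊂ U E ∧ IsEndBasisOf (fun n => g^[p * n] ⁻¹' U E) E)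

/-! ### Mapping tori -/

section Torus

variable {Γ : Type u}

/-- The mapping torus of `g`: the quotient of `Γ × [0, 1]` by the equivalence relation generated
by `(x, 1) ∼ (g x, 0)`. -/
def MappingTorus (g : Γ → Γ) : Type u :=
  Quot (fun a b : Γ × I => ∃ x : Γ, a = (x, 1) ∧ b = (g x, 0))

instance [TopologicalSpace Γ] (g : Γ → Γ) : TopologicalSpace (MappingTorus g) :=
  inferInstanceAs (TopologicalSpace (Quot _))

/-- The class in the mapping torus of a point of `Γ × [0, 1]`. -/
def MappingTorus.mk (g : Γ → Γ) (a : Γ × I) : MappingTorus g := Quot.mk _ a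

/-- The suspension semiflow. A point `(x, s)` flows upwards with unit speed, so that after time `t`
it has passed `⌊s + t⌋` times through the top level `Γ × {1}`. -/
noncomputable def flow (g : Γ → Γ) (t : ℝ≥0) : MappingTorus g → MappingTorus g :=
  Quot.lift
    (fun a : Γ × I => MappingTorus.mk g
      (g^[⌊(a.2 : ℝ) + t⌋₊] a.1,
        ⟨Int.fract ((a.2 : ℝ) + t), Int.fract_nonneg _, (Int.fract_lt_one _).le⟩))
    (by
      rintro _ _ ⟨x, rfl, rfl⟩
      have h : ⌊(1 : ℝ) + t⌋₊ = ⌊(t : ℝ)⌋₊ + 1 := by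
        rw [add_comm, Nat.floor_add_one t.coe_nonneg]
      have h' : Int.fract ((1 : ℝ) + t) = Int.fract (t : ℝ) := by
        rw [add_comm, Int.fract_add_one]
      simp only [Icc.coe_one, Icc.coe_zero, zero_add, h, h', Function.iterate_succ_apply])

theorem flow_mk (g : Γ → Γ) (t : ℝ≥0) (a : Γ × I) :
    flow g t (MappingTorus.mk g a) = MappingTorus.mk g
      (g^[⌊(a.2 : ℝ) + t⌋₊] a.1,
        ⟨Int.fract ((a.2 : ℝ) + t), Int.fract_nonneg _, (Int.fract_lt_one _).le⟩) := rfl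

theorem flow_add (g : Γ → Γ) (s t : ℝ≥0) (z : MappingTorus g) :
    flow g (s + t) z = flow g t (flow g s z) := by
  obtain ⟨⟨x, a⟩, rfl⟩ := Quot.exists_rep z
  change flow g (s + t) (MappingTorus.mk g _) = flow g t (flow g s (MappingTorus.mk g _))
  simp only [flow_mk]
  have ha : (0 : ℝ) ≤ a := a.2.1
  have hs : (0 : ℝ) ≤ s := s.2
  have ht : (0 : ℝ) ≤ t := t.2
  have key : (a : ℝ) + ((s + t : ℝ≥0) : ℝ)
      = (Int.fract ((a : ℝ) + s) + t) + (⌊(a : ℝ) + s⌋₊ : ℕ) := by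
    have h1 := Int.floor_add_fract ((a : ℝ) + s)
    have h2 : ((⌊(a : ℝ) + s⌋₊ : ℕ) : ℝ) = (⌊(a : ℝ) + s⌋ : ℤ) := by
      rw [natCast_floor_eq_intCast_floor (by positivity)]
    rw [h2]; push_cast; linarith
  have hf : ⌊(a : ℝ) + ((s + t : ℝ≥0) : ℝ)⌋₊
      = ⌊Int.fract ((a : ℝ) + s) + t⌋₊ + ⌊(a : ℝ) + s⌋₊ := by
    rw [key, Nat.floor_add_natCast (by have := Int.fract_nonneg ((a : ℝ) + s); positivity)]
  have hr : Int.fract ((a : ℝ) + ((s + t : ℝ≥0) : ℝ))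
      = Int.fract (Int.fract ((a : ℝ) + s) + t) := by
    rw [key, Int.fract_add_natCast]
  simp only [hf, hr, Function.iterate_add_apply]

end Torus

/-! ### The compactified mapping torus -/

section Compactification

variable {Γ : Type u} [TopologicalSpace Γ]

/-- Points of the mapping torus whose forward flowline leaves every compact set. -/
def PosEscaping (g : Γ → Γ) : Type u :=
  {z : MappingTorus g // Tendsto (fun t : ℝ≥0 => flow g t z) atTop (cocompact (MappingTorus g))}

/-- Complete flowlines (defined for all times, negative times included) which leave every compact
set in backward time. -/
def NegEscaping (g : Γ → Γ) : Type u :=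
  {l : ℝ → MappingTorus g // (∀ (a : ℝ) (s : ℝ≥0), l (a + s) = flow g s (l a)) ∧
    Tendsto l atBot (cocompact (MappingTorus g))}

/-- Two escaping forward flowlines are equivalent if they ever meet. -/
def posSetoid (g : Γ → Γ) : Setoid (PosEscaping g) where
  r z w := ∃ s t : ℝ≥0, flow g s z.1 = flow g t w.1
  iseqv :=
    { refl := fun _ => ⟨0, 0, rfl⟩
      symm := fun ⟨s, t, h⟩ => ⟨t, s, h.symm⟩
      trans := by
        rintro z w v ⟨s, t, h⟩ ⟨s', t', h'⟩
        refine ⟨s + s', t' + t, ?_⟩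
        rw [flow_add, h, flow_add, ← h', ← flow_add, ← flow_add, add_comm] }

/-- Two parametrized complete flowlines are identified if they differ by a translation of time. -/
def negSetoid (g : Γ → Γ) : Setoid (NegEscaping g) where
  r l l' := ∃ a : ℝ, ∀ t : ℝ, l'.1 t = l.1 (t + a)
  iseqv :=
    { refl := fun _ => ⟨0, fun t => by rw [add_zero]⟩
      symm := fun ⟨a, h⟩ => ⟨-a, fun t => by rw [h, neg_add_cancel_right]⟩
      trans := fun ⟨a, h⟩ ⟨b, h'⟩ => ⟨b + a, fun t => by rw [h', h, add_assoc]⟩ }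

/-- The ideal points which compactify the forward flowlines. -/
def PosIdeal (g : Γ → Γ) : Type u := Quotient (posSetoid g)

/-- The ideal points which compactify the backward flowlines. -/
def NegIdeal (g : Γ → Γ) : Type u := Quotient (negSetoid g)

/-- The compactified mapping torus: the disjoint union of the mapping torus with the two sets of
ideal points. -/
inductive CompactifiedTorus (g : Γ → Γ) : Type u
  | inner (z : MappingTorus g) : CompactifiedTorus g
  | pos (ξ : PosIdeal g) : CompactifiedTorus g
  | neg (ξ : NegIdeal g) : CompactifiedTorus g

namespace CompactifiedTorus

variable {g : Γ → Γ}

/-- The ideal point in which the forward flowline of `z` ends. -/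
def posLimit (z : PosEscaping g) : CompactifiedTorus g := pos (Quotient.mk (posSetoid g) z)

/-- The ideal point from which the flowline `l` emanates. -/
def negLimit (l : NegEscaping g) : CompactifiedTorus g := neg (Quotient.mk (negSetoid g) l)

/-- `O` contains a set obtained by flowing a neighbourhood of `z` forward for all times in
`(T, ∞]`. -/
def FlowNhdPos (O : Set (CompactifiedTorus g)) (z : MappingTorus g) : Prop :=
  ∃ N ∈ 𝓝 z, ∃ T : ℝ≥0,
    (∀ w ∈ N, ∀ t : ℝ≥0, T < t → inner (flow g t w) ∈ O) ∧
    ∀ w : PosEscaping g, w.1 ∈ N → posLimit w ∈ O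

/-- `O` contains a set obtained by flowing a neighbourhood of `z` backward for all times in
`(T, ∞]`. -/
def FlowNhdNeg (O : Set (CompactifiedTorus g)) (z : MappingTorus g) : Prop :=
  ∃ N ∈ 𝓝 z, ∃ T : ℝ≥0,
    (∀ (w : MappingTorus g) (t : ℝ≥0), T < t → flow g t w ∈ N → inner w ∈ O) ∧
    ∀ (l : NegEscaping g) (a : ℝ), l.1 a ∈ N → negLimit l ∈ O

theorem FlowNhdPos.inter {O O' : Set (CompactifiedTorus g)} {z : MappingTorus g}
    (h : FlowNhdPos O z) (h' : FlowNhdPos O' z) : FlowNhdPos (O ∩ O') z := by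
  obtain ⟨N, hN, T, h1, h2⟩ := h
  obtain ⟨N', hN', T', h1', h2'⟩ := h'
  refine ⟨N ∩ N', inter_mem hN hN', max T T', fun w hw t ht => ?_, fun w hw => ?_⟩
  · exact ⟨h1 w hw.1 t (lt_of_le_of_lt (le_max_left _ _) ht),
      h1' w hw.2 t (lt_of_le_of_lt (le_max_right _ _) ht)⟩
  · exact ⟨h2 w hw.1, h2' w hw.2⟩

theorem FlowNhdPos.mono {O O' : Set (CompactifiedTorus g)} {z : MappingTorus g}
    (h : FlowNhdPos O z) (hO : O ⊆ O') : FlowNhdPos O' z := by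
  obtain ⟨N, hN, T, h1, h2⟩ := h
  exact ⟨N, hN, T, fun w hw t ht => hO (h1 w hw t ht), fun w hw => hO (h2 w hw)⟩

theorem FlowNhdNeg.inter {O O' : Set (CompactifiedTorus g)} {z : MappingTorus g}
    (h : FlowNhdNeg O z) (h' : FlowNhdNeg O' z) : FlowNhdNeg (O ∩ O') z := by
  obtain ⟨N, hN, T, h1, h2⟩ := h
  obtain ⟨N', hN', T', h1', h2'⟩ := h'
  refine ⟨N ∩ N', inter_mem hN hN', max T T', fun w t ht hw => ?_, fun l a hl => ?_⟩
  · exact ⟨h1 w t (lt_of_le_of_lt (le_max_left _ _) ht) hw.1,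
      h1' w t (lt_of_le_of_lt (le_max_right _ _) ht) hw.2⟩
  · exact ⟨h2 l a hl.1, h2' l a hl.2⟩

theorem FlowNhdNeg.mono {O O' : Set (CompactifiedTorus g)} {z : MappingTorus g}
    (h : FlowNhdNeg O z) (hO : O ⊆ O') : FlowNhdNeg O' z := by
  obtain ⟨N, hN, T, h1, h2⟩ := h
  exact ⟨N, hN, T, fun w t ht hw => hO (h1 w t ht hw), fun l a hl => hO (h2 l a hl)⟩

/-- The topology of the compactified mapping torus. The neighbourhoods of points of the mapping
torus are the usual ones; those of a positive ideal point are given by flowing neighbourhoods of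
the points of its flowlines forward, and those of a negative ideal point by flowing neighbourhoods
of the points which lie sufficiently far back on its flowline backward. -/
instance : TopologicalSpace (CompactifiedTorus g) where
  IsOpen O := IsOpen (inner ⁻¹' O) ∧
    (∀ z : PosEscaping g, posLimit z ∈ O → FlowNhdPos O z.1) ∧
    (∀ l : NegEscaping g, negLimit l ∈ O → ∀ᶠ a in atBot, FlowNhdNeg O (l.1 a))
  isOpen_univ := ⟨isOpen_univ,
    fun _ _ => ⟨univ, univ_mem, 0, fun _ _ _ _ => mem_univ _, fun _ _ => mem_univ _⟩,
    fun _ _ => Eventually.of_forall fun _ =>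
      ⟨univ, univ_mem, 0, fun _ _ _ _ => mem_univ _, fun _ _ _ => mem_univ _⟩⟩
  isOpen_inter := fun _ _ h h' => ⟨h.1.inter h'.1,
    fun z hz => (h.2.1 z hz.1).inter (h'.2.1 z hz.2),
    fun l hl => ((h.2.2 l hl.1).and (h'.2.2 l hl.2)).mono fun _ ha => ha.1.inter ha.2⟩
  isOpen_sUnion := fun S hS => by
    refine ⟨?_, ?_, ?_⟩
    · rw [preimage_sUnion]
      exact isOpen_biUnion fun O hO => (hS O hO).1
    · rintro z ⟨O, hO, hz⟩
      exact ((hS O hO).2.1 z hz).mono (subset_sUnion_of_mem hO)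
    · rintro l ⟨O, hO, hl⟩
      exact ((hS O hO).2.2 l hl).mono fun _ ha => ha.mono (subset_sUnion_of_mem hO)

variable (g)

/-- The positive boundary of the compactified mapping torus. -/
def posBoundary : Set (CompactifiedTorus g) := range pos

/-- The negative boundary of the compactified mapping torus. -/
def negBoundary : Set (CompactifiedTorus g) := range neg

variable {g}

/-- `S` is a connected component of the positive or of the negative boundary. -/
def IsBoundaryComponent (S : Set (CompactifiedTorus g)) : Prop :=
  (∃ ξ ∈ posBoundary g, S = connectedComponentIn (posBoundary g) ξ) ∨
  ∃ ξ ∈ negBoundary g, S = connectedComponentIn (negBoundary g) ξ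

end CompactifiedTorus

end Compactification

/-- A continuous map is `π₁`-injective if it induces an injection on fundamental groups, for every
choice of base point. -/
def PiOneInjective {X Y : Type*} [TopologicalSpace X] [TopologicalSpace Y] (f : C(X, Y)) : Prop :=
  ∀ x : X, Function.Injective (FundamentalGroup.map f x)

/-- The inclusion of a subspace, as a continuous map. -/
def inclusionMap {X : Type*} [TopologicalSpace X] (S : Set X) : C(S, X) :=
  ⟨Subtype.val, continuous_subtype_val⟩

end EPGraph

namespace EPGraph

set_option linter.unusedSectionVars false

/-! ### Cells of graphs -/

section Cells

variable {Γ : Type u} [TopologicalSpace Γ] [CWComplex (univ : Set Γ)]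

/-! A loop in a boundary component that is null homotopic in `W_g` is the left side of a square `H`
in `W_g` that is constant on the other three sides. It suffices to find a square with the same
boundary values inside the positive (or negative) boundary: its image is connected, so it stays in
the component.

To bring `H` into `Γ`, the ideal points have to be removed. Near the ends `g` behaves like a shift,
which yields an attracting region `A` with `g(A) ⊆ A` and a repelling region `R` with `g⁻¹(R) ⊆ R`,
on both of which `g` is injective. Summing a bump function along orbits gives functions on `Γ` that
change by exactly one under `g` far out in these regions, and their extensions to `Z_g` change at
unit speed along the flow there. Moving points along flowlines to a fixed level of these functions
defines continuous self maps `pushPos` and `pushNeg` of `W_g`, which together send every ideal point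
to a point of `Z_g` on its own flowline. After these pushes `H` lies in `Z_g`. The circle-valued
height of `Z_g` lifts to a real function on the square, and flowing every point up to one common
integer height gives a square `G` in `Γ`.

The input from graphs is `IsGraph.exists_square_in_subgraph`: a square whose boundary lies in a
subgraph can be replaced by one inside the subgraph. Edges are removed one at a time, by wrapping an
edge around the circle and lifting to the line.

For the positive boundary, enough iterates of `g` carry the left side of `G` into a subgraph
contained in `A`. The square is replaced by one in that subgraph, and sending a point of `A` to the
end of its flowline maps it to the positive boundary (`IsGraph.exists_square_posBoundary`).

For the negative boundary, flowing forward moves away from `R`, so the left side of `G` need not lie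
deep in `R`. It is, however, the image under a power of `g` of a loop `c` deep in `R`. Since `g` is
injective on `π₁`, the loop `c` is itself null homotopic. It lies in a subgraph all of whose points
have backward orbits, and sending such a point to the origin of its flowline maps the resulting
square to the negative boundary (`IsGraph.exists_square_negBoundary`). -/

/-- The closed cell with index `c`. -/
def cellC (c : AnyCell Γ) : Set Γ := RelCWComplex.closedCell (C := (univ : Set Γ)) c.1 c.2

/-- The open cell with index `c`. -/
def cellO (c : AnyCell Γ) : Set Γ := RelCWComplex.openCell (C := (univ : Set Γ)) c.1 c.2

theorem exists_mem_cellO (x : Γ) : ∃ c : AnyCell Γ, x ∈ cellO c := by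
  have : x ∈ (univ : Set Γ) := mem_univ x
  rw [← CWComplex.iUnion_openCell_eq_complex (C := (univ : Set Γ))] at this
  simp only [mem_iUnion] at this
  obtain ⟨n, j, h⟩ := this
  exact ⟨⟨n, j⟩, h⟩

theorem cellO_subset_cellC (c : AnyCell Γ) : cellO c ⊆ cellC c :=
  RelCWComplex.openCell_subset_closedCell c.1 c.2

theorem cellO_nonempty (c : AnyCell Γ) : (cellO c).Nonempty :=
  RelCWComplex.openCell_nonempty c.1 c.2

theorem eq_of_mem_cellO {c d : AnyCell Γ} {x : Γ} (hc : x ∈ cellO c) (hd : x ∈ cellO d) :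
    c = d := by
  apply RelCWComplex.eq_of_not_disjoint_openCell (C := (univ : Set Γ))
  exact not_disjoint_iff.2 ⟨x, hc, hd⟩

theorem isCompact_cellC (c : AnyCell Γ) : IsCompact (cellC c) :=
  RelCWComplex.isCompact_closedCell

theorem isPreconnected_cellC (c : AnyCell Γ) : IsPreconnected (cellC c) :=
  (convex_closedBall _ _).isPreconnected.image _ (RelCWComplex.continuousOn c.1 c.2)

variable [T2Space Γ]

theorem closure_cellO (c : AnyCell Γ) : closure (cellO c) = cellC c :=
  RelCWComplex.closure_openCell_eq_closedCell

theorem isClosed_cellC (c : AnyCell Γ) : IsClosed (cellC c) := (isCompact_cellC c).isClosed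

/-- A set of points is a subgraph if it contains the closure of every cell that it meets. -/
def IsSubgraph (S : Set Γ) : Prop := ∀ c : AnyCell Γ, (cellO c ∩ S).Nonempty → cellC c ⊆ S

variable (hΓ : IsGraph Γ)
include hΓ

theorem IsGraph.fst_eq (c : AnyCell Γ) : c.1 = 0 ∨ c.1 = 1 := by
  by_contra! h
  have := hΓ.dim_le_one c.1 (by have := h.1; have := h.2; omega)
  exact this.elim c.2

/-- An open set that meets the closure of an open cell meets the open cell, so the interior of a
neighbourhood that is good for open cells is good for closed ones. -/
theorem IsGraph.locallyFinite_cellC : LocallyFinite (fun c : AnyCell Γ => cellC c) := by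
  intro x
  obtain ⟨N, hN, hfin⟩ := hΓ.locallyFinite x
  refine ⟨interior N, interior_mem_nhds.2 hN, hfin.subset ?_⟩
  rintro c ⟨y, hy, hyN⟩
  simp only [← closure_cellO] at hy
  obtain ⟨z, hz, hz'⟩ := mem_closure_iff.1 hy _ isOpen_interior hyN
  exact ⟨z, hz', interior_subset hz⟩

theorem IsGraph.finite_cellC_inter {K : Set Γ} (hK : IsCompact K) :
    {c : AnyCell Γ | (cellC c ∩ K).Nonempty}.Finite :=
  hΓ.locallyFinite_cellC.finite_nonempty_inter_compact hK

theorem IsGraph.isClosed_biUnion (J : Set (AnyCell Γ)) : IsClosed (⋃ c ∈ J, cellC c) := by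
  rw [biUnion_eq_iUnion]
  exact (hΓ.locallyFinite_cellC.comp_injective Subtype.val_injective).isClosed_iUnion
    (fun c => isClosed_cellC _)

omit hΓ in
theorem cellC_eq_cellO_of_fst_eq_zero {c : AnyCell Γ} (h : c.1 = 0) : cellC c = cellO c := by
  obtain ⟨n, i⟩ := c
  obtain rfl : n = 0 := h
  simp only [cellC, cellO, RelCWComplex.openCell_zero_eq_singleton,
    RelCWComplex.closedCell_zero_eq_singleton]

omit hΓ in
theorem mem_cellC_edge {e : Edge Γ} {x : Γ} (hx : x ∈ cellC ⟨1, e⟩) :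
    x ∈ openEdge e ∨ x = edgeMap e (-1) ∨ x = edgeMap e 1 := by
  have h := RelCWComplex.cellFrontier_union_openCell_eq_closedCell (C := (univ : Set Γ)) 1 e
  have hx' : x ∈ RelCWComplex.closedCell (C := (univ : Set Γ)) 1 e := hx
  rw [← h, RelCWComplex.cellFrontier_one_eq] at hx'
  rcases hx' with ⟨f, hf | hf, rfl⟩ | hx'
  · right; left; subst hf; rfl
  · right; right; rw [mem_singleton_iff] at hf; subst hf; rfl
  · exact Or.inl hx'

omit hΓ in
theorem edgeMap_endpoint (e : Edge Γ) {t : ℝ} (ht : t = -1 ∨ t = 1) :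
    ∃ v : AnyCell Γ, v.1 = 0 ∧ edgeMap e t ∈ cellO v := by
  obtain ⟨x, y, h⟩ := CWComplex.exists_cellFrontier_one_eq (C := (univ : Set Γ)) e
  have : edgeMap e t ∈ RelCWComplex.cellFrontier (C := (univ : Set Γ)) 1 e := by
    rw [RelCWComplex.cellFrontier_one_eq]
    refine ⟨fun _ => t, ?_, rfl⟩
    rcases ht with rfl | rfl
    · left; rfl
    · right; rfl
  rw [h] at this
  rcases this with h | h
  · exact ⟨⟨0, x⟩, rfl, by rw [← cellC_eq_cellO_of_fst_eq_zero rfl]; exact h⟩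
  · exact ⟨⟨0, y⟩, rfl, by rw [← cellC_eq_cellO_of_fst_eq_zero rfl]; exact h⟩

omit [T2Space Γ] hΓ in
theorem edgeMap_mem_cellC (e : Edge Γ) {t : ℝ} (ht : t ∈ Icc (-1 : ℝ) 1) :
    edgeMap e t ∈ cellC ⟨1, e⟩ := by
  refine ⟨fun _ => t, ?_, rfl⟩
  rw [mem_closedBall_zero_iff, pi_norm_le_iff_of_nonneg zero_le_one]
  intro _
  exact abs_le.2 ht

omit [T2Space Γ] hΓ in
theorem edgeMap_mem_openEdge (e : Edge Γ) {t : ℝ} (ht : t ∈ Ioo (-1 : ℝ) 1) :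
    edgeMap e t ∈ openEdge e := by
  refine ⟨fun _ => t, ?_, rfl⟩
  rw [mem_ball_zero_iff, pi_norm_lt_iff zero_lt_one]
  intro _
  exact abs_lt.2 ht

omit [T2Space Γ] hΓ in
theorem exists_edgeMap_eq {e : Edge Γ} {x : Γ} (hx : x ∈ cellC ⟨1, e⟩) :
    ∃ t ∈ Icc (-1 : ℝ) 1, edgeMap e t = x := by
  obtain ⟨f, hf, rfl⟩ := hx
  rw [mem_closedBall_zero_iff, pi_norm_le_iff_of_nonneg zero_le_one] at hf
  refine ⟨f 0, abs_le.1 (hf 0), ?_⟩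
  unfold edgeMap
  congr 1
  funext i
  rw [Subsingleton.elim i 0]

omit [T2Space Γ] hΓ in
theorem exists_edgeMap_eq_of_mem_openEdge {e : Edge Γ} {x : Γ} (hx : x ∈ openEdge e) :
    ∃ t ∈ Ioo (-1 : ℝ) 1, edgeMap e t = x := by
  obtain ⟨f, hf, rfl⟩ := hx
  rw [mem_ball_zero_iff, pi_norm_lt_iff zero_lt_one] at hf
  refine ⟨f 0, abs_lt.1 (hf 0), ?_⟩
  unfold edgeMap
  congr 1
  funext i
  rw [Subsingleton.elim i 0]

omit [T2Space Γ] hΓ in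
theorem edgeMap_injOn (e : Edge Γ) : InjOn (edgeMap e) (Ioo (-1 : ℝ) 1) := by
  intro s hs t ht h
  have hinj := (RelCWComplex.map (C := (univ : Set Γ)) 1 e).injOn
  rw [RelCWComplex.source_eq] at hinj
  have key : ∀ r ∈ Ioo (-1 : ℝ) 1, (fun _ : Fin 1 => r) ∈ Metric.ball (0 : Fin 1 → ℝ) 1 := by
    intro r hr
    rw [mem_ball_zero_iff, pi_norm_lt_iff zero_lt_one]
    intro _
    exact abs_lt.2 hr
  exact congrFun (hinj (key s hs) (key t ht) h) 0

omit [T2Space Γ] hΓ in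
theorem continuousOn_edgeMap (e : Edge Γ) : ContinuousOn (edgeMap e) (Icc (-1 : ℝ) 1) := by
  refine (RelCWComplex.continuousOn (C := (univ : Set Γ)) 1 e).comp
    (f := fun (t : ℝ) (_ : Fin 1) => t) (by fun_prop) ?_
  intro t ht
  rw [mem_closedBall_zero_iff, pi_norm_le_iff_of_nonneg zero_le_one]
  intro _
  exact abs_le.2 ht

/-- A point of a closed cell lies in the open cell or is a vertex. -/
theorem IsGraph.mem_cellO_or {c : AnyCell Γ} {x : Γ} (hx : x ∈ cellC c) :
    x ∈ cellO c ∨ ∃ v : AnyCell Γ, v.1 = 0 ∧ x ∈ cellO v := by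
  rcases hΓ.fst_eq c with h | h
  · left; rwa [← cellC_eq_cellO_of_fst_eq_zero h]
  · obtain ⟨n, e⟩ := c
    obtain rfl : n = 1 := h
    rcases mem_cellC_edge hx with h | rfl | rfl
    · exact Or.inl h
    · exact Or.inr (edgeMap_endpoint e (Or.inl rfl))
    · exact Or.inr (edgeMap_endpoint e (Or.inr rfl))

/-- In dimension at most one, a point of a closed cell is either in its open cell, so that the two
cells agree, or a vertex, whose closed cell is that single point. -/
theorem IsGraph.cellC_subset_of_mem {c d : AnyCell Γ} {x : Γ} (hx : x ∈ cellC c)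
    (hd : x ∈ cellO d) : cellC d ⊆ cellC c := by
  rcases hΓ.mem_cellO_or hx with h | ⟨v, hv, h⟩
  · rw [eq_of_mem_cellO h hd]
  · obtain rfl := eq_of_mem_cellO h hd
    obtain ⟨n, i⟩ := v
    obtain rfl : n = 0 := hv
    have h0 : cellC (⟨0, i⟩ : AnyCell Γ) = {x} := by
      rw [cellC_eq_cellO_of_fst_eq_zero rfl]
      simp only [cellO, RelCWComplex.openCell_zero_eq_singleton] at h ⊢
      rw [mem_singleton_iff.1 h]
    rw [h0]
    exact singleton_subset_iff.2 hx

theorem IsGraph.isSubgraph_biUnion (J : Set (AnyCell Γ)) : IsSubgraph (⋃ c ∈ J, cellC c) := by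
  rintro d ⟨x, hxd, hx⟩
  simp only [mem_iUnion] at hx
  obtain ⟨c, hc, hx⟩ := hx
  exact (hΓ.cellC_subset_of_mem hx hxd).trans (subset_biUnion_of_mem hc)

omit [T2Space Γ] hΓ in
theorem IsSubgraph.eq_biUnion {S : Set Γ} (hS : IsSubgraph S) :
    S = ⋃ c ∈ {c : AnyCell Γ | cellC c ⊆ S}, cellC c := by
  apply Subset.antisymm
  · intro x hx
    obtain ⟨c, hc⟩ := exists_mem_cellO x
    exact mem_biUnion (hS c ⟨x, hc, hx⟩ : _) (cellO_subset_cellC c hc)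
  · exact iUnion₂_subset fun c hc => hc

theorem IsGraph.isClosed_of_isSubgraph {S : Set Γ} (hS : IsSubgraph S) : IsClosed S := by
  rw [hS.eq_biUnion]; exact hΓ.isClosed_biUnion _

theorem IsGraph.isOpen_openEdge (e : Edge Γ) : IsOpen (openEdge e) := by
  have h : (openEdge e)ᶜ = ⋃ c ∈ {c : AnyCell Γ | c ≠ ⟨1, e⟩}, cellC c := by
    ext x
    simp only [mem_compl_iff, mem_iUnion, mem_ofPred_eq]
    constructor
    · intro hx
      obtain ⟨c, hc⟩ := exists_mem_cellO x
      exact ⟨c, fun h => hx (by subst h; exact hc), cellO_subset_cellC c hc⟩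
    · rintro ⟨c, hc, hx⟩ hxe
      rcases hΓ.mem_cellO_or hx with h | ⟨v, hv, h⟩
      · exact hc (eq_of_mem_cellO h hxe)
      · have := eq_of_mem_cellO (d := ⟨1, e⟩) h hxe
        subst this
        exact one_ne_zero hv
  rw [← isClosed_compl_iff, h]
  exact hΓ.isClosed_biUnion _

theorem IsGraph.weaklyLocallyCompactSpace : WeaklyLocallyCompactSpace Γ where
  exists_compact_mem_nhds x := by
    obtain ⟨N, hN, hfin⟩ := hΓ.locallyFinite x
    refine ⟨⋃ c ∈ {c : AnyCell Γ | (cellO c ∩ N).Nonempty}, cellC c,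
      Finite.isCompact_biUnion hfin fun c _ => isCompact_cellC c, mem_of_superset hN ?_⟩
    intro y hy
    obtain ⟨c, hc⟩ := exists_mem_cellO y
    exact mem_biUnion (⟨y, hc, hy⟩ : c ∈ {c : AnyCell Γ | (cellO c ∩ N).Nonempty})
      (cellO_subset_cellC c hc)

omit hΓ in
-- Closedness of the complement of a component `V` is tested on closed cells. A small convex piece
-- of the closed ball around a point over `V` has connected image in `O`, hence in `V`. So the
-- preimage of `V` is relatively open in the ball, and what remains is the image of a compact set.
theorem locallyConnectedSpace_of_cwComplex : LocallyConnectedSpace Γ := by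
  rw [locallyConnectedSpace_iff_connectedComponentIn_open]
  intro O hO x _
  set V := connectedComponentIn O x
  rw [← isClosed_compl_iff, CWComplex.closed (univ : Set Γ) _ (subset_univ _)]
  intro n j
  set φ := RelCWComplex.map (C := (univ : Set Γ)) n j
  have hφ : ContinuousOn φ (Metric.closedBall 0 1) := RelCWComplex.continuousOn n j
  have hopen : ∃ W : Set (Fin n → ℝ), IsOpen W ∧
      φ ⁻¹' V ∩ Metric.closedBall 0 1 = W ∩ Metric.closedBall 0 1 := by
    obtain ⟨W₀, hW₀, hW₀'⟩ := (continuousOn_iff'.1 hφ) O hO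
    refine ⟨{t | ∃ ε > 0, Metric.ball t ε ∩ Metric.closedBall 0 1 ⊆ φ ⁻¹' V}, ?_, ?_⟩
    · rw [Metric.isOpen_iff]
      rintro t ⟨ε, hε, ht⟩
      refine ⟨ε / 2, by positivity, fun s hs => ⟨ε / 2, by positivity, ?_⟩⟩
      refine (inter_subset_inter_left _ (Metric.ball_subset_ball' ?_)).trans ht
      rw [Metric.mem_ball] at hs
      linarith
    · ext t
      constructor
      · rintro ⟨htV, ht⟩
        refine ⟨?_, ht⟩
        have htO : t ∈ W₀ ∩ Metric.closedBall 0 1 := by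
          rw [← hW₀']; exact ⟨connectedComponentIn_subset O x htV, ht⟩
        obtain ⟨ε, hε, hb⟩ := Metric.isOpen_iff.1 hW₀ t htO.1
        refine ⟨ε, hε, ?_⟩
        have hpre : IsPreconnected (φ '' (Metric.ball t ε ∩ Metric.closedBall 0 1)) :=
          ((convex_ball _ _).inter (convex_closedBall _ _)).isPreconnected.image _
            (hφ.mono inter_subset_right)
        have hsub : φ '' (Metric.ball t ε ∩ Metric.closedBall 0 1) ⊆ O := by
          rintro _ ⟨s, hs, rfl⟩
          have : s ∈ W₀ ∩ Metric.closedBall 0 1 := ⟨hb hs.1, hs.2⟩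
          rw [← hW₀'] at this
          exact this.1
        have := hpre.subset_connectedComponentIn (x := φ t)
          ⟨t, ⟨Metric.mem_ball_self hε, ht⟩, rfl⟩ hsub
        rw [← connectedComponentIn_eq htV] at this
        exact image_subset_iff.1 this
      · rintro ⟨⟨ε, hε, h⟩, ht⟩
        exact ⟨h ⟨Metric.mem_ball_self hε, ht⟩, ht⟩
  obtain ⟨W, hW, hWV⟩ := hopen
  have : Vᶜ ∩ RelCWComplex.closedCell (C := (univ : Set Γ)) n j =
      φ '' (Metric.closedBall 0 1 \ W) := by
    ext y
    constructor
    · rintro ⟨hy, t, ht, rfl⟩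
      refine ⟨t, ⟨ht, fun htW => hy ?_⟩, rfl⟩
      have : t ∈ W ∩ Metric.closedBall 0 1 := ⟨htW, ht⟩
      rw [← hWV] at this
      exact this.1
    · rintro ⟨t, ⟨ht, htW⟩, rfl⟩
      refine ⟨fun htV => htW ?_, t, ht, rfl⟩
      have : t ∈ φ ⁻¹' V ∩ Metric.closedBall 0 1 := ⟨htV, ht⟩
      rw [hWV] at this
      exact this.1
  rw [this]
  exact (((isCompact_closedBall _ _).diff hW).image_of_continuousOn
    (hφ.mono sdiff_subset)).isClosed

/-- From one closed cell, adjoin repeatedly all closed cells that meet the set built so far; by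
local finiteness each stage is compact. The union and its complement are both subgraphs, hence
closed, and connectedness makes the union everything. -/
theorem IsGraph.sigmaCompactSpace [ConnectedSpace Γ] : SigmaCompactSpace Γ := by
  obtain ⟨x₀⟩ := (inferInstance : Nonempty Γ)
  obtain ⟨c₀, hc₀⟩ := exists_mem_cellO x₀
  let F : Set Γ → Set Γ := fun K => ⋃ c ∈ {c : AnyCell Γ | (cellC c ∩ K).Nonempty}, cellC c
  let K : ℕ → Set Γ := fun n => F^[n] (cellC c₀)
  have hK : ∀ n, IsCompact (K n) := by
    intro n
    induction n with
    | zero => exact isCompact_cellC c₀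
    | succ n ih =>
      simp only [K, Function.iterate_succ_apply']
      exact Finite.isCompact_biUnion (hΓ.finite_cellC_inter ih) fun c _ => isCompact_cellC c
  have hmeet : ∀ c : AnyCell Γ, (cellC c ∩ ⋃ n, K n).Nonempty → cellC c ⊆ ⋃ n, K n := by
    rintro c ⟨y, hyc, hy⟩
    obtain ⟨n, hn⟩ := mem_iUnion.1 hy
    refine Subset.trans ?_ (subset_iUnion K (n + 1))
    simp only [K, Function.iterate_succ_apply']
    exact subset_biUnion_of_mem (u := fun c => cellC c) (⟨y, hyc, hn⟩ : _)
  have h1 : IsClosed (⋃ n, K n) := hΓ.isClosed_of_isSubgraph fun c ⟨y, hy, hy'⟩ =>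
    hmeet c ⟨y, cellO_subset_cellC c hy, hy'⟩
  have h2 : IsClosed (⋃ n, K n)ᶜ := hΓ.isClosed_of_isSubgraph fun c ⟨y, hy, hy'⟩ => by
    rw [subset_compl_iff_disjoint_right]
    by_contra h
    rw [not_disjoint_iff_nonempty_inter] at h
    exact hy' (hmeet c h (cellO_subset_cellC c hy))
  have h3 : (⋃ n, K n) = univ :=
    IsClopen.eq_univ ⟨h1, isClosed_compl_iff.1 h2⟩
      ⟨x₀, mem_iUnion.2 ⟨0, cellO_subset_cellC c₀ hc₀⟩⟩
  exact ⟨⟨K, hK, h3⟩⟩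

theorem IsGraph.subset_largestSubgraph {S U : Set Γ} (hS : IsSubgraph S) (hSU : S ⊆ U) :
    S ⊆ largestSubgraph U := by
  intro x hx
  refine ⟨S, ⟨hSU, ⟨S, fun n => {i | cellC (⟨n, i⟩ : AnyCell Γ) ⊆ S},
    hΓ.isClosed_of_isSubgraph hS, ?_⟩, rfl⟩, hx⟩
  rw [empty_union]
  apply Subset.antisymm
  · refine iUnion₂_subset fun n i => ?_
    exact (cellO_subset_cellC (⟨n, i.1⟩ : AnyCell Γ)).trans i.2
  · intro y hy
    obtain ⟨c, hc⟩ := exists_mem_cellO y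
    exact mem_iUnion₂.2 ⟨c.1, ⟨c.2, hS c ⟨y, hc, hy⟩⟩, hc⟩

theorem IsGraph.cellC_subset_largestSubgraph {c : AnyCell Γ} {U : Set Γ} (h : cellC c ⊆ U) :
    cellC c ⊆ largestSubgraph U := by
  refine hΓ.subset_largestSubgraph (S := cellC c) ?_ h
  have := hΓ.isSubgraph_biUnion {c}
  simpa using this

end Cells

/-! ### Lifting maps from the square to the circle -/

/-- The map is extended to the plane through the retraction onto the square, lifted there, and
restricted back. -/
theorem exists_lift_square (f : C(I × I, AddCircle (1 : ℝ))) (z₀ : I × I) (r : ℝ)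
    (hr : (r : AddCircle (1 : ℝ)) = f z₀) :
    ∃ h : C(I × I, ℝ), h z₀ = r ∧ ∀ z, (h z : AddCircle (1 : ℝ)) = f z := by
  let P : C(ℝ × ℝ, I × I) :=
    ⟨fun w => (projIcc 0 1 zero_le_one w.1, projIcc 0 1 zero_le_one w.2), by fun_prop⟩
  let J : C(I × I, ℝ × ℝ) := ⟨fun z => (z.1, z.2), by fun_prop⟩
  have hPJ : ∀ z, P (J z) = z := fun z => by
    simp [P, J]
  obtain ⟨F, ⟨hF, hF'⟩, -⟩ := (AddCircle.isCoveringMap_coe (1 : ℝ)).existsUnique_continuousMap_lifts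
    (f.comp P) (J z₀) r (by rw [ContinuousMap.comp_apply, hPJ]; exact hr)
  refine ⟨F.comp J, hF, fun z => ?_⟩
  have := congrFun hF' (J z)
  simpa [hPJ] using this

theorem lift_eq_of_isPreconnected {X : Type*} [TopologicalSpace X] {h : X → ℝ} (hc : Continuous h)
    {B : Set X} (hB : IsPreconnected B) {r : ℝ}
    (hr : ∀ z ∈ B, (h z : AddCircle (1 : ℝ)) = r) {z₀ : X} (hz₀ : z₀ ∈ B) (h₀ : h z₀ = r) :
    ∀ z ∈ B, h z = r :=
  (AddCircle.isCoveringMap_coe (1 : ℝ)).eqOn_of_comp_eqOn (g₂ := fun _ => r) hB hc.continuousOn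
    continuousOn_const (fun z hz => hr z hz) hz₀ h₀

/-- The boundary of the unit square. -/
def squareBoundary : Set (I × I) := {z | z.1 = 0 ∨ z.1 = 1 ∨ z.2 = 0 ∨ z.2 = 1}

/-- The boundary of the unit square without the interior of its left side. -/
def squareSides : Set (I × I) := {z | z.1 = 1 ∨ z.2 = 0 ∨ z.2 = 1}

theorem isPreconnected_squareSides : IsPreconnected squareSides := by
  have h1 : IsPreconnected {z : I × I | z.1 = 1} := by
    have : {z : I × I | z.1 = 1} = range (fun t : I => ((1 : I), t)) := by
      ext ⟨a, b⟩
      simp [eq_comm]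
    rw [this]
    exact isPreconnected_range (by fun_prop)
  have h2 : ∀ c : I, IsPreconnected {z : I × I | z.2 = c} := by
    intro c
    have : {z : I × I | z.2 = c} = range (fun t : I => (t, c)) := by
      ext ⟨a, b⟩
      simp [eq_comm]
    rw [this]
    exact isPreconnected_range (by fun_prop)
  have h12 := (IsPreconnected.union' (s := {z : I × I | z.1 = 1}) (t := {z : I × I | z.2 = 0})
    ⟨((1 : I), (0 : I)), rfl, rfl⟩ h1 (h2 0)).union' (t := {z : I × I | z.2 = 1})
    ⟨((1 : I), (1 : I)), Or.inl rfl, rfl⟩ (h2 1)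
  convert h12 using 1
  ext z
  simp [squareSides, or_assoc]

theorem isPreconnected_squareBoundary : IsPreconnected squareBoundary := by
  have h1 : IsPreconnected {z : I × I | z.1 = 0} := by
    have : {z : I × I | z.1 = 0} = range (fun t : I => ((0 : I), t)) := by
      ext ⟨a, b⟩
      simp [eq_comm]
    rw [this]
    exact isPreconnected_range (by fun_prop)
  exact IsPreconnected.union' (s := {z : I × I | z.1 = 0}) (t := squareSides)
    ⟨((0 : I), (0 : I)), rfl, Or.inr (Or.inl rfl)⟩ h1 isPreconnected_squareSides

/-- A continuous map from a compact set to a Hausdorff space is closed onto its image, so closed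
sets can be tested upstairs. -/
theorem continuousOn_image_of_comp {X Y Z : Type*} [TopologicalSpace X] [TopologicalSpace Y]
    [TopologicalSpace Z] [T2Space Y] {φ : X → Y} {K : Set X} (hK : IsCompact K)
    (hφ : ContinuousOn φ K) {f : Y → Z} (hf : ContinuousOn (f ∘ φ) K) :
    ContinuousOn f (φ '' K) := by
  rw [continuousOn_iff_isClosed] at hf ⊢
  intro t ht
  obtain ⟨u, hu, hu'⟩ := hf t ht
  refine ⟨φ '' (K ∩ u), ((hK.inter_right hu).image_of_continuousOn
    (hφ.mono inter_subset_left)).isClosed, ?_⟩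
  ext y
  constructor
  · rintro ⟨hy, x, hx, rfl⟩
    have : x ∈ u ∩ K := by rw [← hu']; exact ⟨hy, hx⟩
    exact ⟨⟨x, ⟨hx, this.1⟩, rfl⟩, x, hx, rfl⟩
  · rintro ⟨⟨x, ⟨hx, hxu⟩, rfl⟩, -⟩
    have : x ∈ f ∘ φ ⁻¹' t ∩ K := by rw [hu']; exact ⟨hxu, hx⟩
    exact ⟨this.1, x, hx, rfl⟩

/-! ### Null homotopies and subgraphs -/

section Pinch

variable {Γ : Type u} [TopologicalSpace Γ] [CWComplex (univ : Set Γ)]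

open Classical in
/-- The map to the circle which wraps the edge `e` once around the circle and collapses its
complement. -/
noncomputable def pinch (e : Edge Γ) (x : Γ) : AddCircle (1 : ℝ) :=
  if h : ∃ t ∈ Ioo (-1 : ℝ) 1, edgeMap e t = x then (((h.choose + 1) / 2 : ℝ) : AddCircle (1 : ℝ))
  else 0

theorem pinch_of_notMem {e : Edge Γ} {x : Γ} (hx : x ∉ openEdge e) : pinch e x = 0 := by
  unfold pinch
  rw [dif_neg]
  rintro ⟨t, ht, rfl⟩
  exact hx (edgeMap_mem_openEdge e ht)

theorem pinch_edgeMap_of_mem {e : Edge Γ} {t : ℝ} (ht : t ∈ Ioo (-1 : ℝ) 1) :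
    pinch e (edgeMap e t) = (((t + 1) / 2 : ℝ) : AddCircle (1 : ℝ)) := by
  have h : ∃ s ∈ Ioo (-1 : ℝ) 1, edgeMap e s = edgeMap e t := ⟨t, ht, rfl⟩
  unfold pinch
  rw [dif_pos h, edgeMap_injOn e h.choose_spec.1 ht h.choose_spec.2]

variable [T2Space Γ]

theorem edgeMap_notMem {e : Edge Γ} {t : ℝ} (ht : t = -1 ∨ t = 1) : edgeMap e t ∉ openEdge e := by
  intro h
  obtain ⟨v, hv, h'⟩ := edgeMap_endpoint e ht
  have := eq_of_mem_cellO h' (d := ⟨1, e⟩) h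
  subst this
  exact one_ne_zero hv

theorem pinch_edgeMap {e : Edge Γ} {t : ℝ} (ht : t ∈ Icc (-1 : ℝ) 1) :
    pinch e (edgeMap e t) = (((t + 1) / 2 : ℝ) : AddCircle (1 : ℝ)) := by
  rcases eq_or_ne t (-1) with rfl | h1
  · rw [pinch_of_notMem (edgeMap_notMem (Or.inl rfl))]; norm_num
  rcases eq_or_ne t 1 with rfl | h2
  · rw [pinch_of_notMem (edgeMap_notMem (Or.inr rfl))]; norm_num; exact (AddCircle.coe_period 1).symm
  · exact pinch_edgeMap_of_mem ⟨lt_of_le_of_ne ht.1 h1.symm, lt_of_le_of_ne ht.2 h2⟩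

theorem edgeMap_image_Icc (e : Edge Γ) : edgeMap e '' Icc (-1 : ℝ) 1 = cellC ⟨1, e⟩ := by
  ext x
  constructor
  · rintro ⟨t, ht, rfl⟩
    exact edgeMap_mem_cellC e ht
  · intro hx
    obtain ⟨t, ht, rfl⟩ := exists_edgeMap_eq hx
    exact ⟨t, ht, rfl⟩

variable (hΓ : IsGraph Γ)
include hΓ

/-- The closed edge and the complement of the open edge are closed sets covering `Γ`, and the two
formulas can be checked on each separately. -/
theorem IsGraph.continuous_pinch (e : Edge Γ) : Continuous (pinch e) := by
  rw [← continuousOn_univ]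
  have h1 : ContinuousOn (pinch e) (cellC ⟨1, e⟩) := by
    rw [← edgeMap_image_Icc]
    refine continuousOn_image_of_comp isCompact_Icc (continuousOn_edgeMap e) ?_
    have : ContinuousOn (fun t : ℝ => (((t + 1) / 2 : ℝ) : AddCircle (1 : ℝ))) (Icc (-1 : ℝ) 1) :=
      ((AddCircle.continuous_mk' (1 : ℝ)).comp
        (by fun_prop : Continuous fun t : ℝ => (t + 1) / 2)).continuousOn
    exact this.congr fun t ht => pinch_edgeMap ht
  have h2 : ContinuousOn (pinch e) (openEdge e)ᶜ :=
    continuousOn_const.congr fun x hx => pinch_of_notMem hx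
  refine (h1.union_of_isClosed h2 (isClosed_cellC _)
    (hΓ.isOpen_openEdge e).isClosed_compl).mono fun x _ => ?_
  by_cases hx : x ∈ openEdge e
  · exact Or.inl (cellO_subset_cellC ⟨1, e⟩ hx)
  · exact Or.inr hx

/-- The map `pinch e ∘ H` lifts to a real function `h` on the square which vanishes on the boundary.
Where `h = 0` the map `H` already misses the open edge. Every other point is sent to an endpoint of
`e` chosen by the sign of `h`. -/
theorem IsGraph.exists_avoiding_edge (e : Edge Γ) (H : C(I × I, Γ))
    (hbd : ∀ z ∈ squareBoundary, H z ∉ openEdge e) :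
    ∃ H' : C(I × I, Γ), (∀ z ∈ squareBoundary, H' z = H z) ∧ (∀ z, H' z ∉ openEdge e) ∧
      ∀ z, H' z ∈ range H ∨ ∃ v : AnyCell Γ, v.1 = 0 ∧ H' z ∈ cellO v := by
  classical
  obtain ⟨h, h0, hh⟩ := exists_lift_square
    ⟨fun z => pinch e (H z), (hΓ.continuous_pinch e).comp H.continuous⟩ (0, 0) 0 (by
      simp only [ContinuousMap.coe_mk]
      rw [pinch_of_notMem (hbd _ (Or.inl rfl))]; simp)
  simp only [ContinuousMap.coe_mk] at hh
  have hbd0 : ∀ z ∈ squareBoundary, h z = 0 := by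
    refine lift_eq_of_isPreconnected h.continuous isPreconnected_squareBoundary (fun z hz => ?_)
      (z₀ := (0, 0)) (Or.inl rfl) h0
    rw [hh, pinch_of_notMem (hbd z hz)]; simp
  have hzero : ∀ z, h z = 0 → H z ∉ openEdge e := by
    intro z hz hmem
    obtain ⟨t, ht, hteq⟩ := exists_edgeMap_eq_of_mem_openEdge hmem
    have := hh z
    rw [hz, ← hteq, pinch_edgeMap_of_mem ht] at this
    have h3 := this.symm
    rw [AddCircle.coe_zero, AddCircle.coe_eq_zero_iff] at h3
    obtain ⟨n, hn⟩ := h3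
    rw [zsmul_one] at hn
    have a1 : (0 : ℝ) < n := by rw [hn]; linarith [ht.1]
    have a2 : (n : ℝ) < 1 := by rw [hn]; linarith [ht.2]
    have a3 : 0 < n := by exact_mod_cast a1
    have a4 : n < 1 := by exact_mod_cast a2
    omega
  -- near the zero set of `h`, the map `H` is determined by `h` on the edge
  have hval : ∀ z, (h z ∈ Ioo (0 : ℝ) 1 → H z = edgeMap e (2 * h z - 1)) ∧
      (h z ∈ Ioo (-1 : ℝ) 0 → H z = edgeMap e (2 * h z + 1)) := by
    intro z
    have key : ∀ r : ℝ, (r : AddCircle (1 : ℝ)) = pinch e (H z) → r ∈ Ioo (0 : ℝ) 1 →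
        H z = edgeMap e (2 * r - 1) := by
      intro r hr hr01
      by_cases hmem : H z ∈ openEdge e
      · obtain ⟨t, ht, hteq⟩ := exists_edgeMap_eq_of_mem_openEdge hmem
        rw [← hteq, pinch_edgeMap_of_mem ht] at hr
        have hr' := sub_eq_zero.2 hr
        rw [← AddCircle.coe_sub, AddCircle.coe_eq_zero_iff] at hr'
        obtain ⟨n, hn⟩ := hr'
        rw [zsmul_one] at hn
        have a1 : (-1 : ℝ) < n := by rw [hn]; linarith [ht.2, hr01.1]
        have a2 : (n : ℝ) < 1 := by rw [hn]; linarith [ht.1, hr01.2]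
        have a3 : -1 < n := by exact_mod_cast a1
        have a4 : n < 1 := by exact_mod_cast a2
        obtain rfl : n = 0 := by omega
        rw [← hteq]
        congr 1
        push_cast at hn
        linarith
      · rw [pinch_of_notMem hmem, AddCircle.coe_eq_zero_iff] at hr
        obtain ⟨n, hn⟩ := hr
        rw [zsmul_one] at hn
        have a3 : 0 < n := by have := hr01.1; rw [← hn] at this; exact_mod_cast this
        have a4 : n < 1 := by have := hr01.2; rw [← hn] at this; exact_mod_cast this
        omega
    refine ⟨key _ (hh z), fun hz => ?_⟩
    rw [key (h z + 1) (by rw [← hh z]; simp) ⟨by linarith [hz.1], by linarith [hz.2]⟩]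
    congr 1
    ring
  -- For small `h > 0` the point `H z` is on the edge near parameter `-1`, and for small `h < 0`
  -- near parameter `1`. This dictates the endpoints.
  let H' : I × I → Γ := fun z =>
    if h z = 0 then H z else if 0 < h z then edgeMap e (-1) else edgeMap e 1
  have hcont : Continuous H' := by
    rw [continuous_iff_continuousAt]
    intro z₀
    rcases lt_trichotomy (h z₀) 0 with hz | hz | hz
    · have : ∀ᶠ z in 𝓝 z₀, H' z = edgeMap e 1 := by
        filter_upwards [h.continuous.continuousAt.eventually_lt_const hz] with z hz
        simp only [H', if_neg hz.ne, if_neg hz.le.not_gt]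
      exact continuousAt_const.congr (this.mono fun z hz => hz.symm)
    · have hH' : H' z₀ = H z₀ := by simp [H', hz]
      -- At a zero `z₀` of `h` approached through positive values, `H z = edgeMap e (2 * h z - 1)`
      -- tends both to `H z₀` and to the endpoint, so `H'` does not jump.
      have hpos : (∃ᶠ z in 𝓝 z₀, 0 < h z) → H z₀ = edgeMap e (-1) := by
        intro hf
        by_contra hne
        have t1 : Tendsto (fun z => edgeMap e (2 * h z - 1)) (𝓝 z₀ ⊓ 𝓟 {z | 0 < h z})
            (𝓝 (edgeMap e (-1))) := by
          have hw := (continuousOn_edgeMap e) (-1) ⟨le_rfl, by norm_num⟩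
          refine hw.tendsto.comp (tendsto_nhdsWithin_iff.2 ⟨?_, ?_⟩)
          · have : ContinuousAt (fun z => 2 * h z - 1) z₀ := by fun_prop
            have := this.tendsto
            rw [hz] at this
            norm_num at this
            exact this.mono_left inf_le_left
          · have : ∀ᶠ z in 𝓝 z₀, h z < 1 :=
              h.continuous.continuousAt.eventually_lt_const (by rw [hz]; norm_num)
            filter_upwards [this.filter_mono inf_le_left, mem_inf_of_right (mem_principal_self _)]
              with z h1 h2
            have h2' : 0 < h z := h2
            exact ⟨by linarith, by linarith⟩
        have t2 : Tendsto (fun z => edgeMap e (2 * h z - 1)) (𝓝 z₀ ⊓ 𝓟 {z | 0 < h z})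
            (𝓝 (H z₀)) := by
          refine (H.continuous.continuousAt.mono_left inf_le_left).congr' ?_
          have : ∀ᶠ z in 𝓝 z₀, h z < 1 :=
            h.continuous.continuousAt.eventually_lt_const (by rw [hz]; norm_num)
          filter_upwards [this.filter_mono inf_le_left, mem_inf_of_right (mem_principal_self _)]
            with z h1 h2
          exact (hval z).1 ⟨h2, h1⟩
        have : (𝓝 z₀ ⊓ 𝓟 {z | 0 < h z}).NeBot := by
          rw [← frequently_mem_iff_neBot]; exact hf
        exact hne (tendsto_nhds_unique t2 t1)
      have hneg : (∃ᶠ z in 𝓝 z₀, h z < 0) → H z₀ = edgeMap e 1 := by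
        intro hf
        by_contra hne
        have t1 : Tendsto (fun z => edgeMap e (2 * h z + 1)) (𝓝 z₀ ⊓ 𝓟 {z | h z < 0})
            (𝓝 (edgeMap e 1)) := by
          have hw := (continuousOn_edgeMap e) 1 ⟨by norm_num, le_rfl⟩
          refine hw.tendsto.comp (tendsto_nhdsWithin_iff.2 ⟨?_, ?_⟩)
          · have : ContinuousAt (fun z => 2 * h z + 1) z₀ := by fun_prop
            have := this.tendsto
            rw [hz] at this
            norm_num at this
            exact this.mono_left inf_le_left
          · have : ∀ᶠ z in 𝓝 z₀, -1 < h z :=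
              h.continuous.continuousAt.eventually_const_lt (by rw [hz]; norm_num)
            filter_upwards [this.filter_mono inf_le_left, mem_inf_of_right (mem_principal_self _)]
              with z h1 h2
            have h2' : h z < 0 := h2
            exact ⟨by linarith, by linarith⟩
        have t2 : Tendsto (fun z => edgeMap e (2 * h z + 1)) (𝓝 z₀ ⊓ 𝓟 {z | h z < 0})
            (𝓝 (H z₀)) := by
          refine (H.continuous.continuousAt.mono_left inf_le_left).congr' ?_
          have : ∀ᶠ z in 𝓝 z₀, -1 < h z :=
            h.continuous.continuousAt.eventually_const_lt (by rw [hz]; norm_num)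
          filter_upwards [this.filter_mono inf_le_left, mem_inf_of_right (mem_principal_self _)]
            with z h1 h2
          exact (hval z).2 ⟨h1, h2⟩
        have : (𝓝 z₀ ⊓ 𝓟 {z | h z < 0}).NeBot := by
          rw [← frequently_mem_iff_neBot]; exact hf
        exact hne (tendsto_nhds_unique t2 t1)
      have e1 : ∀ᶠ z in 𝓝 z₀, 0 < h z → edgeMap e (-1) = H z₀ := by
        by_cases hf : ∃ᶠ z in 𝓝 z₀, 0 < h z
        · exact Eventually.of_forall fun z _ => (hpos hf).symm
        · rw [not_frequently] at hf
          filter_upwards [hf] with z h1 h2 using absurd h2 h1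
      have e2 : ∀ᶠ z in 𝓝 z₀, h z < 0 → edgeMap e 1 = H z₀ := by
        by_cases hf : ∃ᶠ z in 𝓝 z₀, h z < 0
        · exact Eventually.of_forall fun z _ => (hneg hf).symm
        · rw [not_frequently] at hf
          filter_upwards [hf] with z h1 h2 using absurd h2 h1
      rw [ContinuousAt, hH', tendsto_def]
      intro O hO
      filter_upwards [e1, e2, H.continuous.continuousAt.preimage_mem_nhds hO] with z h1 h2 h3
      simp only [mem_preimage, H']
      split_ifs with h4 h5
      · exact h3
      · rw [h1 h5]; exact mem_of_mem_nhds hO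
      · rw [h2 (lt_of_le_of_ne (not_lt.1 h5) h4)]; exact mem_of_mem_nhds hO
    · have : ∀ᶠ z in 𝓝 z₀, H' z = edgeMap e (-1) := by
        filter_upwards [h.continuous.continuousAt.eventually_const_lt hz] with z hz
        simp only [H', if_neg hz.ne', if_pos hz]
      exact continuousAt_const.congr (this.mono fun z hz => hz.symm)
  refine ⟨⟨H', hcont⟩, fun z hz => ?_, fun z => ?_, fun z => ?_⟩
  · simp [H', hbd0 z hz]
  · simp only [ContinuousMap.coe_mk, H']
    split_ifs with h1 h2
    · exact hzero z h1
    · exact edgeMap_notMem (Or.inl rfl)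
    · exact edgeMap_notMem (Or.inr rfl)
  · simp only [ContinuousMap.coe_mk, H']
    split_ifs with h1 h2
    · exact Or.inl ⟨z, rfl⟩
    · exact Or.inr (edgeMap_endpoint e (Or.inl rfl))
    · exact Or.inr (edgeMap_endpoint e (Or.inr rfl))

theorem IsGraph.exists_avoiding_finset (E : Finset (Edge Γ)) (H : C(I × I, Γ))
    (hbd : ∀ z ∈ squareBoundary, ∀ e ∈ E, H z ∉ openEdge e) :
    ∃ H' : C(I × I, Γ), (∀ z ∈ squareBoundary, H' z = H z) ∧ (∀ z, ∀ e ∈ E, H' z ∉ openEdge e) ∧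
      ∀ z, H' z ∈ range H ∨ ∃ v : AnyCell Γ, v.1 = 0 ∧ H' z ∈ cellO v := by
  classical
  induction E using Finset.induction_on with
  | empty => exact ⟨H, fun _ _ => rfl, by simp, fun z => Or.inl ⟨z, rfl⟩⟩
  | insert e E he ih =>
    obtain ⟨H₁, h1, h2, h3⟩ := ih fun z hz e' he' => hbd z hz e' (Finset.mem_insert_of_mem he')
    obtain ⟨H₂, k1, k2, k3⟩ := hΓ.exists_avoiding_edge e H₁ fun z hz => by
      rw [h1 z hz]; exact hbd z hz e (Finset.mem_insert_self e E)
    refine ⟨H₂, fun z hz => (k1 z hz).trans (h1 z hz), fun z e' he' => ?_, fun z => ?_⟩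
    · rcases Finset.mem_insert.1 he' with rfl | he'
      · exact k2 z
      · rcases k3 z with ⟨w, hw⟩ | ⟨v, hv, hvz⟩
        · rw [← hw]; exact h2 w e' he'
        · intro h
          have := eq_of_mem_cellO hvz (d := ⟨1, e'⟩) h
          subst this
          exact one_ne_zero hv
    · rcases k3 z with ⟨w, hw⟩ | h
      · rw [← hw]; exact h3 w
      · exact Or.inr h

/-- A map of the square into a graph whose boundary lies in a subgraph can be replaced by a map
into the subgraph. -/
theorem IsGraph.exists_square_in_subgraph {S : Set Γ} (hS : IsSubgraph S) (H : C(I × I, Γ))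
    (hbd : ∀ z ∈ squareBoundary, H z ∈ S) :
    ∃ H' : C(I × I, Γ), (∀ z ∈ squareBoundary, H' z = H z) ∧ ∀ z, H' z ∈ S := by
  -- Only finitely many edges meet the compact image, so the edges outside `S` can be removed by a
  -- finite induction.
  have hfin : {e : Edge Γ | (cellC ⟨1, e⟩ ∩ range H).Nonempty ∧ ¬ openEdge e ⊆ S}.Finite := by
    have := hΓ.finite_cellC_inter (isCompact_range H.continuous)
    refine Finite.subset (this.preimage (f := fun e : Edge Γ => (⟨1, e⟩ : AnyCell Γ))
      (fun a _ b _ h => by simpa using h)) ?_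
    exact fun e he => he.1
  obtain ⟨H', h1, h2, h3⟩ := hΓ.exists_avoiding_finset hfin.toFinset H (by
    intro z hz e he hze
    rw [Finite.mem_toFinset] at he
    exact he.2 ((cellO_subset_cellC ⟨1, e⟩).trans (hS ⟨1, e⟩ ⟨_, hze, hbd z hz⟩)))
  refine ⟨H', h1, ?_⟩
  have hkey : ∀ z, H' z ∈ S ∨ ∃ v : AnyCell Γ, v.1 = 0 ∧ H' z ∈ cellO v := by
    intro z
    rcases h3 z with ⟨w, hw⟩ | h
    · obtain ⟨c, hc⟩ := exists_mem_cellO (H' z)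
      rcases hΓ.fst_eq c with h0 | h0
      · exact Or.inr ⟨c, h0, hc⟩
      · obtain ⟨n, e⟩ := c
        obtain rfl : n = 1 := h0
        left
        by_contra hzS
        refine h2 z e ?_ hc
        rw [Finite.mem_toFinset]
        exact ⟨⟨_, cellO_subset_cellC _ hc, w, hw⟩, fun h => hzS (h hc)⟩
    · exact Or.inr h
  -- The image now lies in `S` together with vertices outside `S`. These vertices form a closed set
  -- disjoint from `S`, and the connected image meets `S`.
  set V : Set Γ := ⋃ c ∈ {c : AnyCell Γ | c.1 = 0 ∧ ¬ cellC c ⊆ S}, cellC c with hV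
  have hVc : IsClosed V := hΓ.isClosed_biUnion _
  have hSc : IsClosed S := hΓ.isClosed_of_isSubgraph hS
  have hdisj : Disjoint S V := by
    rw [Set.disjoint_left]
    intro x hxS hxV
    simp only [hV, mem_iUnion] at hxV
    obtain ⟨c, ⟨hc0, hc⟩, hx⟩ := hxV
    rw [cellC_eq_cellO_of_fst_eq_zero hc0] at hx
    exact hc (hS c ⟨x, hx, hxS⟩)
  have hcov : range H' ⊆ S ∪ V := by
    rintro _ ⟨z, rfl⟩
    rcases hkey z with h | ⟨v, hv, h⟩
    · exact Or.inl h
    · by_cases hvS : cellC v ⊆ S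
      · exact Or.inl (hvS (cellO_subset_cellC v h))
      · exact Or.inr (mem_biUnion (⟨hv, hvS⟩ : _) (cellO_subset_cellC v h))
  have hpre : IsPreconnected (range H') := isPreconnected_range H'.continuous
  have hz0 : H' (0, 0) ∈ S := by rw [h1 _ (Or.inl rfl)]; exact hbd _ (Or.inl rfl)
  intro z
  by_contra hz
  have hzV : H' z ∈ V := (hcov ⟨z, rfl⟩).resolve_left hz
  have hsub := isPreconnected_closed_iff.1 hpre S V hSc hVc hcov ⟨_, ⟨(0, 0), rfl⟩, hz0⟩
    ⟨_, ⟨z, rfl⟩, hzV⟩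
  obtain ⟨x, -, hx1, hx2⟩ := hsub
  exact Set.disjoint_left.1 hdisj hx1 hx2

end Pinch

/-! ### Ends and ultrafilters -/

section EndsTopology

variable {Γ : Type u} [TopologicalSpace Γ]

theorem IsExhaustion.exists_subset {K : ℕ → Set Γ} (hK : IsExhaustion K) {C : Set Γ}
    (hC : IsCompact C) : ∃ n, C ⊆ interior (K n) :=
  hC.elim_directed_cover (fun n => interior (K n)) (fun _ => isOpen_interior)
    (by rw [hK.iUnion_interior]; exact subset_univ C)
    (Monotone.directed_le fun _ _ h => interior_mono (hK.mono h))

theorem IsEndBasis.eventually_disjoint {V : ℕ → Set Γ} (hV : IsEndBasis V) {C : Set Γ}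
    (hC : IsCompact C) : ∀ᶠ n in atTop, Disjoint (V n) C := by
  obtain ⟨-, K, hK, h⟩ := hV
  obtain ⟨m, hm⟩ := hK.exists_subset hC
  filter_upwards [eventually_ge_atTop m] with n hn
  obtain ⟨x, -, hx⟩ := h n
  rw [hx, Set.disjoint_left]
  intro y hy hyC
  exact connectedComponentIn_subset _ _ hy (hK.mono hn (interior_subset (hm hyC)))

/-- Components of an open set are open here, so a frontier point inside `O` would have a component
meeting, hence equal to, the given one. -/
theorem frontier_connectedComponentIn_subset [LocallyConnectedSpace Γ] {O : Set Γ} (hO : IsOpen O)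
    (x : Γ) : frontier (connectedComponentIn O x) ⊆ Oᶜ := by
  intro y hy hyO
  have hyo : IsOpen (connectedComponentIn O y) := hO.connectedComponentIn
  have hxo : IsOpen (connectedComponentIn O x) := hO.connectedComponentIn
  rw [hxo.frontier_eq] at hy
  obtain ⟨z, hz, hz'⟩ := mem_closure_iff.1 hy.1 _ hyo (mem_connectedComponentIn hyO)
  apply hy.2
  rw [connectedComponentIn_eq hz', ← connectedComponentIn_eq hz]
  exact mem_connectedComponentIn hyO

theorem IsEndBasis.isOpen [T2Space Γ] [LocallyConnectedSpace Γ] {V : ℕ → Set Γ}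
    (hV : IsEndBasis V) (n : ℕ) : IsOpen (V n) := by
  obtain ⟨-, K, hK, h⟩ := hV
  obtain ⟨x, -, hx⟩ := h n
  rw [hx]
  exact (hK.isCompact n).isClosed.isOpen_compl.connectedComponentIn

theorem IsEndBasis.isCompact_frontier [T2Space Γ] [LocallyConnectedSpace Γ] {V : ℕ → Set Γ}
    (hV : IsEndBasis V) (n : ℕ) : IsCompact (frontier (V n)) := by
  obtain ⟨-, K, hK, h⟩ := hV
  obtain ⟨x, -, hx⟩ := h n
  rw [hx]
  refine (hK.isCompact n).of_isClosed_subset isClosed_frontier ?_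
  have := frontier_connectedComponentIn_subset (hK.isCompact n).isClosed.isOpen_compl x
  rwa [compl_compl] at this

variable [T2Space Γ] [LocallyConnectedSpace Γ] [WeaklyLocallyCompactSpace Γ] [ConnectedSpace Γ]

/-- Outside a larger compact set `K'`, finitely many components of `Kᶜ` cover everything: each
component reaching outside `K'` must meet the compact frontier of `K'`. An ultrafilter that contains
a finite union contains one of its members. -/
theorem exists_connectedComponentIn_mem {K : Set Γ} (hK : IsCompact K) (𝓤 : Ultrafilter Γ)
    (h𝓤 : (𝓤 : Filter Γ) ≤ cocompact Γ) : ∃ x ∈ Kᶜ, connectedComponentIn Kᶜ x ∈ 𝓤 := by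
  rcases K.eq_empty_or_nonempty with rfl | hne
  · obtain ⟨x⟩ := (inferInstance : Nonempty Γ)
    refine ⟨x, by simp, ?_⟩
    rw [compl_empty, connectedComponentIn_univ, PreconnectedSpace.connectedComponent_eq_univ]
    exact univ_mem
  obtain ⟨K', hK', hKK'⟩ := exists_compact_superset hK
  have hopen : IsOpen Kᶜ := hK.isClosed.isOpen_compl
  have hfr : IsCompact (frontier K') :=
    hK'.of_isClosed_subset isClosed_frontier hK'.isClosed.frontier_subset
  have hfrK : frontier K' ⊆ Kᶜ := by
    intro x hx hxK
    exact hx.2 (hKK' hxK)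
  obtain ⟨t, ht, htc⟩ := hfr.elim_nhds_subcover (fun x => connectedComponentIn Kᶜ x)
    fun x hx => hopen.connectedComponentIn.mem_nhds (mem_connectedComponentIn (hfrK hx))
  have hcov : K'ᶜ ⊆ ⋃ x ∈ t, connectedComponentIn Kᶜ x := by
    intro y hy
    have hyK : y ∈ Kᶜ := fun h => hy (interior_subset (hKK' h))
    set C := connectedComponentIn Kᶜ y with hC
    have hyC : y ∈ C := mem_connectedComponentIn hyK
    have hCo : IsOpen C := hopen.connectedComponentIn
    have : (C ∩ frontier K').Nonempty := by
      by_contra hemp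
      rw [not_nonempty_iff_eq_empty] at hemp
      have hpre : IsPreconnected C := isPreconnected_connectedComponentIn
      have hCK' : Disjoint C K' := by
        rw [Set.disjoint_left]
        intro z hzC hzK'
        have hsub : C ⊆ interior K' ∪ K'ᶜ := by
          intro w hw
          by_cases hwK : w ∈ K'
          · left
            by_contra hwi
            have : w ∈ C ∩ frontier K' := ⟨hw, subset_closure hwK, hwi⟩
            rw [hemp] at this
            exact this
          · exact Or.inr hwK
        have hzi : z ∈ interior K' := (hsub hzC).resolve_right (fun h => h hzK')
        obtain ⟨w, -, hw1, hw2⟩ := hpre _ _ isOpen_interior hK'.isClosed.isOpen_compl hsub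
          ⟨z, hzC, hzi⟩ ⟨y, hyC, hy⟩
        exact hw2 (interior_subset hw1)
      -- The frontier of `C` lies in `K`, while `C` avoids the neighbourhood `interior K'` of `K`;
      -- so the frontier is empty and `C` would be the whole connected space.
      have hclosed : IsClosed C := by
        rw [← closure_subset_iff_isClosed]
        intro z hz
        by_contra hzC
        have hzf : z ∈ frontier C := by rw [hCo.frontier_eq]; exact ⟨hz, hzC⟩
        have hzK := frontier_connectedComponentIn_subset hopen y hzf
        rw [compl_compl] at hzK
        obtain ⟨w, hw1, hw2⟩ := mem_closure_iff.1 hz _ isOpen_interior (hKK' hzK)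
        exact Set.disjoint_left.1 hCK' hw2 (interior_subset hw1)
      have huniv : C = univ := IsClopen.eq_univ ⟨hclosed, hCo⟩ ⟨y, hyC⟩
      obtain ⟨k, hk⟩ := hne
      have : k ∈ C := by rw [huniv]; exact mem_univ k
      exact connectedComponentIn_subset _ _ this hk
    obtain ⟨z, hzC, hzf⟩ := this
    have := htc hzf
    simp only [mem_iUnion] at this ⊢
    obtain ⟨x, hx, hzx⟩ := this
    refine ⟨x, hx, ?_⟩
    rw [connectedComponentIn_eq hzx, ← connectedComponentIn_eq hzC]
    exact hyC
  have hmem : (⋃ x ∈ t, connectedComponentIn Kᶜ x) ∈ 𝓤 :=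
    mem_of_superset (h𝓤 hK'.compl_mem_cocompact) hcov
  rw [← Ultrafilter.mem_coe] at hmem
  have hmem' := (Ultrafilter.finite_biUnion_mem_iff t.finite_toSet).1 hmem
  obtain ⟨x, hx, hxU⟩ := hmem'
  exact ⟨x, hfrK (ht x hx), hxU⟩

/-- Every ultrafilter of points which leaves all compact sets converges to an end. -/
theorem exists_end_of_ultrafilter [SigmaCompactSpace Γ] (𝓤 : Ultrafilter Γ)
    (h𝓤 : (𝓤 : Filter Γ) ≤ cocompact Γ) :
    ∃ E : GraphEnd Γ, ∃ V, IsEndBasisOf V E ∧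
      ∀ V', IsEndBasisOf V' E → ∀ n, V' n ∈ 𝓤 := by
  let K := CompactExhaustion.choice Γ
  choose x hx hxU using fun n => exists_connectedComponentIn_mem (K.isCompact n) 𝓤 h𝓤
  let V : ℕ → Set Γ := fun n => connectedComponentIn (K n)ᶜ (x n)
  have hV : IsEndBasis V := by
    refine ⟨antitone_nat_of_succ_le fun n => ?_, K, ⟨K.isCompact, ?_, ?_⟩, fun n =>
      ⟨x n, hx n, rfl⟩⟩
    · obtain ⟨y, hy1, hy2⟩ := 𝓤.nonempty_of_mem (inter_mem (hxU n) (hxU (n + 1)))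
      change connectedComponentIn (K (n + 1))ᶜ (x (n + 1)) ⊆ connectedComponentIn (K n)ᶜ (x n)
      rw [connectedComponentIn_eq hy1, connectedComponentIn_eq hy2]
      exact connectedComponentIn_mono _ (compl_subset_compl.2 (K.subset_succ n))
    · exact fun m n h => K.subset h
    · refine eq_univ_of_forall fun y => ?_
      obtain ⟨n, hn⟩ := K.exists_mem y
      exact mem_iUnion.2 ⟨n + 1, K.subset_interior_succ n hn⟩
  refine ⟨Quotient.mk (endSetoid Γ) ⟨V, hV⟩, V, ⟨hV, rfl⟩, ?_⟩
  rintro V' ⟨hV', h⟩ n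
  have := (Quotient.exact h : (endSetoid Γ).r _ _) n
  obtain ⟨j, hj⟩ := this.2
  exact mem_of_superset (hxU j) hj

/-- Otherwise some ultrafilter on the complement would leave all compact sets and converge to an end
`E`, while a tail of each basis of `E` lies in `U E`. -/
theorem isCompact_compl_iUnion_nhds [SigmaCompactSpace Γ] {U : GraphEnd Γ → Set Γ}
    (hU : ∀ E, IsEndNhd (U E) E) : IsCompact (⋃ E, U E)ᶜ := by
  have hcl : IsClosed (⋃ E, U E)ᶜ := (isOpen_iUnion fun E => (hU E).isOpen).isClosed_compl
  by_contra hnc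
  have hne : (cocompact Γ ⊓ 𝓟 (⋃ E, U E)ᶜ).NeBot := by
    rw [← Filter.frequently_mem_iff_neBot]
    intro h
    obtain ⟨C, hC, hsub⟩ := mem_cocompact.1 h
    refine hnc (hC.of_isClosed_subset hcl fun x hx => ?_)
    by_contra hxC
    exact hsub hxC hx
  obtain ⟨E, V, hVE, hV⟩ := exists_end_of_ultrafilter (Ultrafilter.of _)
    ((Ultrafilter.of_le (cocompact Γ ⊓ 𝓟 (⋃ E, U E)ᶜ)).trans inf_le_left)
  have h2 : (⋃ E, U E)ᶜ ∈ Ultrafilter.of (cocompact Γ ⊓ 𝓟 (⋃ E, U E)ᶜ) :=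
    Ultrafilter.of_le _ (mem_inf_of_right (mem_principal_self _))
  obtain ⟨k, hk⟩ := (hU E).tail V hVE
  obtain ⟨y, hy1, hy2⟩ := Ultrafilter.nonempty_of_mem (inter_mem (hV V hVE k) h2)
  exact hy2 (mem_iUnion.2 ⟨E, hk k le_rfl hy1⟩)

end EndsTopology

/-! ### Attracting and repelling regions -/

section Regions

variable {Γ : Type u} [TopologicalSpace Γ]

/-- An open set on which `g` is an open embedding into itself whose images shrink to infinity, and
which is entered by all escaping orbits. -/
structure IsAttractingRegion (g : C(Γ, Γ)) (A : Set Γ) : Prop where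
  isOpen : IsOpen A
  mapsTo : MapsTo g A A
  injOn : InjOn g A
  isOpen_image : ∀ O ⊆ A, IsOpen O → IsOpen (g '' O)
  preimage_image : g ⁻¹' (g '' A) ⊆ A
  escape : ∀ K, IsCompact K → ∃ n, Disjoint (g^[n] '' A) K
  isCompact_frontier : IsCompact (frontier A)
  enter : ∀ x, Tendsto (fun n => g^[n] x) atTop (cocompact Γ) → ∃ n, g^[n] x ∈ A

/-- An open set containing its preimage under `g` on which `g` is an embedding, whose iterated
preimages shrink to infinity, and which is entered by all orbits which escape in backward time. -/
structure IsRepellingRegion (g : C(Γ, Γ)) (R : Set Γ) : Prop where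
  isOpen : IsOpen R
  preimage : g ⁻¹' R ⊆ R
  injOn : InjOn g R
  inducing : ∀ O, IsOpen O → ∃ V, IsOpen V ∧ ∀ y ∈ R, g y ∈ V ↔ y ∈ O
  escape : ∀ K, IsCompact K → ∃ n, Disjoint (g^[n] ⁻¹' R) K
  isCompact_frontier : IsCompact (frontier R)
  enter : ∀ x : ℕ → Γ, (∀ n, g (x (n + 1)) = x n) → Tendsto x atTop (cocompact Γ) →
    ∃ n, x n ∈ R

end Regions

/-! ### End-periodic maps outside a compact set -/

section Dynamics

variable {Γ : Type u} [TopologicalSpace Γ] [T2Space Γ] [CWComplex (univ : Set Γ)]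

theorem exists_image_cellO {g : C(Γ, Γ)} (hg : IsGraphMap g) (hΓ : IsGraph Γ) {U : Set Γ}
    (hedge : ∀ e : Edge Γ, openEdge e ⊆ largestSubgraph U →
      ∃ e' : Edge Γ, g '' openEdge e = openEdge e') {c : AnyCell Γ}
    (hc : cellC c ⊆ largestSubgraph U) : ∃ c' : AnyCell Γ, g '' cellO c = cellO c' := by
  rcases hΓ.fst_eq c with h | h
  · obtain ⟨n, i⟩ := c
    obtain rfl : n = 0 := h
    have h0 := RelCWComplex.openCell_zero_eq_singleton (C := (univ : Set Γ)) (j := i)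
    have hv : g (RelCWComplex.map (C := (univ : Set Γ)) 0 i ![]) ∈ vertices Γ := by
      refine hg.vertex (mem_iUnion.2 ⟨i, ?_⟩)
      rw [h0]
      rfl
    obtain ⟨j, hj⟩ := mem_iUnion.1 hv
    have h1 := RelCWComplex.openCell_zero_eq_singleton (C := (univ : Set Γ)) (j := j)
    refine ⟨⟨0, j⟩, ?_⟩
    rw [h1, mem_singleton_iff] at hj
    simp only [cellO, h0, h1, image_singleton, hj]
  · obtain ⟨n, e⟩ := c
    obtain rfl : n = 1 := h
    obtain ⟨e', he'⟩ := hedge e ((cellO_subset_cellC _).trans hc)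
    exact ⟨⟨1, e'⟩, he'⟩

theorem image_cellC_eq {g : C(Γ, Γ)} {c c' : AnyCell Γ} (h : g '' cellO c = cellO c') :
    g '' cellC c = cellC c' := by
  apply Subset.antisymm
  · rw [← closure_cellO c, ← closure_cellO c', ← h]
    exact image_closure_subset_closure_image g.continuous
  · rw [← closure_cellO c', ← h]
    exact closure_minimal (image_mono (cellO_subset_cellC c))
      ((isCompact_cellC c).image g.continuous).isClosed

/-- The facts on an end-periodic map which the construction of the attracting and repelling
regions uses: outside a compact set `K` the map is an embedding, it maps cells to cells, and it is
proper. -/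
theorem IsGraph.exists_compact_good [ConnectedSpace Γ] (hΓ : IsGraph Γ) {g : C(Γ, Γ)}
    (hg : IsGraphMap g) {U : GraphEnd Γ → Set Γ} (hU : ∀ E, IsEndNhd (U E) E)
    (hemb : IsEmbedding ((largestSubgraph (⋃ E, U E)).domRestrict g))
    (hedge : ∀ e : Edge Γ, openEdge e ⊆ largestSubgraph (⋃ E, U E) →
      ∃ e' : Edge Γ, g '' openEdge e = openEdge e') :
    ∃ K : Set Γ, IsCompact K ∧ InjOn g Kᶜ ∧
      (∀ O, IsOpen O → ∃ V, IsOpen V ∧ ∀ y ∈ Kᶜ, g y ∈ V ↔ y ∈ O) ∧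
      (∀ c : AnyCell Γ, cellC c ⊆ Kᶜ → ∃ c' : AnyCell Γ, g '' cellO c = cellO c') ∧
      IsProperMap g := by
  have : LocallyConnectedSpace Γ := locallyConnectedSpace_of_cwComplex
  have : WeaklyLocallyCompactSpace Γ := hΓ.weaklyLocallyCompactSpace
  have : SigmaCompactSpace Γ := hΓ.sigmaCompactSpace
  set L := largestSubgraph (⋃ E, U E) with hL
  have hQ := isCompact_compl_iUnion_nhds hU
  -- A closed cell that is not contained in `K` misses the complement of the end neighbourhoods, so
  -- it lies in the largest subgraph `L`.
  set K : Set Γ := ⋃ c ∈ {c : AnyCell Γ | (cellC c ∩ (⋃ E, U E)ᶜ).Nonempty}, cellC c with hK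
  have hKc : IsCompact K :=
    Finite.isCompact_biUnion (hΓ.finite_cellC_inter hQ) fun c _ => isCompact_cellC c
  have hgood : ∀ c : AnyCell Γ, ¬ cellC c ⊆ K → cellC c ⊆ L := by
    intro c hc
    refine hΓ.cellC_subset_largestSubgraph fun x hx => ?_
    by_contra hxU
    exact hc (subset_biUnion_of_mem (u := fun c => cellC c)
      (⟨x, hx, hxU⟩ : c ∈ {c : AnyCell Γ | (cellC c ∩ (⋃ E, U E)ᶜ).Nonempty}))
  have hKL : Kᶜ ⊆ L := by
    intro x hx
    obtain ⟨c, hc⟩ := exists_mem_cellO x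
    exact hgood c (fun h => hx (h (cellO_subset_cellC c hc))) (cellO_subset_cellC c hc)
  have hinjL : InjOn g L := by
    intro x hx y hy h
    have := hemb.injective (a₁ := ⟨x, hx⟩) (a₂ := ⟨y, hy⟩) h
    exact congrArg Subtype.val this
  refine ⟨K, hKc, hinjL.mono hKL, ?_, ?_, ?_⟩
  · intro O hO
    obtain ⟨V, hV, hVO⟩ := hemb.isInducing.isOpen_iff.1 (hO.preimage continuous_subtype_val)
    refine ⟨V, hV, fun y hy => ?_⟩
    have := Set.ext_iff.1 hVO ⟨y, hKL hy⟩
    exact this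
  · intro c hc
    exact exists_image_cellO hg hΓ hedge (hc.trans hKL)
  · rw [isProperMap_iff_tendsto_cocompact]
    refine ⟨g.continuous, ?_⟩
    rw [hasBasis_cocompact.tendsto_right_iff]
    intro C hC
    set F : Set (AnyCell Γ) := {d | (cellC d ∩ C).Nonempty} with hF
    have hFfin : F.Finite := hΓ.finite_cellC_inter hC
    -- Properness is finiteness of cells: by injectivity on `L`, at most one cell of `L` is mapped
    -- onto each of the finitely many cells that meet `C`.
    set B : Set (AnyCell Γ) := ⋃ d ∈ F, {c | cellC c ⊆ L ∧ g '' cellO c = cellO d} with hB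
    have hBfin : B.Finite := by
      refine hFfin.biUnion fun d _ => Set.Subsingleton.finite ?_
      rintro c ⟨hcL, hc⟩ c' ⟨hcL', hc'⟩
      obtain ⟨y, hy⟩ := cellO_nonempty c
      have : g y ∈ g '' cellO c' := by rw [hc', ← hc]; exact ⟨y, hy, rfl⟩
      obtain ⟨y', hy', hyy⟩ := this
      have := hinjL (hcL' (cellO_subset_cellC c' hy')) (hcL (cellO_subset_cellC c hy)) hyy
      subst this
      exact eq_of_mem_cellO hy hy'
    refine mem_cocompact.2 ⟨K ∪ ⋃ c ∈ B, cellC c,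
      hKc.union (hBfin.isCompact_biUnion fun c _ => isCompact_cellC c), ?_⟩
    intro x hx hxC
    apply hx
    by_cases hxK : x ∈ K
    · exact Or.inl hxK
    right
    obtain ⟨c, hc⟩ := exists_mem_cellO x
    have hcL := hgood c fun h => hxK (h (cellO_subset_cellC c hc))
    obtain ⟨d, hd⟩ := exists_image_cellO hg hΓ hedge hcL
    refine mem_biUnion (x := c) ?_ (cellO_subset_cellC c hc)
    refine mem_biUnion (x := d) ⟨g x, cellO_subset_cellC d ?_, hxC⟩ ⟨hcL, hd⟩
    rw [← hd]
    exact ⟨x, hc, rfl⟩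

end Dynamics

/-! ### Existence of attracting and repelling regions -/

section Existence

variable {Γ : Type u} [TopologicalSpace Γ]

theorem isProperMap_iterate {g : C(Γ, Γ)} (hg : IsProperMap g) (n : ℕ) : IsProperMap g^[n] := by
  induction n with
  | zero => exact isProperMap_id
  | succ n ih => rw [Function.iterate_succ]; exact ih.comp hg

theorem injOn_iterate_of_avoiding {g : Γ → Γ} {K : Set Γ} (hinj : InjOn g Kᶜ) (m : ℕ) :
    InjOn g^[m] {y | ∀ i < m, g^[i] y ∉ K} := by
  induction m with
  | zero => exact fun _ _ _ _ h => h
  | succ m ih =>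
    intro x hx y hy h
    rw [Function.iterate_succ_apply', Function.iterate_succ_apply'] at h
    exact ih (fun i hi => hx i (by omega)) (fun i hi => hy i (by omega))
      (hinj (hx m (by omega)) (hy m (by omega)) h)

variable [T2Space Γ] [LocallyConnectedSpace Γ] [WeaklyLocallyCompactSpace Γ] [ConnectedSpace Γ]
  [SigmaCompactSpace Γ]

/-- The image under `x` of a nonprincipal ultrafilter on `ℕ` converges to an end, and a set
belonging to it is visited infinitely often. -/
theorem exists_end_frequently {x : ℕ → Γ} (hx : Tendsto x atTop (cocompact Γ)) :
    ∃ E : GraphEnd Γ, ∀ V, IsEndBasisOf V E → ∀ n, ∃ᶠ m in atTop, x m ∈ V n := by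
  obtain ⟨E, -, -, hE⟩ := exists_end_of_ultrafilter ((Filter.hyperfilter ℕ).map x)
    (by
      rw [Ultrafilter.coe_map]
      refine le_trans (Filter.map_mono ?_) hx
      rw [← Nat.cofinite_eq_atTop]
      exact Filter.hyperfilter_le_cofinite)
  refine ⟨E, fun V hV n hcon => ?_⟩
  have h1 : {m | x m ∈ V n} ∈ Filter.hyperfilter ℕ := hE V hV n
  have h2 : {m | x m ∉ V n} ∈ Filter.hyperfilter ℕ := by
    have : {m | x m ∉ V n} ∈ (atTop : Filter ℕ) := hcon
    rw [← Nat.cofinite_eq_atTop] at this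
    exact Filter.hyperfilter_le_cofinite this
  obtain ⟨m, hm1, hm2⟩ := Ultrafilter.nonempty_of_mem (inter_mem h1 h2)
  exact hm2 hm1

variable [Finite (GraphEnd Γ)] {g : C(Γ, Γ)} {K : Set Γ} {U : GraphEnd Γ → Set Γ} {p : ℕ}

/-- Deep basis sets at the attracting ends are invariant only under `g^[p]`. Adding their images
under the first `p` iterates of `g` makes the union invariant under `g`. Depth `N` is taken so large
that the iterates involved avoid both `K` and `g '' K`. -/
theorem exists_isAttractingRegion (hgp : IsProperMap g) (hK : IsCompact K) (hinj : InjOn g Kᶜ)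
    (hind : ∀ O, IsOpen O → ∃ V, IsOpen V ∧ ∀ y ∈ Kᶜ, g y ∈ V ↔ y ∈ O)
    (hp : 0 < p)
    (hdyn : ∀ E,
      (g^[p] '' U E ⊂ U E ∧ IsEndBasisOf (fun n => g^[p * n] '' U E) E) ∨
      (g^[p] ⁻¹' U E ⊂ U E ∧ IsEndBasisOf (fun n => g^[p * n] ⁻¹' U E) E)) :
    ∃ A, IsAttractingRegion g A := by
  let T := {E : GraphEnd Γ //
    g^[p] '' U E ⊂ U E ∧ IsEndBasisOf (fun n => g^[p * n] '' U E) E} × Fin p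
  have : Finite T := inferInstance
  let W : T → ℕ → Set Γ := fun i n => g^[p * n] '' U i.1.1
  have hWb : ∀ i, IsEndBasis (W i) := fun i => i.1.2.2.1
  have hWo : ∀ i n, IsOpen (W i n) := fun i n => (hWb i).isOpen n
  have hWs : ∀ i n k, g^[p * k] '' W i n = W i (n + k) := by
    intro i n k
    simp only [W, ← image_comp, ← Function.iterate_add, mul_add, add_comm (p * k)]
  have hWs1 : ∀ i n, g^[p] '' W i n = W i (n + 1) := by
    intro i n
    have := hWs i n 1
    rwa [mul_one] at this
  have hfar : ∀ C, IsCompact C → ∀ᶠ n in atTop, ∀ i : T, ∀ j ∈ Finset.range (2 * p + 1),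
      Disjoint (g^[j] '' W i n) C := by
    intro C hC
    rw [eventually_all]
    intro i
    rw [Finset.eventually_all]
    intro j _
    filter_upwards [(hWb i).eventually_disjoint
      ((isProperMap_iterate hgp j).isCompact_preimage hC)] with n hn
    rw [Set.disjoint_left] at hn ⊢
    rintro _ ⟨y, hy, rfl⟩ hyC
    exact hn hy hyC
  obtain ⟨N, hN⟩ := (hfar (K ∪ g '' K) (hK.union (hK.image g.continuous))).exists_forall_of_atTop
  have hnotK : ∀ i, ∀ j ≤ 2 * p, ∀ y ∈ W i N, g^[j] y ∉ K := fun i j hj y hy hyK =>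
    Set.disjoint_left.1 (hN N le_rfl i j (Finset.mem_range.2 (by omega))) ⟨y, hy, rfl⟩ (Or.inl hyK)
  have hnotgK : ∀ i, ∀ j ≤ 2 * p, ∀ y ∈ W i N, g^[j] y ∉ g '' K := fun i j hj y hy hyK =>
    Set.disjoint_left.1 (hN N le_rfl i j (Finset.mem_range.2 (by omega))) ⟨y, hy, rfl⟩ (Or.inr hyK)
  -- the intermediate images are open
  have hopen : ∀ i, ∀ j ≤ p, IsOpen (g^[j] '' W i N) := by
    intro i j hj
    have hG : IsOpen {y | ∀ l < p - j, g^[l] y ∉ K} := by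
      have : {y | ∀ l < p - j, g^[l] y ∉ K} = ⋂ l ∈ Finset.range (p - j), (g^[l] ⁻¹' K)ᶜ := by
        ext y
        simp
      rw [this]
      exact isOpen_biInter_finset fun l _ =>
        (hK.isClosed.preimage (g.continuous.iterate l)).isOpen_compl
    -- The image is described without `g^[j]`: as the points that avoid `K` on their remaining way
    -- and arrive in the open set `W i (N + 1)`. Injectivity of `g` off `K` makes this description
    -- exact.
    have heq : g^[j] '' W i N = {y | ∀ l < p - j, g^[l] y ∉ K} ∩ g^[p - j] ⁻¹' W i (N + 1) := by
      apply Subset.antisymm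
      · rintro _ ⟨y, hy, rfl⟩
        refine ⟨fun l hl => ?_, ?_⟩
        · rw [← Function.iterate_add_apply]
          exact hnotK i _ (by omega) y hy
        · rw [mem_preimage, ← Function.iterate_add_apply, Nat.sub_add_cancel hj, ← hWs1]
          exact ⟨y, hy, rfl⟩
      · rintro y ⟨hy, hy'⟩
        rw [mem_preimage, ← hWs1] at hy'
        obtain ⟨w, hw, hwy⟩ := hy'
        refine ⟨w, hw, injOn_iterate_of_avoiding hinj (p - j) (fun l hl => ?_) hy ?_⟩
        · rw [← Function.iterate_add_apply]
          exact hnotK i _ (by omega) w hw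
        · rw [← Function.iterate_add_apply, Nat.sub_add_cancel hj, hwy]
    rw [heq]
    exact hG.inter ((hWo i (N + 1)).preimage (g.continuous.iterate _))
  set A : Set Γ := ⋃ i : T, g^[(i.2 : ℕ)] '' W i N with hA
  have hAmem : ∀ {y}, y ∈ A ↔ ∃ i : T, ∃ w ∈ W i N, g^[(i.2 : ℕ)] w = y := by
    intro y; simp only [hA, mem_iUnion, mem_image]
  have hAK : A ⊆ Kᶜ := by
    intro y hy
    obtain ⟨i, w, hw, rfl⟩ := hAmem.1 hy
    exact hnotK i _ (by have := i.2.2; omega) w hw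
  have hgA : IsOpen (g '' A) := by
    rw [hA, image_iUnion]
    refine isOpen_iUnion fun i => ?_
    rw [← image_comp, ← Function.iterate_succ']
    exact hopen i _ i.2.2
  have hAo : IsOpen A := isOpen_iUnion fun i => hopen i _ i.2.2.le
  have hWanti : ∀ i, Antitone (W i) := fun i => (hWb i).1
  refine ⟨A, hAo, ?_, hinj.mono hAK, ?_, ?_, ?_, ?_, ?_⟩
  · intro y hy
    obtain ⟨i, w, hw, rfl⟩ := hAmem.1 hy
    rw [← Function.iterate_succ_apply' (⇑g)]
    rcases (Nat.succ_le_of_lt i.2.2).lt_or_eq with h | h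
    · exact hAmem.2 ⟨(i.1, ⟨i.2 + 1, h⟩), w, hw, rfl⟩
    · refine hAmem.2 ⟨(i.1, ⟨0, hp⟩), g^[(i.2 : ℕ) + 1] w, ?_, rfl⟩
      rw [Nat.succ_eq_add_one] at h
      rw [h]
      exact hWanti i (Nat.le_succ N) (by rw [← hWs1]; exact ⟨w, hw, rfl⟩)
  · intro O hOA hO
    obtain ⟨V, hV, hVO⟩ := hind O hO
    have : g '' O = V ∩ g '' A := by
      apply Subset.antisymm
      · rintro _ ⟨y, hy, rfl⟩
        exact ⟨(hVO y (hAK (hOA hy))).2 hy, y, hOA hy, rfl⟩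
      · rintro _ ⟨hyV, y, hy, rfl⟩
        exact ⟨y, (hVO y (hAK hy)).1 hyV, rfl⟩
    rw [this]
    exact hV.inter hgA
  -- Since `g a` avoids `g '' K`, every preimage `x` of it lies outside `K`, where `g` is injective.
  · rintro x ⟨a, ha, hax⟩
    have hxK : x ∈ Kᶜ := by
      intro hxK
      obtain ⟨i, w, hw, rfl⟩ := hAmem.1 ha
      rw [← Function.iterate_succ_apply' (⇑g)] at hax
      exact hnotgK i ((i.2 : ℕ) + 1) (by have := i.2.2; omega) w hw (by rw [hax]; exact ⟨x, hxK, rfl⟩)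
    rwa [← hinj (hAK ha) hxK hax]
  · intro C hC
    obtain ⟨n, hn⟩ := (hfar C hC).exists_forall_of_atTop
    refine ⟨p * n, ?_⟩
    rw [Set.disjoint_left]
    rintro _ ⟨y, hy, rfl⟩ hyC
    obtain ⟨i, w, hw, rfl⟩ := hAmem.1 hy
    refine Set.disjoint_left.1 (hn (N + n) (by omega) i i.2
      (Finset.mem_range.2 (by have := i.2.2; omega))) ⟨g^[p * n] w, ?_, rfl⟩ ?_
    · rw [← hWs]
      exact ⟨w, hw, rfl⟩
    · rwa [← Function.iterate_add_apply, add_comm, Function.iterate_add_apply]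
  · have hc : IsCompact (⋃ i : T, g^[(i.2 : ℕ)] '' frontier (W i N)) :=
      isCompact_iUnion fun i => ((hWb i).isCompact_frontier N).image (g.continuous.iterate _)
    refine hc.of_isClosed_subset isClosed_frontier ?_
    rw [hAo.frontier_eq]
    rintro y ⟨hy, hyA⟩
    rw [hA, closure_iUnion_of_finite, mem_iUnion] at hy
    obtain ⟨i, hy⟩ := hy
    have : y ∈ g^[(i.2 : ℕ)] '' closure (W i N) := by
      refine closure_minimal (image_mono subset_closure) ?_ hy
      exact (isProperMap_iterate hgp i.2).isClosedMap _ isClosed_closure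
    obtain ⟨w, hw, rfl⟩ := this
    rw [closure_eq_self_union_frontier] at hw
    rcases hw with hw | hw
    · exact absurd (hAmem.2 ⟨i, w, hw, rfl⟩) hyA
    · exact mem_iUnion.2 ⟨i, w, hw, rfl⟩
  · intro x hx
    have hx' : Tendsto (fun n => g^[p * n] x) atTop (cocompact Γ) :=
      hx.comp (tendsto_id.const_mul_atTop' hp)
    obtain ⟨E, hE⟩ := exists_end_frequently hx'
    rcases hdyn E with h | h
    · obtain ⟨m, hm⟩ := (hE _ h.2 N).exists
      exact ⟨p * m, hAmem.2 ⟨(⟨E, h⟩, ⟨0, hp⟩), _, hm, rfl⟩⟩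
    -- At a repelling end, leaving `U E` is permanent under `g^[p]`. An orbit returning infinitely
    -- often never left, so `x` would lie in every iterated preimage of `U E`, although these escape
    -- from `{x}`.
    · exfalso
      have hout : ∀ n, g^[p * n] x ∉ U E → ∀ m, g^[p * (n + m)] x ∉ U E := by
        intro n hn m
        induction m with
        | zero => exact hn
        | succ m ih =>
          intro hcon
          apply ih
          apply h.1.1
          rw [mem_preimage, ← Function.iterate_add_apply]
          convert hcon using 3
          ring
      have hin : ∀ n, g^[p * n] x ∈ U E := by
        intro n
        by_contra hn
        obtain ⟨m, hm, hmU⟩ := frequently_atTop.1 (hE _ h.2 0) n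
        have := hout n hn (m - n)
        rw [Nat.add_sub_cancel' hm] at this
        apply this
        simpa using hmU
      obtain ⟨n, hn⟩ := (h.2.1.eventually_disjoint (isCompact_singleton (x := x))).exists
      exact Set.disjoint_left.1 hn (hin n) rfl

/-- The counterpart of `exists_isAttractingRegion` with preimages in place of images; openness is
now automatic. -/
theorem exists_isRepellingRegion (hK : IsCompact K) (hinj : InjOn g Kᶜ)
    (hind : ∀ O, IsOpen O → ∃ V, IsOpen V ∧ ∀ y ∈ Kᶜ, g y ∈ V ↔ y ∈ O)
    (hgp : IsProperMap g) (hp : 0 < p)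
    (hdyn : ∀ E,
      (g^[p] '' U E ⊂ U E ∧ IsEndBasisOf (fun n => g^[p * n] '' U E) E) ∨
      (g^[p] ⁻¹' U E ⊂ U E ∧ IsEndBasisOf (fun n => g^[p * n] ⁻¹' U E) E)) :
    ∃ R, IsRepellingRegion g R ∧ R ⊆ Kᶜ := by
  let T := {E : GraphEnd Γ //
    g^[p] ⁻¹' U E ⊂ U E ∧ IsEndBasisOf (fun n => g^[p * n] ⁻¹' U E) E} × Fin p
  have : Finite T := inferInstance
  let W : T → ℕ → Set Γ := fun i n => g^[p * n] ⁻¹' U i.1.1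
  have hWb : ∀ i, IsEndBasis (W i) := fun i => i.1.2.2.1
  have hWs : ∀ i n k, g^[p * k] ⁻¹' W i n = W i (n + k) := by
    intro i n k
    simp only [W, ← preimage_comp, ← Function.iterate_add, mul_add]
  have hWs1 : ∀ i n, g^[p] ⁻¹' W i n = W i (n + 1) := by
    intro i n
    have := hWs i n 1
    rwa [mul_one] at this
  have hWanti : ∀ i, Antitone (W i) := fun i => (hWb i).1
  have hfar : ∀ C, IsCompact C → ∀ᶠ n in atTop, ∀ i : T, Disjoint (g^[(i.2 : ℕ)] ⁻¹' W i n) C := by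
    intro C hC
    rw [eventually_all]
    intro i
    filter_upwards [(hWb i).eventually_disjoint (hC.image (g.continuous.iterate i.2))] with n hn
    rw [Set.disjoint_left] at hn ⊢
    intro y hy hyC
    exact hn hy ⟨y, hyC, rfl⟩
  obtain ⟨N, hN⟩ := (hfar K hK).exists_forall_of_atTop
  set R : Set Γ := ⋃ i : T, g^[(i.2 : ℕ)] ⁻¹' W i N with hR
  have hRmem : ∀ {y}, y ∈ R ↔ ∃ i : T, g^[(i.2 : ℕ)] y ∈ W i N := by
    intro y; simp only [hR, mem_iUnion, mem_preimage]
  have hRK : R ⊆ Kᶜ := by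
    intro y hy hyK
    obtain ⟨i, hi⟩ := hRmem.1 hy
    exact Set.disjoint_left.1 (hN N le_rfl i) hi hyK
  have hRo : IsOpen R :=
    isOpen_iUnion fun i => ((hWb i).isOpen N).preimage (g.continuous.iterate _)
  refine ⟨R, ⟨hRo, ?_, hinj.mono hRK, ?_, ?_, ?_, ?_⟩, hRK⟩
  · intro y hy
    obtain ⟨i, hi⟩ := hRmem.1 hy
    rw [← Function.iterate_succ_apply] at hi
    rcases (Nat.succ_le_of_lt i.2.2).lt_or_eq with h | h
    · exact hRmem.2 ⟨(i.1, ⟨i.2 + 1, h⟩), hi⟩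
    · rw [h] at hi
      refine hRmem.2 ⟨(i.1, ⟨0, hp⟩), hWanti i (Nat.le_succ N) ?_⟩
      rw [Nat.succ_eq_add_one, ← hWs1]
      exact hi
  · intro O hO
    obtain ⟨V, hV, h⟩ := hind O hO
    exact ⟨V, hV, fun y hy => h y (hRK hy)⟩
  · intro C hC
    obtain ⟨n, hn⟩ := (hfar C hC).exists_forall_of_atTop
    refine ⟨p * n, ?_⟩
    rw [Set.disjoint_left]
    intro y hy hyC
    obtain ⟨i, hi⟩ := hRmem.1 hy
    rw [← Function.iterate_add_apply, add_comm, Function.iterate_add_apply, ← mem_preimage,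
      hWs] at hi
    exact Set.disjoint_left.1 (hn (N + n) (by omega) i) hi hyC
  · have hc : IsCompact (⋃ i : T, g^[(i.2 : ℕ)] ⁻¹' frontier (W i N)) :=
      isCompact_iUnion fun i =>
        (isProperMap_iterate hgp i.2).isCompact_preimage ((hWb i).isCompact_frontier N)
    refine hc.of_isClosed_subset isClosed_frontier ?_
    rw [hRo.frontier_eq]
    rintro y ⟨hy, hyR⟩
    rw [hR, closure_iUnion_of_finite, mem_iUnion] at hy
    obtain ⟨i, hy⟩ := hy
    have : y ∈ g^[(i.2 : ℕ)] ⁻¹' closure (W i N) :=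
      closure_minimal (preimage_mono subset_closure)
        (isClosed_closure.preimage (g.continuous.iterate _)) hy
    rw [mem_preimage, closure_eq_self_union_frontier] at this
    rcases this with hw | hw
    · exact absurd (hRmem.2 ⟨i, hw⟩) hyR
    · exact mem_iUnion.2 ⟨i, hw⟩
  · intro x hgx hx
    have hx' : Tendsto (fun n => x (p * n)) atTop (cocompact Γ) :=
      hx.comp (tendsto_id.const_mul_atTop' hp)
    have hiter : ∀ k n, g^[k] (x (n + k)) = x n := by
      intro k
      induction k with
      | zero => intro n; rfl
      | succ k ih =>
        intro n
        rw [Function.iterate_succ_apply, ← add_assoc, hgx, ih]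
    obtain ⟨E, hE⟩ := exists_end_frequently hx'
    rcases hdyn E with h | h
    -- At an attracting end, `x (p * m) ∈ U E` forces `x 0 ∈ g^[p * m] '' U E` for arbitrarily large
    -- `m`, although these sets escape from `{x 0}`.
    · exfalso
      obtain ⟨n, hn⟩ := (h.2.1.eventually_disjoint (isCompact_singleton (x := x 0))).exists_forall_of_atTop
      obtain ⟨m, hm, hmU⟩ := frequently_atTop.1 (hE _ h.2 0) n
      refine Set.disjoint_left.1 (hn m hm) ⟨x (p * m), ?_, ?_⟩ (mem_singleton (x 0))
      · simpa using hmU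
      · have := hiter (p * m) 0
        rwa [zero_add] at this
    · obtain ⟨m, hm⟩ := (hE _ h.2 N).exists
      exact ⟨p * m, hRmem.2 ⟨(⟨E, h⟩, ⟨0, hp⟩), hm⟩⟩

end Existence

/-! ### The topology of the mapping torus -/

section TorusBasic

variable {Γ : Type u} {g : Γ → Γ}

theorem MappingTorus.mk_one (x : Γ) : MappingTorus.mk g (x, 1) = MappingTorus.mk g (g x, 0) :=
  Quot.sound ⟨x, rfl, rfl⟩

theorem MappingTorus.exists_rep (z : MappingTorus g) :
    ∃ (x : Γ) (s : I), (s : ℝ) < 1 ∧ z = MappingTorus.mk g (x, s) := by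
  obtain ⟨⟨x, s⟩, rfl⟩ := Quot.exists_rep z
  rcases s.2.2.lt_or_eq with h | h
  · exact ⟨x, s, h, rfl⟩
  · obtain rfl : s = 1 := Subtype.ext h
    exact ⟨g x, 0, by simp, mk_one x⟩

open Classical in
/-- The representative with second coordinate less than one of a point of the mapping torus. -/
noncomputable def MappingTorus.normalForm : MappingTorus g → Γ × ℝ :=
  Quot.lift (fun a : Γ × I => if a.2 = 1 then (g a.1, 0) else (a.1, (a.2 : ℝ))) (by
    rintro _ _ ⟨x, rfl, rfl⟩
    simp)

theorem MappingTorus.normalForm_mk (x : Γ) {s : I} (hs : (s : ℝ) < 1) :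
    MappingTorus.normalForm (MappingTorus.mk g (x, s)) = (x, (s : ℝ)) := by
  have : s ≠ 1 := fun h => by simp [h] at hs
  change (if s = 1 then _ else _) = _
  rw [if_neg this]

theorem MappingTorus.mk_eq_mk {x y : Γ} {s t : I} (hs : (s : ℝ) < 1) (ht : (t : ℝ) < 1)
    (h : MappingTorus.mk g (x, s) = MappingTorus.mk g (y, t)) : x = y ∧ s = t := by
  have := congrArg MappingTorus.normalForm h
  rw [normalForm_mk x hs, normalForm_mk y ht, Prod.mk.injEq] at this
  exact ⟨this.1, Subtype.ext this.2⟩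

theorem MappingTorus.mk_zero_injective {x y : Γ}
    (h : MappingTorus.mk g (x, 0) = MappingTorus.mk g (y, 0)) : x = y :=
  (mk_eq_mk (by simp) (by simp) h).1

theorem flow_zero (z : MappingTorus g) : flow g 0 z = z := by
  obtain ⟨x, s, hs, rfl⟩ := z.exists_rep
  rw [flow_mk]
  have h1 : ⌊(s : ℝ) + (0 : ℝ≥0)⌋₊ = 0 := by simp [hs]
  have h2 : Int.fract ((s : ℝ) + (0 : ℝ≥0)) = s := by
    simp [Int.fract_eq_self.2 ⟨s.2.1, hs⟩]
  simp only [h1, h2, Function.iterate_zero, id]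

theorem flow_natCast (n : ℕ) (x : Γ) (s : I) :
    flow g n (MappingTorus.mk g (x, s)) = MappingTorus.mk g (g^[n] x, s) := by
  rcases s.2.2.lt_or_eq with hs | hs
  · rw [flow_mk]
    have h1 : ⌊(s : ℝ) + ((n : ℝ≥0) : ℝ)⌋₊ = n := by
      rw [NNReal.coe_natCast, Nat.floor_add_natCast s.2.1, Nat.floor_eq_zero.2 hs, zero_add]
    have h2 : Int.fract ((s : ℝ) + ((n : ℝ≥0) : ℝ)) = s := by
      rw [NNReal.coe_natCast, Int.fract_add_natCast, Int.fract_eq_self.2 ⟨s.2.1, hs⟩]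
    simp only [h1, h2]
  · obtain rfl : s = 1 := Subtype.ext hs
    rw [flow_mk]
    have h1 : ⌊((1 : I) : ℝ) + ((n : ℝ≥0) : ℝ)⌋₊ = n + 1 := by
      rw [NNReal.coe_natCast, Icc.coe_one, add_comm, Nat.floor_add_one (Nat.cast_nonneg n),
        Nat.floor_natCast]
    have h2 : Int.fract (((1 : I) : ℝ) + ((n : ℝ≥0) : ℝ)) = 0 := by
      rw [NNReal.coe_natCast, Icc.coe_one, Int.fract_add_natCast, Int.fract_one]
    simp only [h1, h2]
    rw [MappingTorus.mk_one, ← Function.iterate_succ_apply' g]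
    rfl

theorem flow_of_add_le {x : Γ} {s : I} {t : ℝ≥0} (h : (s : ℝ) + t ≤ 1) :
    flow g t (MappingTorus.mk g (x, s)) =
      MappingTorus.mk g (x, ⟨s + t, add_nonneg s.2.1 t.coe_nonneg, h⟩) := by
  rcases h.lt_or_eq with h' | h'
  · rw [flow_mk]
    have h1 : ⌊(s : ℝ) + (t : ℝ)⌋₊ = 0 := Nat.floor_eq_zero.2 h'
    have h2 : Int.fract ((s : ℝ) + (t : ℝ)) = s + t :=
      Int.fract_eq_self.2 ⟨add_nonneg s.2.1 t.coe_nonneg, h'⟩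
    simp only [h1, h2, Function.iterate_zero, id]
  · have : (⟨s + t, add_nonneg s.2.1 t.coe_nonneg, h⟩ : I) = 1 := Subtype.ext h'
    rw [this, flow_mk]
    simp only [h', Nat.floor_one, Int.fract_one, Function.iterate_one, MappingTorus.mk_one]
    rfl

/-- The point which is reached from `(x, 0)` after time `n + s`. -/
theorem flow_natCast_add (n : ℕ) (s : ℝ≥0) (hs : (s : ℝ) ≤ 1) (x : Γ) :
    flow g (n + s) (MappingTorus.mk g (x, 0)) = MappingTorus.mk g (g^[n] x, ⟨s, s.coe_nonneg, hs⟩) := by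
  rw [flow_add, flow_natCast, flow_of_add_le (by simp [hs])]
  congr 3
  simp

/-- The height of a point of the mapping torus, as a point of the circle. -/
def torusHeight : MappingTorus g → AddCircle (1 : ℝ) :=
  Quot.lift (fun a : Γ × I => ((a.2 : ℝ) : AddCircle (1 : ℝ))) (by
    rintro _ _ ⟨x, rfl, rfl⟩
    simp)

theorem torusHeight_mk (x : Γ) (s : I) :
    torusHeight (MappingTorus.mk g (x, s)) = ((s : ℝ) : AddCircle (1 : ℝ)) := rfl

theorem coe_fract_addCircle (r : ℝ) :
    ((Int.fract r : ℝ) : AddCircle (1 : ℝ)) = (r : AddCircle (1 : ℝ)) := by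
  rw [← sub_eq_zero, ← AddCircle.coe_sub, AddCircle.coe_eq_zero_iff]
  refine ⟨-⌊r⌋, ?_⟩
  rw [zsmul_one, ← Int.self_sub_floor]
  push_cast
  ring

theorem torusHeight_flow (t : ℝ≥0) (z : MappingTorus g) :
    torusHeight (flow g t z) = torusHeight z + ((t : ℝ) : AddCircle (1 : ℝ)) := by
  obtain ⟨x, s, -, rfl⟩ := z.exists_rep
  rw [flow_mk, torusHeight_mk, torusHeight_mk, ← AddCircle.coe_add]
  exact coe_fract_addCircle _

theorem exists_mk_zero_of_torusHeight {z : MappingTorus g} (h : torusHeight z = 0) :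
    ∃ x, z = MappingTorus.mk g (x, 0) := by
  obtain ⟨x, s, hs, rfl⟩ := z.exists_rep
  refine ⟨x, ?_⟩
  rw [torusHeight_mk, AddCircle.coe_eq_zero_iff] at h
  obtain ⟨n, hn⟩ := h
  rw [zsmul_one] at hn
  have h1 : (n : ℝ) < 1 := by rw [hn]; exact hs
  have h0 : (0 : ℝ) ≤ n := by rw [hn]; exact s.2.1
  have h1' : n < 1 := by exact_mod_cast h1
  have h0' : 0 ≤ n := by exact_mod_cast h0
  obtain rfl : n = 0 := by omega
  have : s = 0 := Subtype.ext (by simpa using hn.symm)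
  rw [this]

/-- The function on the mapping torus given by `(x, s) ↦ f x + s * χ x`. -/
def torusFun (f χ : Γ → ℝ) (h : ∀ x, f (g x) = f x + χ x) : MappingTorus g → ℝ :=
  Quot.lift (fun a : Γ × I => f a.1 + a.2 * χ a.1) (by
    rintro _ _ ⟨x, rfl, rfl⟩
    simp [h])

theorem torusFun_mk (f χ : Γ → ℝ) (h : ∀ x, f (g x) = f x + χ x) (x : Γ) (s : I) :
    torusFun f χ h (MappingTorus.mk g (x, s)) = f x + s * χ x := rfl

end TorusBasic

section TorusTopology

variable {Γ : Type u} [TopologicalSpace Γ] {g : C(Γ, Γ)}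

theorem MappingTorus.isQuotientMap_mk : IsQuotientMap (MappingTorus.mk g) := isQuotientMap_quot_mk

theorem MappingTorus.continuous_mk : Continuous (MappingTorus.mk g) :=
  isQuotientMap_mk.continuous

theorem continuous_torusHeight : Continuous (torusHeight (g := g)) := by
  rw [MappingTorus.isQuotientMap_mk.continuous_iff]
  change Continuous fun a : Γ × I => ((a.2 : ℝ) : AddCircle (1 : ℝ))
  exact (AddCircle.continuous_mk' (1 : ℝ)).comp (by fun_prop)

theorem continuous_torusFun {f χ : Γ → ℝ} (h : ∀ x, f (g x) = f x + χ x) (hf : Continuous f)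
    (hχ : Continuous χ) : Continuous (torusFun (g := g) f χ h) := by
  rw [MappingTorus.isQuotientMap_mk.continuous_iff]
  change Continuous fun a : Γ × I => f a.1 + a.2 * χ a.1
  fun_prop

/-- An open set `O` of `Γ` is thickened to a saturated open collar of level zero: heights below
`1/2` over `O`, and heights above `1/2` over its preimage under `g`. -/
theorem isInducing_mk_zero : IsInducing fun x : Γ => MappingTorus.mk g (x, 0) := by
  have hc : Continuous fun x : Γ => MappingTorus.mk g (x, 0) :=
    MappingTorus.continuous_mk.comp (by fun_prop)
  refine ⟨le_antisymm hc.le_induced ?_⟩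
  intro O hO
  rw [isOpen_induced_iff]
  refine ⟨{z | ∃ a : Γ × I, z = MappingTorus.mk g a ∧
    (((a.2 : ℝ) < 1 / 2 ∧ a.1 ∈ O) ∨ ((1 / 2 : ℝ) < a.2 ∧ g a.1 ∈ O))}, ?_, ?_⟩
  · rw [← MappingTorus.isQuotientMap_mk.isOpen_preimage]
    have : MappingTorus.mk g ⁻¹' {z | ∃ a : Γ × I, z = MappingTorus.mk g a ∧
        (((a.2 : ℝ) < 1 / 2 ∧ a.1 ∈ O) ∨ ((1 / 2 : ℝ) < a.2 ∧ g a.1 ∈ O))} =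
        {a : Γ × I | ((a.2 : ℝ) < 1 / 2 ∧ a.1 ∈ O) ∨ ((1 / 2 : ℝ) < a.2 ∧ g a.1 ∈ O)} := by
      ext ⟨x, s⟩
      constructor
      · rintro ⟨⟨y, t⟩, h, h'⟩
        rcases s.2.2.lt_or_eq with hs | hs <;> rcases t.2.2.lt_or_eq with ht | ht
        · obtain ⟨rfl, rfl⟩ := MappingTorus.mk_eq_mk hs ht h
          exact h'
        · obtain rfl : t = 1 := Subtype.ext ht
          rw [MappingTorus.mk_one] at h
          obtain ⟨rfl, rfl⟩ := MappingTorus.mk_eq_mk hs (by simp) h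
          rcases h' with h' | h'
          · norm_num at h'
          · left
            exact ⟨by norm_num, h'.2⟩
        · obtain rfl : s = 1 := Subtype.ext hs
          rw [MappingTorus.mk_one] at h
          obtain ⟨rfl, rfl⟩ := MappingTorus.mk_eq_mk (by simp) ht h
          rcases h' with h' | h'
          · right
            exact ⟨by norm_num, h'.2⟩
          · norm_num at h'
        · obtain rfl : s = 1 := Subtype.ext hs
          obtain rfl : t = 1 := Subtype.ext ht
          rw [MappingTorus.mk_one, MappingTorus.mk_one] at h
          have := MappingTorus.mk_zero_injective h
          rcases h' with h' | h'
          · norm_num at h'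
          · right
            refine ⟨by norm_num, ?_⟩
            change g x ∈ O
            rw [this]
            exact h'.2
      · intro h
        exact ⟨(x, s), rfl, h⟩
    rw [this]
    refine IsOpen.union ?_ ?_
    · exact (isOpen_lt (f := fun a : Γ × I => (a.2 : ℝ)) (by fun_prop) continuous_const).inter
        (hO.preimage continuous_fst)
    · exact (isOpen_lt (g := fun a : Γ × I => (a.2 : ℝ)) continuous_const (by fun_prop)).inter
        (hO.preimage (g.continuous.comp continuous_fst))
  · ext x
    constructor
    · rintro ⟨⟨y, t⟩, h, h'⟩
      rcases t.2.2.lt_or_eq with ht | ht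
      · obtain ⟨rfl, rfl⟩ := MappingTorus.mk_eq_mk (by simp) ht h
        rcases h' with h' | h'
        · exact h'.2
        · norm_num at h'
      · obtain rfl : t = 1 := Subtype.ext ht
        rw [MappingTorus.mk_one] at h
        obtain rfl := MappingTorus.mk_zero_injective h
        rcases h' with h' | h'
        · norm_num at h'
        · exact h'.2
    · intro hx
      exact ⟨(x, 0), rfl, Or.inl ⟨by norm_num, hx⟩⟩

theorem continuous_of_mk_zero {X : Type*} [TopologicalSpace X] {f : X → Γ}
    (h : Continuous fun x => MappingTorus.mk g (f x, 0)) : Continuous f :=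
  isInducing_mk_zero.continuous_iff.2 h

/-- On each slab of times between `n` and `n + 1` the flow is given by an explicit formula. Finitely
many closed slabs are glued, and every point is interior to such a union. -/
theorem continuous_suspension :
    Continuous fun q : Γ × ℝ≥0 => flow g q.2 (MappingTorus.mk g (q.1, 0)) := by
  have hcl : ∀ n : ℕ, ContinuousOn (fun q : Γ × ℝ≥0 => flow g q.2 (MappingTorus.mk g (q.1, 0)))
      {q | q.2 ≤ n} := by
    intro n
    induction n with
    | zero =>
      have : Continuous fun q : Γ × ℝ≥0 => MappingTorus.mk g (q.1, 0) :=
        MappingTorus.continuous_mk.comp (by fun_prop)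
      refine this.continuousOn.congr fun q hq => ?_
      have : q.2 = 0 := by simpa using hq
      simp only [this, flow_zero]
    | succ n ih =>
      have h2 : ContinuousOn (fun q : Γ × ℝ≥0 => flow g q.2 (MappingTorus.mk g (q.1, 0)))
          {q | (n : ℝ≥0) ≤ q.2 ∧ q.2 ≤ n + 1} := by
        have : Continuous fun q : Γ × ℝ≥0 =>
            MappingTorus.mk g (g^[n] q.1, projIcc (0 : ℝ) 1 zero_le_one (q.2 - n)) :=
          MappingTorus.continuous_mk.comp
            (((g.continuous.iterate n).comp continuous_fst).prodMk
              (continuous_projIcc.comp (by fun_prop)))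
        refine this.continuousOn.congr fun q hq => ?_
        have h0 : q.2 = n + (q.2 - n) := (add_tsub_cancel_of_le hq.1).symm
        have h1 : ((q.2 - n : ℝ≥0) : ℝ) = q.2 - n := by
          rw [NNReal.coe_sub hq.1]; simp
        have h3 : ((q.2 : ℝ≥0) : ℝ) ≤ n + 1 := by exact_mod_cast hq.2
        have h4 : ((q.2 - n : ℝ≥0) : ℝ) ≤ 1 := by rw [h1]; linarith
        change flow g q.2 (MappingTorus.mk g (q.1, 0)) = _
        have h6 := flow_natCast_add (g := g) n _ h4 q.1
        rw [← h0] at h6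
        rw [h6]
        congr 2
        have h5 : (q.2 : ℝ) - n ∈ Icc (0 : ℝ) 1 := by
          rw [← h1]; exact ⟨NNReal.coe_nonneg _, h4⟩
        rw [projIcc_of_mem _ h5]
        exact Subtype.ext h1
      refine (ih.union_of_isClosed h2 ?_ ?_).mono ?_
      · exact isClosed_le (by fun_prop) continuous_const
      · exact (isClosed_le continuous_const (by fun_prop)).inter
          (isClosed_le (by fun_prop) continuous_const)
      · intro q hq
        rcases le_total q.2 n with h | h
        · exact Or.inl h
        · exact Or.inr ⟨h, by simpa using hq⟩
  rw [continuous_iff_continuousAt]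
  rintro ⟨x, r⟩
  obtain ⟨n, hn⟩ := exists_nat_gt r
  refine (hcl n).continuousAt ?_
  filter_upwards [(isOpen_lt (f := fun q : Γ × ℝ≥0 => q.2) (g := fun _ => (n : ℝ≥0))
    (by fun_prop) continuous_const).mem_nhds hn] with q hq
  exact hq.le

theorem flow_mk_eq_suspension (t : ℝ≥0) (x : Γ) (s : I) :
    flow g t (MappingTorus.mk g (x, s)) =
      flow g ((s : ℝ).toNNReal + t) (MappingTorus.mk g (x, 0)) := by
  rw [flow_add, flow_of_add_le (s := 0) (by simpa [s.2.1] using s.2.2)]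
  congr 3
  exact Subtype.ext (by simp [s.2.1])

/-- A quotient map times a space need not be a quotient map. Currying moves the time variable into a
function space, where the quotient property applies; uncurrying is possible because `ℝ≥0` is locally
compact. -/
theorem continuous_flow : Continuous fun q : MappingTorus g × ℝ≥0 => flow g q.2 q.1 := by
  let F : C(Γ × I, C(ℝ≥0, MappingTorus g)) := ContinuousMap.curry
    ⟨fun q : (Γ × I) × ℝ≥0 => flow g q.2 (MappingTorus.mk g q.1), by
      have : (fun q : (Γ × I) × ℝ≥0 => flow g q.2 (MappingTorus.mk g q.1)) =
          (fun q : Γ × ℝ≥0 => flow g q.2 (MappingTorus.mk g (q.1, 0))) ∘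
          fun q : (Γ × I) × ℝ≥0 => (q.1.1, ((q.1.2 : ℝ)).toNNReal + q.2) := by
        funext q
        exact flow_mk_eq_suspension q.2 q.1.1 q.1.2
      rw [this]
      refine continuous_suspension.comp (Continuous.prodMk (by fun_prop) ?_)
      exact (continuous_real_toNNReal.comp (by fun_prop)).add continuous_snd⟩
  let F' : C(MappingTorus g, C(ℝ≥0, MappingTorus g)) :=
    ⟨fun z => ⟨fun t => flow g t z, by
      obtain ⟨a, rfl⟩ := Quot.exists_rep z
      exact (F a).continuous⟩, by
      rw [MappingTorus.isQuotientMap_mk.continuous_iff]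
      exact F.continuous⟩
  exact (ContinuousMap.uncurry F').continuous

theorem tendsto_orbit_of_tendsto_flow {x : Γ} {s : I}
    (h : Tendsto (fun t : ℝ≥0 => flow g t (MappingTorus.mk g (x, s))) atTop
      (cocompact (MappingTorus g))) : Tendsto (fun n => g^[n] x) atTop (cocompact Γ) := by
  rw [hasBasis_cocompact.tendsto_right_iff]
  intro K hK
  have hK' : IsCompact ((fun x : Γ => MappingTorus.mk g (x, s)) '' K) :=
    hK.image (MappingTorus.continuous_mk.comp (by fun_prop))
  have h1 := (h.comp tendsto_natCast_atTop_atTop).eventually hK'.compl_mem_cocompact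
  filter_upwards [h1] with n hn hnK
  apply hn
  simp only [Function.comp]
  rw [flow_natCast]
  exact ⟨_, hnK, rfl⟩

end TorusTopology

/-! ### Flow functions on attracting and repelling regions -/

section FlowFunctions

variable {Γ : Type u} [TopologicalSpace Γ]

/-- A point of `closure (D k)` outside `D 0` lies on the compact frontier of `D 0`, and for large
`k` the set `D k` misses a compact neighbourhood of that frontier. -/
theorem exists_closure_subset_of_escape [WeaklyLocallyCompactSpace Γ] {D : ℕ → Set Γ}
    (hanti : Antitone D) (hfr : IsCompact (frontier (D 0)))
    (hesc : ∀ K, IsCompact K → ∃ n, Disjoint (D n) K) : ∃ k, closure (D k) ⊆ D 0 := by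
  obtain ⟨K, hK, hfK⟩ := exists_compact_superset hfr
  obtain ⟨k, hk⟩ := hesc K hK
  refine ⟨k, fun x hx => ?_⟩
  by_contra hx0
  have hxf : x ∈ frontier (D 0) :=
    ⟨closure_mono (hanti (Nat.zero_le k)) hx, fun h => hx0 (interior_subset h)⟩
  obtain ⟨y, hy1, hy2⟩ := mem_closure_iff.1 hx _ isOpen_interior (hfK hxf)
  exact Set.disjoint_left.1 hk hy2 (interior_subset hy1)

theorem locallyFinite_of_escape [WeaklyLocallyCompactSpace Γ] {D S : ℕ → Set Γ}
    (hanti : Antitone D) (hesc : ∀ K, IsCompact K → ∃ n, Disjoint (D n) K)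
    (hS : ∀ n, S n ⊆ D n) : LocallyFinite S := by
  intro x
  obtain ⟨K, hK, hxK⟩ := exists_compact_mem_nhds x
  obtain ⟨n, hn⟩ := hesc K hK
  refine ⟨K, hxK, (finite_lt_nat n).subset ?_⟩
  rintro m ⟨y, hy, hyK⟩
  by_contra hm
  exact Set.disjoint_left.1 hn (hanti (not_lt.1 hm) (hS m hy)) hyK

theorem finsum_eq_zero_add {f : ℕ → ℝ} (hf : (Function.support f).Finite) :
    ∑ᶠ n, f n = f 0 + ∑ᶠ n, f (n + 1) := by
  have hf' : (Function.support fun n => f (n + 1)).Finite :=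
    hf.preimage (f := fun n => n + 1) (fun a _ b _ h => by simpa using h)
  rw [← tsum_eq_finsum (L := .unconditional ℕ) hf, ← tsum_eq_finsum (L := .unconditional ℕ) hf']
  exact (summable_of_hasFiniteSupport hf).tsum_eq_zero_add

variable {g : C(Γ, Γ)}

/-- A function `T` on `Γ` which decreases by one along the orbits of `g` far out in the repelling
region `R`. -/
structure IsRepellingFunction (g : C(Γ, Γ)) (R : Set Γ) (T ψ : Γ → ℝ) (k : ℕ) : Prop where
  continuous : Continuous T
  continuous_step : Continuous ψ
  apply_map : ∀ x, T (g x) = T x + -ψ x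
  step_le_one : ∀ x, ψ x ≤ 1
  le_of_notMem : ∀ x, x ∉ g^[k] ⁻¹' R → T x ≤ k
  step_eq_one : ∀ x ∈ g^[k] ⁻¹' R, ψ x = 1
  le_of_mem : ∀ n : ℕ, ∀ x ∈ g^[k + n] ⁻¹' R, (n : ℝ) ≤ T x

/-- A function `S` on `Γ` which increases by one along the orbits of `g` far out in the attracting
region `A`. -/
structure IsAttractingFunction (g : C(Γ, Γ)) (A : Set Γ) (S χ : Γ → ℝ) (k : ℕ) : Prop where
  continuous : Continuous S
  continuous_step : Continuous χ
  apply_map : ∀ x, S (g x) = S x + χ x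
  step_le_one : ∀ x, χ x ≤ 1
  le_of_notMem : ∀ x, x ∉ g^[k + 1] '' A → S x ≤ k
  step_eq_one : ∀ x ∈ g^[k] '' A, χ x = 1
  nonneg : ∀ x, 0 ≤ S x

/-! ### Functions on the repelling region -/

section Repelling

variable {R : Set Γ} (hR : IsRepellingRegion g R)
include hR

theorem IsRepellingRegion.antitone : Antitone fun n => g^[n] ⁻¹' R := by
  refine antitone_nat_of_succ_le fun n x hx => ?_
  rw [mem_preimage, Function.iterate_succ_apply'] at hx
  exact hR.preimage hx

/-- Take an Urysohn function `f` that vanishes off `R` and equals one deep in `R`, and put `T x = ∑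
f (g^[n] x)`. The sum is locally finite because the iterated preimages of `R` escape, and shifting
the index gives the functional equation. -/
theorem IsRepellingRegion.exists_flowFunction [T2Space Γ] [WeaklyLocallyCompactSpace Γ]
    [SigmaCompactSpace Γ] :
    ∃ (T ψ : Γ → ℝ) (k : ℕ), IsRepellingFunction g R T ψ k := by
  obtain ⟨k, hk⟩ := exists_closure_subset_of_escape hR.antitone hR.isCompact_frontier hR.escape
  obtain ⟨f, hf0, hf1, hf01⟩ := exists_continuous_zero_one_of_isClosed
    hR.isOpen.isClosed_compl (isClosed_closure (s := g^[k] ⁻¹' R))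
    (disjoint_compl_left_iff_subset.2 hk)
  have hf0' : ∀ x, x ∉ R → f x = 0 := fun x hx => hf0 hx
  have hf1' : ∀ x ∈ g^[k] ⁻¹' R, f x = 1 := fun x hx => hf1 (subset_closure hx)
  have hsupp : ∀ n, (Function.support fun x => f (g^[n] x)) ⊆ g^[n] ⁻¹' R := by
    intro n x hx
    by_contra hxR
    exact hx (hf0' _ hxR)
  have hlf : LocallyFinite fun n => Function.support fun x => f (g^[n] x) :=
    locallyFinite_of_escape hR.antitone hR.escape hsupp
  have hfin : ∀ x, (Function.support fun n => f (g^[n] x)).Finite := fun x => hlf.point_finite x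
  set T : Γ → ℝ := fun x => ∑ᶠ n, f (g^[n] x) with hT
  have hrec : ∀ x, T x = f x + T (g x) := fun x => by
    simp only [hT]
    rw [finsum_eq_zero_add (hfin x)]
    rfl
  have hnn : ∀ x, 0 ≤ T x := fun x => finsum_nonneg fun n => (hf01 _).1
  -- Only the first `n` terms can be nonzero, and each is at most one.
  have hTout : ∀ n : ℕ, ∀ x, x ∉ g^[n] ⁻¹' R → T x ≤ n := by
    intro n
    induction n with
    | zero =>
      intro x hx
      have : T x = 0 := by
        simp only [hT]
        rw [← finsum_zero (α := ℕ)]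
        congr 1
        funext n
        exact hf0' _ fun h => hx (hR.antitone (Nat.zero_le n) h)
      simp [this]
    | succ n ih =>
      intro x hx
      rw [hrec]
      have := ih (g x) hx
      push_cast
      linarith [(hf01 x).2]
  refine ⟨T, f, k, continuous_finsum (fun n => f.continuous.comp (g.continuous.iterate n)) hlf,
    f.continuous, fun x => by rw [hrec x]; ring, fun x => (hf01 x).2, hTout k, hf1',
    ?_⟩
  intro n
  induction n with
  | zero => intro x _; simpa using hnn x
  | succ n ih =>
    intro x hx
    rw [hrec, hf1' x (hR.antitone (by omega : k ≤ k + (n + 1)) hx)]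
    have := ih (g x) hx
    push_cast
    linarith

end Repelling

/-! ### Functions on the attracting region -/

section Attracting

variable {A : Set Γ} (hA : IsAttractingRegion g A)
include hA

theorem IsAttractingRegion.antitone : Antitone fun n => g^[n] '' A := by
  refine antitone_nat_of_succ_le fun n => ?_
  change g^[n + 1] '' A ⊆ g^[n] '' A
  rw [Function.iterate_succ, image_comp]
  exact image_mono hA.mapsTo.image_subset

theorem IsAttractingRegion.isOpen_iterate_image (n : ℕ) {O : Set Γ} (hO : IsOpen O)
    (hOA : O ⊆ A) : IsOpen (g^[n] '' O) ∧ g^[n] '' O ⊆ A := by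
  induction n with
  | zero => simpa using ⟨hO, hOA⟩
  | succ n ih =>
    rw [Function.iterate_succ', image_comp]
    exact ⟨hA.isOpen_image _ ih.2 ih.1, (image_mono ih.2).trans hA.mapsTo.image_subset⟩

theorem IsAttractingRegion.injOn_iterate (n : ℕ) : InjOn g^[n] A := hA.injOn.iterate hA.mapsTo n

omit hA in
-- On `g '' A` continuity holds because `g` is open on `A`. At any other point `φ` vanishes nearby,
-- because the support is contained in the closed set `g '' C`.
theorem continuous_extendZero {f : Γ → ℝ} (hf : Continuous f) {A C : Set Γ}
    (hopen : ∀ O ⊆ A, IsOpen O → IsOpen (g '' O)) (hAo : IsOpen A)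
    (hCA : C ⊆ A) (hC : IsClosed (g '' C)) (hfC : ∀ x, x ∉ C → f x = 0) (φ : Γ → ℝ)
    (hφ : ∀ x ∈ A, φ (g x) = f x) (hφ' : ∀ x, x ∉ g '' A → φ x = 0) : Continuous φ := by
  rw [continuous_iff_continuousAt]
  intro x₀
  by_cases hx₀ : x₀ ∈ g '' A
  · obtain ⟨y₀, hy₀, rfl⟩ := hx₀
    rw [ContinuousAt, hφ y₀ hy₀, tendsto_def]
    intro V hV
    obtain ⟨V', hV'V, hV', hy₀V⟩ := mem_nhds_iff.1 hV
    refine mem_of_superset ((hopen (A ∩ f ⁻¹' V') inter_subset_left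
      (hAo.inter (hV'.preimage hf))).mem_nhds ⟨y₀, ⟨hy₀, hy₀V⟩, rfl⟩) ?_
    rintro _ ⟨y, ⟨hyA, hyV⟩, rfl⟩
    rw [mem_preimage, hφ y hyA]
    exact hV'V hyV
  · have hev : ∀ᶠ x in 𝓝 x₀, φ x = 0 := by
      have hxC' : x₀ ∉ g '' C := fun h => hx₀ (image_mono hCA h)
      filter_upwards [hC.isOpen_compl.mem_nhds hxC'] with x hx
      by_cases hxA : x ∈ g '' A
      · obtain ⟨y, hy, rfl⟩ := hxA
        rw [hφ y hy]
        exact hfC y fun h => hx ⟨y, h, rfl⟩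
      · exact hφ' x hxA
    exact continuousAt_const.congr (hev.mono fun x hx => hx.symm)

open Classical in
/-- The function `f` on `A`, transported by `g` to the image of `A` and extended by zero. -/
noncomputable def pushForward (g : Γ → Γ) (A : Set Γ) (f : Γ → ℝ) (x : Γ) : ℝ :=
  if h : ∃ y ∈ A, g y = x then f h.choose else 0

omit hA in
theorem pushForward_of_notMem {f : Γ → ℝ} {x : Γ} (hx : x ∉ g '' A) : pushForward g A f x = 0 := by
  unfold pushForward
  rw [dif_neg]
  exact hx

omit hA in
theorem pushForward_apply (hinj : InjOn g A) {f : Γ → ℝ} {x : Γ} (hx : x ∈ A) :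
    pushForward g A f (g x) = f x := by
  have h : ∃ y ∈ A, g y = g x := ⟨x, hx, rfl⟩
  unfold pushForward
  rw [dif_pos h, hinj h.choose_spec.1 hx h.choose_spec.2]

/-- Here the bump function `f` is summed along backward orbits, which are unique inside `A`: the
terms are the iterated push-forwards of `f` by `g`, extended by zero. -/
theorem IsAttractingRegion.exists_flowFunction [T2Space Γ] [WeaklyLocallyCompactSpace Γ]
    [SigmaCompactSpace Γ] (hgp : IsProperMap g) :
    ∃ (S χ : Γ → ℝ) (k : ℕ), IsAttractingFunction g A S χ k := by
  have hfr : IsCompact (frontier (g^[0] '' A)) := by simpa using hA.isCompact_frontier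
  obtain ⟨k, hk⟩ := exists_closure_subset_of_escape hA.antitone hfr hA.escape
  have hk' : closure (g^[k] '' A) ⊆ A := by simpa using hk
  -- The intermediate `V` gives `f` a closed support `C` inside `A`; the images of `C` are closed by
  -- properness, which makes the extensions by zero continuous.
  obtain ⟨V, hV, hkV, hVA⟩ := normal_exists_closure_subset isClosed_closure hA.isOpen hk'
  obtain ⟨f, hf0, hf1, hf01⟩ := exists_continuous_zero_one_of_isClosed
    hV.isClosed_compl (isClosed_closure (s := g^[k] '' A))
    (disjoint_compl_left_iff_subset.2 hkV)
  set C := closure V with hC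
  have hf0' : ∀ x, x ∉ C → f x = 0 := fun x hx => hf0 fun h => hx (subset_closure h)
  have hf1' : ∀ x ∈ g^[k] '' A, f x = 1 := fun x hx => hf1 (subset_closure hx)
  let F : ℕ → Γ → ℝ := fun n => (pushForward g A)^[n] f
  have hF : ∀ n, F (n + 1) = pushForward g A (F n) := fun n =>
    Function.iterate_succ_apply' (pushForward g A) n _
  have hCA : ∀ n, g^[n] '' C ⊆ g^[n] '' A := fun n => image_mono hVA
  have hCA' : ∀ n, g^[n] '' C ⊆ A := fun n => by
    rintro _ ⟨y, hy, rfl⟩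
    exact hA.mapsTo.iterate n (hVA hy)
  have hFzero : ∀ n x, x ∉ g^[n] '' C → F n x = 0 := by
    intro n
    induction n with
    | zero => intro x hx; exact hf0' x (by simpa using hx)
    | succ n ih =>
      intro x hx
      rw [hF]
      by_cases hxA : x ∈ g '' A
      · obtain ⟨y, hy, rfl⟩ := hxA
        rw [pushForward_apply hA.injOn hy]
        refine ih y fun h => hx ?_
        rw [Function.iterate_succ', image_comp]
        exact ⟨y, h, rfl⟩
      · exact pushForward_of_notMem hxA
  have hFcont : ∀ n, Continuous (F n) := by
    intro n
    induction n with
    | zero => exact f.continuous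
    | succ n ih =>
      rw [hF]
      refine continuous_extendZero ih hA.isOpen_image hA.isOpen (hCA' n) ?_ (hFzero n)
        _ (fun x hx => pushForward_apply hA.injOn hx) fun x hx => pushForward_of_notMem hx
      rw [← image_comp, ← Function.iterate_succ']
      exact (isProperMap_iterate hgp _).isClosedMap _ isClosed_closure
  -- This holds also for `x` outside `A`: then `F n x = 0`, and `g x` is not in `g '' A` by
  -- `preimage_image`.
  have hFg : ∀ n x, F (n + 1) (g x) = F n x := by
    intro n x
    rw [hF]
    by_cases hx : x ∈ A
    · exact pushForward_apply hA.injOn hx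
    · rw [hFzero n x fun h => hx (hCA' n h)]
      exact pushForward_of_notMem fun h => hx (hA.preimage_image h)
  have hFnn : ∀ n x, 0 ≤ F n x := by
    intro n
    induction n with
    | zero => exact fun x => (hf01 x).1
    | succ n ih =>
      intro x
      rw [hF]
      by_cases hxA : x ∈ g '' A
      · obtain ⟨y, hy, rfl⟩ := hxA
        rw [pushForward_apply hA.injOn hy]
        exact ih y
      · rw [pushForward_of_notMem hxA]
  have hsupp : ∀ n, Function.support (F n) ⊆ g^[n] '' A := by
    intro n x hx
    by_contra hxA
    exact hx (hFzero n x fun h => hxA (hCA n h))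
  have hlf : LocallyFinite fun n => Function.support (F n) :=
    locallyFinite_of_escape hA.antitone hA.escape hsupp
  have hlf' : LocallyFinite fun n => Function.support (F (n + 1)) :=
    hlf.comp_injective (add_left_injective 1)
  -- The term `F 0 = f` is omitted so that it appears as the increment from `S x` to `S (g x)`.
  set S : Γ → ℝ := fun x => ∑ᶠ n, F (n + 1) x with hS
  have hrec : ∀ x, S (g x) = S x + f x := by
    intro x
    simp only [hS, hFg]
    rw [finsum_eq_zero_add (hlf.point_finite x), add_comm]
    rfl
  have hzero : ∀ x, x ∉ g '' A → S x = 0 := by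
    intro x hx
    simp only [hS]
    rw [← finsum_zero (α := ℕ)]
    congr 1
    funext n
    rw [hF]
    exact pushForward_of_notMem hx
  have hSout : ∀ n : ℕ, ∀ x, x ∉ g^[n + 1] '' A → S x ≤ n := by
    intro n
    induction n with
    | zero =>
      intro x hx
      rw [hzero x (by simpa using hx)]
      simp
    | succ n ih =>
      intro x hx
      by_cases hxA : x ∈ g '' A
      · obtain ⟨y, hy, rfl⟩ := hxA
        rw [hrec]
        have := ih y fun h => hx (by
          rw [Function.iterate_succ', image_comp]
          exact ⟨y, h, rfl⟩)
        push_cast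
        linarith [(hf01 y).2]
      · rw [hzero x hxA]
        positivity
  refine ⟨S, f, k, continuous_finsum (fun n => hFcont _) hlf', f.continuous, hrec,
    fun x => (hf01 x).2, hSout k, hf1', fun x => finsum_nonneg fun n => hFnn _ x⟩

end Attracting

end FlowFunctions

/-! ### Backward flowlines -/

section NegFlowlines

variable {Γ : Type u} [TopologicalSpace Γ] {g : C(Γ, Γ)}

theorem flow_eq_mk_iterate (x : Γ) (s : I) (t : ℝ≥0) :
    ∃ (n : ℕ) (s' : I), (s' : ℝ) < 1 ∧ (s : ℝ) + t = n + s' ∧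
      flow g t (MappingTorus.mk g (x, s)) = MappingTorus.mk g (g^[n] x, s') := by
  refine ⟨⌊(s : ℝ) + t⌋₊, ⟨Int.fract ((s : ℝ) + t), Int.fract_nonneg _, (Int.fract_lt_one _).le⟩,
    Int.fract_lt_one _, ?_, flow_mk _ _ _⟩
  have h0 : (0 : ℝ) ≤ (s : ℝ) + t := add_nonneg s.2.1 t.coe_nonneg
  rw [natCast_floor_eq_intCast_floor h0]
  exact (Int.floor_add_fract _).symm

theorem NegEscaping.exists_orbit (l : NegEscaping g) {a : ℝ} (ha : torusHeight (l.1 a) = 0) :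
    ∃ x : ℕ → Γ, (∀ n, g (x (n + 1)) = x n) ∧ ∀ n : ℕ, l.1 (a - n) = MappingTorus.mk g (x n, 0) := by
  have hheight : ∀ n : ℕ, torusHeight (l.1 (a - n)) = 0 := by
    intro n
    have h1 := l.2.1 (a - n) n
    rw [NNReal.coe_natCast, sub_add_cancel] at h1
    rw [h1, torusHeight_flow, NNReal.coe_natCast] at ha
    have : ((n : ℝ) : AddCircle (1 : ℝ)) = 0 := by
      rw [AddCircle.coe_eq_zero_iff]
      exact ⟨n, by simp⟩
    rwa [this, add_zero] at ha
  choose x hx using fun n => exists_mk_zero_of_torusHeight (hheight n)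
  refine ⟨x, fun n => ?_, hx⟩
  have h1 := l.2.1 (a - (n + 1 : ℕ)) 1
  have h2 : a - (n + 1 : ℕ) + ((1 : ℝ≥0) : ℝ) = a - n := by push_cast; ring
  have h3 := flow_natCast (g := g) 1 (x (n + 1)) 0
  rw [Nat.cast_one] at h3
  rw [h2, hx, hx, h3] at h1
  exact (MappingTorus.mk_zero_injective h1).symm

/-- A flowline crosses the level `Γ × {0}` at a sequence of times tending to `-∞`. -/
theorem NegEscaping.exists_backward_orbit (l : NegEscaping g) :
    ∃ (a : ℝ) (x : ℕ → Γ), (∀ n, g (x (n + 1)) = x n) ∧ Tendsto x atTop (cocompact Γ) ∧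
      ∀ n : ℕ, l.1 (a - n) = MappingTorus.mk g (x n, 0) := by
  obtain ⟨x₀, s, hs, h0⟩ := (l.1 0).exists_rep
  have hheight : torusHeight (l.1 (1 - s)) = 0 := by
    have hc : ((1 - (s : ℝ)).toNNReal : ℝ) = 1 - s := Real.coe_toNNReal _ (sub_nonneg.2 hs.le)
    have h1 := l.2.1 0 (1 - (s : ℝ)).toNNReal
    rw [hc, zero_add] at h1
    rw [h1, torusHeight_flow, h0, torusHeight_mk, hc, ← AddCircle.coe_add, add_sub_cancel]
    exact AddCircle.coe_period 1
  obtain ⟨x, hg, hx⟩ := l.exists_orbit hheight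
  refine ⟨_, x, hg, ?_, hx⟩
  rw [hasBasis_cocompact.tendsto_right_iff]
  intro K hK
  have hK' : IsCompact ((fun x : Γ => MappingTorus.mk g (x, 0)) '' K) :=
    hK.image (MappingTorus.continuous_mk.comp (by fun_prop))
  have ht : Tendsto (fun n : ℕ => 1 - (s : ℝ) - n) atTop atBot :=
    tendsto_const_nhds.add_atBot (tendsto_neg_atTop_atBot.comp tendsto_natCast_atTop_atTop)
  filter_upwards [(l.2.2.comp ht).eventually hK'.compl_mem_cocompact] with n hn hnK
  apply hn
  simp only [Function.comp, hx]
  exact ⟨_, hnK, rfl⟩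

variable {R : Set Γ} {T ψ : Γ → ℝ} {k : ℕ}

/-- The function on the mapping torus defined by a repelling function. -/
def IsRepellingFunction.fn (h : IsRepellingFunction g R T ψ k) : MappingTorus g → ℝ :=
  torusFun T (fun x => -ψ x) h.apply_map

variable (h : IsRepellingFunction g R T ψ k) (hR : IsRepellingRegion g R)
include h

theorem IsRepellingFunction.fn_mk (x : Γ) (s : I) :
    h.fn (MappingTorus.mk g (x, s)) = T x - s * ψ x := by
  unfold fn
  rw [torusFun_mk]
  ring

theorem IsRepellingFunction.continuous_fn : Continuous h.fn :=
  continuous_torusFun h.apply_map h.continuous h.continuous_step.neg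

theorem IsRepellingFunction.mem_of_lt {x : Γ} (hx : (k : ℝ) < T x) : x ∈ g^[k] ⁻¹' R := by
  by_contra hxR
  exact absurd (h.le_of_notMem x hxR) (not_le.2 hx)

include hR

omit h in
theorem IsRepellingRegion.mem_of_iterate_mem {m n : ℕ} {x : Γ} (hx : g^[n] x ∈ g^[m] ⁻¹' R) :
    x ∈ g^[m] ⁻¹' R := by
  rw [mem_preimage, ← Function.iterate_add_apply] at hx
  exact hR.antitone (Nat.le_add_right m n) hx

theorem IsRepellingFunction.apply_iterate {n : ℕ} {x : Γ} (hx : g^[n] x ∈ g^[k] ⁻¹' R) :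
    T (g^[n] x) = T x - n := by
  induction n with
  | zero => simp
  | succ n ih =>
    have hxn : g^[n] x ∈ g^[k] ⁻¹' R := by
      rw [Function.iterate_succ_apply'] at hx
      exact hR.mem_of_iterate_mem (n := 1) hx
    rw [Function.iterate_succ_apply', h.apply_map, ih hxn, h.step_eq_one _ hxn]
    push_cast
    ring

/-- A point beyond level `k` lies over `g^[k] ⁻¹' R`, hence so does everything before it on the
flowline, and there every step of `T` is exactly one. -/
theorem IsRepellingFunction.fn_eq_add {z : MappingTorus g} {t : ℝ≥0}
    (hz : (k : ℝ) < h.fn (flow g t z)) : h.fn z = h.fn (flow g t z) + t := by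
  obtain ⟨x, s, hs, rfl⟩ := z.exists_rep
  obtain ⟨n, s', hs', hst, hfl⟩ := flow_eq_mk_iterate (g := g) x s t
  rw [hfl, h.fn_mk] at hz ⊢
  rw [h.fn_mk]
  have hmem : g^[n] x ∈ g^[k] ⁻¹' R := by
    by_contra hcon
    have h1 := h.le_of_notMem _ hcon
    -- The function interpolates between the values of `T` at `g^[n] x` and at its image, so it is
    -- bounded by one or the other according to the sign of `ψ`. Both values are at most `k` outside
    -- `g^[k] ⁻¹' R`.
    have h2 : 0 ≤ ψ (g^[n] x) ∨ ψ (g^[n] x) < 0 := le_or_gt _ _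
    rcases h2 with h2 | h2
    · nlinarith [mul_nonneg s'.2.1 h2]
    · have h3 := h.apply_map (g^[n] x)
      have h4 : T (g (g^[n] x)) ≤ k := by
        apply h.le_of_notMem
        intro hc
        exact hcon (hR.mem_of_iterate_mem (n := 1) hc)
      nlinarith [s'.2.1]
  rw [h.apply_iterate hR hmem, h.step_eq_one _ hmem,
    h.step_eq_one _ (hR.mem_of_iterate_mem hmem)]
  linarith

theorem IsRepellingFunction.sub_le_iterate (n : ℕ) (x : Γ) : T x - n ≤ T (g^[n] x) := by
  induction n with
  | zero => simp
  | succ n ih =>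
    rw [Function.iterate_succ_apply', h.apply_map]
    push_cast
    linarith [h.step_le_one (g^[n] x)]

theorem IsRepellingFunction.lt_of_lt_fn {x : Γ} {s : I} (hz : (k : ℝ) < T x - s * ψ x) :
    x ∈ g^[k] ⁻¹' R := by
  have := h.fn_eq_add hR (z := MappingTorus.mk g (x, s)) (t := 0)
  by_contra hcon
  have h1 := h.le_of_notMem _ hcon
  rcases le_or_gt 0 (ψ x) with h2 | h2
  · nlinarith [mul_nonneg s.2.1 h2]
  · have h3 := h.apply_map x
    have h4 : T (g x) ≤ k := by
      apply h.le_of_notMem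
      intro hc
      exact hcon (hR.mem_of_iterate_mem (n := 1) hc)
    nlinarith [s.2.1, s.2.2]

/-- The forward version of `fn_eq_add`: since `T` drops by at most one per step, a start above level
`k + t` is still beyond level `k` after time `t`. -/
theorem IsRepellingFunction.fn_flow {z : MappingTorus g} {t : ℝ≥0}
    (hz : (k : ℝ) < h.fn z - t) : h.fn (flow g t z) = h.fn z - t := by
  have key : (k : ℝ) < h.fn (flow g t z) := by
    obtain ⟨x, s, hs, rfl⟩ := z.exists_rep
    obtain ⟨n, s', hs', hst, hfl⟩ := flow_eq_mk_iterate (g := g) x s t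
    rw [h.fn_mk] at hz
    rw [hfl, h.fn_mk]
    have hx : x ∈ g^[k] ⁻¹' R := h.lt_of_lt_fn hR (s := s) (by linarith [t.coe_nonneg])
    rw [h.step_eq_one x hx] at hz
    have h1 := h.sub_le_iterate hR n x
    have h2 := mul_le_mul_of_nonneg_left (h.step_le_one (g^[n] x)) s'.2.1
    linarith
  have := h.fn_eq_add hR key
  linarith

theorem IsRepellingFunction.exists_lt_fn (l : NegEscaping g) (M : ℝ) :
    ∃ a : ℝ, M < h.fn (l.1 a) := by
  obtain ⟨a, x, hx, hxc, hl⟩ := l.exists_backward_orbit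
  obtain ⟨m, hm⟩ := hR.enter x hx hxc
  obtain ⟨j, hj⟩ := exists_nat_gt M
  -- Once the backward orbit is in `R`, going back `k + j` further steps puts it into `g^[k + j] ⁻¹'
  -- R`, where `T ≥ j`.
  refine ⟨a - (m + (k + j) : ℕ), ?_⟩
  rw [hl, h.fn_mk]
  have hiter : ∀ i n, g^[i] (x (n + i)) = x n := by
    intro i
    induction i with
    | zero => intro n; rfl
    | succ i ih =>
      intro n
      rw [Function.iterate_succ_apply, ← add_assoc, hx, ih]
  have := h.le_of_mem j (x (m + (k + j))) (by rw [mem_preimage, hiter]; exact hm)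
  simp only [Icc.coe_zero, zero_mul, sub_zero]
  linarith

omit h hR in
theorem NegEscaping.eq_flow (l : NegEscaping g) {a b : ℝ} (hab : a ≤ b) :
    l.1 b = flow g (b - a).toNNReal (l.1 a) := by
  rw [← l.2.1 a, Real.coe_toNNReal _ (sub_nonneg.2 hab)]
  rw [add_sub_cancel]

theorem IsRepellingFunction.fn_flowline (l : NegEscaping g) {a b : ℝ} (hab : a ≤ b)
    (hb : (k : ℝ) < h.fn (l.1 b)) : h.fn (l.1 a) = h.fn (l.1 b) + (b - a) := by
  have h1 := l.eq_flow hab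
  rw [h1] at hb
  have := h.fn_eq_add hR hb
  rw [← h1, Real.coe_toNNReal _ (sub_nonneg.2 hab)] at this
  exact this

/-- Far out in the repelling region, flow forward to the level `M` of the repelling function. -/
noncomputable def IsRepellingFunction.push (M : ℝ) (z : MappingTorus g) : MappingTorus g :=
  flow g (h.fn z - M).toNNReal z

omit hR in
theorem IsRepellingFunction.continuous_push (M : ℝ) : Continuous (h.push M) :=
  continuous_flow.comp (continuous_id.prodMk
    (continuous_real_toNNReal.comp (h.continuous_fn.sub continuous_const)))

theorem IsRepellingFunction.push_flow {M : ℝ} (hM : (k : ℝ) ≤ M) {z : MappingTorus g} {t : ℝ≥0}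
    (hz : M < h.fn (flow g t z)) : h.push M (flow g t z) = h.push M z := by
  have h1 := h.fn_eq_add hR (hM.trans_lt hz)
  unfold push
  rw [← flow_add, h1]
  congr 1
  ext
  rw [NNReal.coe_add, Real.coe_toNNReal _ (by linarith), Real.coe_toNNReal _ (by
    have := t.coe_nonneg; linarith)]
  ring

theorem IsRepellingFunction.push_flowline {M : ℝ} (hM : (k : ℝ) ≤ M) (l : NegEscaping g) {a b : ℝ}
    (ha : M < h.fn (l.1 a)) (hb : M < h.fn (l.1 b)) :
    h.push M (l.1 a) = h.push M (l.1 b) := by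
  wlog hab : a ≤ b generalizing a b
  · exact (this hb ha (le_of_not_ge hab)).symm
  rw [l.eq_flow hab] at hb ⊢
  exact (h.push_flow hR hM hb).symm

/-- The point in which a flowline meets the level `M` of the repelling function. -/
noncomputable def IsRepellingFunction.levelPoint (M : ℝ) (l : NegEscaping g) : MappingTorus g :=
  h.push M (l.1 (h.exists_lt_fn hR l M).choose)

theorem IsRepellingFunction.levelPoint_eq {M : ℝ} (hM : (k : ℝ) ≤ M) (l : NegEscaping g) {a : ℝ}
    (ha : M < h.fn (l.1 a)) : h.levelPoint hR M l = h.push M (l.1 a) :=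
  h.push_flowline hR hM l (h.exists_lt_fn hR l M).choose_spec ha

theorem IsRepellingFunction.exists_levelPoint {M : ℝ} (hM : (k : ℝ) < M) (l : NegEscaping g) :
    ∃ b, h.levelPoint hR M l = l.1 b ∧ h.fn (l.1 b) = M := by
  obtain ⟨a, ha⟩ := h.exists_lt_fn hR l M
  refine ⟨a + (h.fn (l.1 a) - M).toNNReal, ?_, ?_⟩
  · rw [h.levelPoint_eq hR hM.le l ha, l.2.1]
    rfl
  · rw [l.2.1, h.fn_flow hR, Real.coe_toNNReal _ (by linarith)]
    · ring
    · rw [Real.coe_toNNReal _ (by linarith)]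
      linarith

/-- The levels of the repelling function are permuted by the flow. -/
theorem IsRepellingFunction.flow_levelPoint {M : ℝ} (hM : (k : ℝ) < M) (t : ℝ≥0)
    (l : NegEscaping g) :
    flow g t (h.levelPoint hR (M + t) l) = h.levelPoint hR M l := by
  obtain ⟨a, ha⟩ := h.exists_lt_fn hR l (M + t)
  have ht := t.coe_nonneg
  rw [h.levelPoint_eq hR (by linarith) l ha, h.levelPoint_eq hR hM.le l (by linarith)]
  unfold push
  rw [← flow_add]
  congr 1
  ext
  rw [NNReal.coe_add, Real.coe_toNNReal _ (by linarith), Real.coe_toNNReal _ (by linarith)]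
  ring

open CompactifiedTorus

/-- The map which pushes the negative boundary of the compactified mapping torus into its
interior. -/
noncomputable def IsRepellingFunction.pushNeg {M : ℝ} (hM : (k : ℝ) ≤ M) :
    CompactifiedTorus g → CompactifiedTorus g
  | CompactifiedTorus.inner z => CompactifiedTorus.inner (h.push M z)
  | pos ξ => pos ξ
  | neg ξ => CompactifiedTorus.inner (Quotient.lift (h.levelPoint hR M) (by
      rintro l l' ⟨a, hl⟩
      obtain ⟨b, hb⟩ := h.exists_lt_fn hR l' M
      rw [h.levelPoint_eq hR hM l' hb, hl]
      exact h.levelPoint_eq hR hM l (by rwa [hl] at hb)) ξ)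

/-- At a positive ideal point, pushing only lengthens the flow time, so the same neighbourhood
works. At a negative one, `push` is constant along each flowline above level `M`, so an open
condition at one far point governs everything flowing into it. -/
theorem IsRepellingFunction.continuous_pushNeg {M : ℝ} (hM : (k : ℝ) ≤ M) :
    Continuous (h.pushNeg hR hM) := by
  refine ⟨fun V hV => ⟨hV.1.preimage (h.continuous_push M), ?_, ?_⟩⟩
  · intro z hz
    obtain ⟨N, hN, t₀, h1, h2⟩ := hV.2.1 z hz
    refine ⟨N, hN, t₀, fun w hw t ht => ?_, fun w hw => h2 w hw⟩
    change CompactifiedTorus.inner (h.push M (flow g t w)) ∈ V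
    unfold push
    rw [← flow_add]
    exact h1 w hw _ (lt_of_lt_of_le ht (le_self_add))
  · intro l hl
    obtain ⟨a₀, ha₀⟩ := h.exists_lt_fn hR l M
    filter_upwards [eventually_le_atBot a₀] with a ha
    have hla : M < h.fn (l.1 a) := by
      rw [h.fn_flowline hR l ha (hM.trans_lt ha₀)]
      linarith
    refine ⟨{z | M < h.fn z} ∩ h.push M ⁻¹' (CompactifiedTorus.inner ⁻¹' V), ?_, 0, ?_, ?_⟩
    · refine IsOpen.mem_nhds ?_ ⟨hla, ?_⟩
      · exact (isOpen_lt continuous_const h.continuous_fn).inter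
          (hV.1.preimage (h.continuous_push M))
      · rw [mem_preimage, mem_preimage, ← h.levelPoint_eq hR hM l hla]
        exact hl
    · rintro w t - ⟨hw1, hw2⟩
      rw [mem_preimage, h.push_flow hR hM hw1] at hw2
      exact hw2
    · rintro l' b ⟨hb1, hb2⟩
      rw [mem_preimage, ← h.levelPoint_eq hR hM l' hb1] at hb2
      exact hb2

end NegFlowlines

/-! ### Forward flowlines -/

section PosFlowlines

variable {Γ : Type u} [TopologicalSpace Γ] {g : C(Γ, Γ)}

variable {A : Set Γ} {S χ : Γ → ℝ} {k : ℕ}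

/-- The function on the mapping torus defined by an attracting function. -/
def IsAttractingFunction.fn (h : IsAttractingFunction g A S χ k) : MappingTorus g → ℝ :=
  torusFun S χ h.apply_map

variable (h : IsAttractingFunction g A S χ k) (hA : IsAttractingRegion g A)
include h

theorem IsAttractingFunction.fn_mk (x : Γ) (s : I) :
    h.fn (MappingTorus.mk g (x, s)) = S x + s * χ x := rfl

theorem IsAttractingFunction.continuous_fn : Continuous h.fn :=
  continuous_torusFun h.apply_map h.continuous h.continuous_step

theorem IsAttractingFunction.mem_of_lt {x : Γ} (hx : (k : ℝ) < S x) : x ∈ g^[k + 1] '' A := by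
  by_contra hxA
  exact absurd (h.le_of_notMem x hxA) (not_le.2 hx)

omit h in
include hA in
theorem IsAttractingRegion.mapsTo_iterate_image (n j : ℕ) :
    MapsTo g^[j] (g^[n] '' A) (g^[n] '' A) := by
  rintro _ ⟨a, ha, rfl⟩
  rw [← Function.iterate_add_apply, add_comm, Function.iterate_add_apply]
  exact ⟨_, hA.mapsTo.iterate j ha, rfl⟩

include hA

theorem IsAttractingFunction.apply_iterate {x : Γ} (hx : x ∈ g^[k] '' A) (n : ℕ) :
    S (g^[n] x) = S x + n := by
  induction n with
  | zero => simp
  | succ n ih =>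
    rw [Function.iterate_succ_apply', h.apply_map, ih,
      h.step_eq_one _ (hA.mapsTo_iterate_image k n hx)]
    push_cast
    ring

theorem IsAttractingFunction.fn_flow_mk {x : Γ} (hx : x ∈ g^[k] '' A) (s : I) (t : ℝ≥0) :
    h.fn (flow g t (MappingTorus.mk g (x, s))) = S x + s + t := by
  obtain ⟨n, s', -, hst, hfl⟩ := flow_eq_mk_iterate (g := g) x s t
  rw [hfl, h.fn_mk, h.step_eq_one _ (hA.mapsTo_iterate_image k n hx), h.apply_iterate hA hx]
  linarith

/-- While `S x > k`, the point `x` has a preimage that still lies in `g^[k] '' A` and on which `S`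
is smaller by one; descend until `S ≤ k`. This replaces the missing inverse of the flow. -/
theorem IsAttractingFunction.exists_iterate_eq (n : ℕ) {x : Γ} (hx : x ∈ g^[k] '' A)
    (hxn : S x ≤ k + n) : ∃ (i : ℕ) (y : Γ), y ∈ g^[k] '' A ∧ S y ≤ k ∧ g^[i] y = x := by
  induction n generalizing x with
  | zero => exact ⟨0, x, hx, by simpa using hxn, rfl⟩
  | succ n ih =>
    rcases le_or_gt (S x) k with hk | hk
    · exact ⟨0, x, hx, hk, rfl⟩
    · obtain ⟨a, ha, rfl⟩ := h.mem_of_lt hk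
      rw [Function.iterate_succ_apply'] at hxn hk hx ⊢
      have hmem : g^[k] a ∈ g^[k] '' A := ⟨a, ha, rfl⟩
      rw [h.apply_map, h.step_eq_one _ hmem] at hxn
      obtain ⟨i, y, hy, hyk, hiy⟩ := ih hmem (by push_cast at hxn; linarith)
      exact ⟨i + 1, y, hy, hyk, by rw [Function.iterate_succ_apply', hiy]⟩

theorem IsAttractingFunction.exists_iterate_eq_of_lt {x : Γ} {s : I}
    (hx : (k : ℝ) + 1 < S x + s * χ x) :
    ∃ (i : ℕ) (y : Γ), y ∈ g^[k] '' A ∧ S y ≤ k ∧ g^[i] y = x := by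
  have h1 : (s : ℝ) * χ x ≤ 1 := by nlinarith [s.2.1, s.2.2, h.step_le_one x]
  have h2 : x ∈ g^[k + 1] '' A := h.mem_of_lt (by linarith)
  obtain ⟨n, hn⟩ := exists_nat_ge (S x)
  exact h.exists_iterate_eq hA n (hA.antitone (Nat.le_succ k) h2)
    (hn.trans (le_add_of_nonneg_left (Nat.cast_nonneg k)))

theorem IsAttractingFunction.exists_flow_eq {z : MappingTorus g} (hz : (k : ℝ) + 1 < h.fn z) :
    ∃ (y : Γ) (t : ℝ≥0), y ∈ g^[k] '' A ∧ S y ≤ k ∧ z = flow g t (MappingTorus.mk g (y, 0)) := by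
  obtain ⟨x, s, hs, rfl⟩ := z.exists_rep
  obtain ⟨i, y, hy, hyk, rfl⟩ := h.exists_iterate_eq_of_lt hA hz
  refine ⟨y, i + ⟨s, s.2.1⟩, hy, hyk, ?_⟩
  rw [flow_natCast_add i ⟨s, s.2.1⟩ hs.le]
  rfl

theorem IsAttractingFunction.fn_flow {z : MappingTorus g} (hz : (k : ℝ) + 1 < h.fn z) (t : ℝ≥0) :
    h.fn (flow g t z) = h.fn z + t := by
  obtain ⟨y, r, hy, -, rfl⟩ := h.exists_flow_eq hA hz
  rw [← flow_add, h.fn_flow_mk hA hy, h.fn_flow_mk hA hy]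
  push_cast
  ring

omit h in
-- Equal heights make the two times differ by an integer `j`, and injectivity of the iterates of `g`
-- on `A` cancels the common part of the orbits.
theorem IsAttractingRegion.exists_iterate_of_flow_eq {y y' : Γ} (hy : y ∈ A) (hy' : y' ∈ A)
    {t t' : ℝ≥0} (ht : t ≤ t')
    (heq : flow g t (MappingTorus.mk g (y, 0)) = flow g t' (MappingTorus.mk g (y', 0))) :
    ∃ j : ℕ, t' = j + t ∧ y = g^[j] y' := by
  obtain ⟨n, s, hs, hst, hfl⟩ := flow_eq_mk_iterate (g := g) y 0 t
  obtain ⟨n', s', hs', hst', hfl'⟩ := flow_eq_mk_iterate (g := g) y' 0 t'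
  rw [hfl, hfl'] at heq
  obtain ⟨hg, rfl⟩ := MappingTorus.mk_eq_mk hs hs' heq
  simp only [Icc.coe_zero, zero_add] at hst hst'
  have hnn : n ≤ n' := by
    have : (t : ℝ) ≤ t' := ht
    have : (n : ℝ) ≤ n' := by linarith
    exact_mod_cast this
  obtain ⟨j, rfl⟩ := Nat.exists_eq_add_of_le hnn
  refine ⟨j, ?_, ?_⟩
  · ext
    push_cast at hst' ⊢
    linarith
  · rw [Function.iterate_add_apply] at hg
    exact hA.injOn_iterate n hy (hA.mapsTo.iterate j hy') hg

omit h hA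

open Classical in
/-- Far out in the attracting region, flow backward to the level `M` of the attracting
function. -/
noncomputable def IsAttractingFunction.push (_ : IsAttractingFunction g A S χ k) (M : ℝ)
    (z : MappingTorus g) : MappingTorus g :=
  if hz : ∃ q : Γ × ℝ≥0, q.1 ∈ g^[k] '' A ∧ S q.1 < M ∧ z = flow g q.2 (MappingTorus.mk g (q.1, 0))
  -- Starting below level `M`, the flow reaches that level after time `M - S`. The minimum stops
  -- there and leaves points that have not reached it where they are.
  then flow g (min hz.choose.2 (M - S hz.choose.1).toNNReal)
    (MappingTorus.mk g (hz.choose.1, 0))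
  else z

include h hA

/-- Independence of the base point chosen in `push`: moving it `j` steps along its orbit shifts both
terms of the minimum by `j`. -/
theorem IsAttractingFunction.flow_min_eq {M : ℝ} {y y' : Γ} {t t' : ℝ≥0} (hy : y ∈ g^[k] '' A)
    (hy' : y' ∈ g^[k] '' A) (hyM : S y < M) (hyM' : S y' < M)
    (heq : flow g t (MappingTorus.mk g (y, 0)) = flow g t' (MappingTorus.mk g (y', 0))) :
    flow g (min t (M - S y).toNNReal) (MappingTorus.mk g (y, 0)) =
      flow g (min t' (M - S y').toNNReal) (MappingTorus.mk g (y', 0)) := by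
  wlog ht : t ≤ t' generalizing y y' t t'
  · exact (this hy' hy hyM' hyM heq.symm (le_of_not_ge ht)).symm
  have hsub : g^[k] '' A ⊆ A := by simpa using hA.antitone (Nat.zero_le k)
  obtain ⟨j, rfl, rfl⟩ := hA.exists_iterate_of_flow_eq (hsub hy) (hsub hy') ht heq
  rw [h.apply_iterate hA hy'] at hyM ⊢
  rw [← flow_natCast, ← flow_add]
  congr 1
  rw [← min_add_add_left]
  congr 1
  ext
  rw [NNReal.coe_add, Real.coe_toNNReal _ (by linarith), Real.coe_toNNReal _ (by linarith)]
  rw [NNReal.coe_natCast]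
  ring

theorem IsAttractingFunction.push_flow_mk {M : ℝ} {y : Γ} (hy : y ∈ g^[k] '' A) (hyM : S y < M)
    (t : ℝ≥0) : h.push M (flow g t (MappingTorus.mk g (y, 0))) =
      flow g (min t (M - S y).toNNReal) (MappingTorus.mk g (y, 0)) := by
  have hz : ∃ q : Γ × ℝ≥0, q.1 ∈ g^[k] '' A ∧ S q.1 < M ∧
      flow g t (MappingTorus.mk g (y, 0)) = flow g q.2 (MappingTorus.mk g (q.1, 0)) :=
    ⟨(y, t), hy, hyM, rfl⟩
  unfold push
  rw [dif_pos hz]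
  obtain ⟨h1, h2, h3⟩ := hz.choose_spec
  exact h.flow_min_eq hA h1 hy h2 hyM h3.symm

theorem IsAttractingFunction.push_of_le {M : ℝ} {z : MappingTorus g} (hz : h.fn z ≤ M) :
    h.push M z = z := by
  by_cases hq : ∃ q : Γ × ℝ≥0, q.1 ∈ g^[k] '' A ∧ S q.1 < M ∧
      z = flow g q.2 (MappingTorus.mk g (q.1, 0))
  · obtain ⟨⟨y, t⟩, hy, hyM, rfl⟩ := hq
    rw [h.push_flow_mk hA hy hyM, min_eq_left]
    rw [h.fn_flow_mk hA hy] at hz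
    simp only [Icc.coe_zero, add_zero] at hz
    exact NNReal.le_toNNReal_of_coe_le (by linarith)
  · unfold push
    rw [dif_neg hq]

theorem IsAttractingFunction.push_flow {M : ℝ} (hM : (k : ℝ) + 1 < M) {z : MappingTorus g}
    (hz : M ≤ h.fn z) (t : ℝ≥0) : h.push M (flow g t z) = h.push M z := by
  obtain ⟨y, r, hy, hyk, rfl⟩ := h.exists_flow_eq hA (hM.trans_le hz)
  have hyM : S y < M := by linarith
  rw [h.fn_flow_mk hA hy] at hz
  simp only [Icc.coe_zero, add_zero] at hz
  have hr : (M - S y).toNNReal ≤ r := Real.toNNReal_le_iff_le_coe.2 (by linarith)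
  rw [← flow_add, h.push_flow_mk hA hy hyM, h.push_flow_mk hA hy hyM, min_eq_right hr,
    min_eq_right (hr.trans le_self_add)]

theorem IsAttractingFunction.flow_push {M : ℝ} (hM : (k : ℝ) + 1 < M) {z : MappingTorus g}
    (hz : M ≤ h.fn z) : ∃ t : ℝ≥0, flow g t (h.push M z) = z := by
  obtain ⟨y, r, hy, hyk, rfl⟩ := h.exists_flow_eq hA (hM.trans_le hz)
  have hyM : S y < M := by linarith
  rw [h.fn_flow_mk hA hy] at hz
  simp only [Icc.coe_zero, add_zero] at hz
  have hr : (M - S y).toNNReal ≤ r := Real.toNNReal_le_iff_le_coe.2 (by linarith)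
  refine ⟨r - (M - S y).toNNReal, ?_⟩
  rw [h.push_flow_mk hA hy hyM, min_eq_right hr, ← flow_add, add_tsub_cancel_of_le hr]

/-- Below level `M` the map is locally the identity. Elsewhere the point is over some `g^[i] y` with
`y` at a low level; `g^[i]` is open near `y`, so nearby points are over nearby `g^[i] y'` and one
continuous formula applies. -/
theorem IsAttractingFunction.continuous_push {M : ℝ} (hM : (k : ℝ) + 1 < M) :
    Continuous (h.push M) := by
  rw [MappingTorus.isQuotientMap_mk.continuous_iff, continuous_iff_continuousAt]
  rintro ⟨x, s⟩
  have hcfn := h.continuous_fn.comp MappingTorus.continuous_mk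
  rcases lt_or_ge (h.fn (MappingTorus.mk g (x, s))) M with hlt | hge
  · refine MappingTorus.continuous_mk.continuousAt.congr ?_
    filter_upwards [(isOpen_lt hcfn continuous_const).mem_nhds hlt] with a ha
    exact (h.push_of_le hA (le_of_lt ha)).symm
  · obtain ⟨i, y, hy, hyk, rfl⟩ := h.exists_iterate_eq_of_lt hA (hM.trans_le hge)
    have hform : ∀ y' ∈ g^[k] '' A, S y' < M → ∀ s' : I,
        h.push M (MappingTorus.mk g (g^[i] y', s')) =
          flow g (min (i + ⟨s', s'.2.1⟩) (M - S y').toNNReal) (MappingTorus.mk g (y', 0)) := by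
      intro y' hy' hyM' s'
      rw [← h.push_flow_mk hA hy' hyM', flow_natCast_add i ⟨s', s'.2.1⟩ s'.2.2]
      rfl
    have hAo := hA.isOpen_iterate_image k hA.isOpen subset_rfl
    rw [ContinuousAt, tendsto_def]
    intro V hV
    obtain ⟨V', hV'V, hV', hxV'⟩ := mem_nhds_iff.1 hV
    have hcont : Continuous fun q : Γ × I =>
        flow g (min (i + ⟨q.2, q.2.2.1⟩) (M - S q.1).toNNReal) (MappingTorus.mk g (q.1, 0)) := by
      refine continuous_suspension.comp (continuous_fst.prodMk ?_)
      refine (continuous_const.add ?_).min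
        (continuous_real_toNNReal.comp (continuous_const.sub (h.continuous.comp continuous_fst)))
      exact Continuous.subtype_mk (by fun_prop) _
    rw [Function.comp, hform y hy (by linarith)] at hxV'
    have hO := (hV'.preimage hcont).mem_nhds (x := (y, s)) hxV'
    rw [nhds_prod_eq] at hO ⊢
    obtain ⟨U, hU, J, hJ, hUJ⟩ := mem_prod_iff.1 hO
    have hU' : U ∩ (g^[k] '' A ∩ {y | S y < M}) ∈ 𝓝 y := inter_mem hU
      ((hAo.1.inter (isOpen_lt h.continuous continuous_const)).mem_nhds
        ⟨hy, show S y < M by linarith⟩)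
    obtain ⟨U', hU'U, hU'o, hyU'⟩ := mem_nhds_iff.1 hU'
    refine mem_prod_iff.2 ⟨g^[i] '' U', ?_, J, hJ, ?_⟩
    · exact (hA.isOpen_iterate_image i hU'o
        fun _ ha => hAo.2 (hU'U ha).2.1).1.mem_nhds ⟨y, hyU', rfl⟩
    · rintro ⟨_, s'⟩ ⟨⟨y', hy', rfl⟩, hs'⟩
      obtain ⟨hyU, hyA, hyM⟩ := hU'U hy'
      have h1 := hUJ (mk_mem_prod hyU hs')
      rw [mem_preimage, ← hform y' hyA hyM s'] at h1
      exact hV'V h1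

theorem IsAttractingFunction.exists_lt_fn (z : PosEscaping g) (M : ℝ) :
    ∃ t : ℝ≥0, M < h.fn (flow g t z.1) := by
  obtain ⟨z, hz⟩ := z
  obtain ⟨x, s, hs, rfl⟩ := z.exists_rep
  obtain ⟨n, hn⟩ := hA.enter _ (tendsto_orbit_of_tendsto_flow hz)
  obtain ⟨t, ht⟩ := exists_nat_gt M
  have hmem : g^[k + n] x ∈ g^[k] '' A := by
    rw [Function.iterate_add_apply]
    exact ⟨_, hn, rfl⟩
  refine ⟨((k + n : ℕ) : ℝ≥0) + t, ?_⟩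
  change M < h.fn (flow g _ (MappingTorus.mk g (x, s)))
  rw [flow_add, flow_natCast, h.fn_flow_mk hA hmem]
  have h1 := h.nonneg (g^[k + n] x)
  have h2 := s.2.1
  simp only [NNReal.coe_natCast]
  linarith

/-- The attracting function is bounded on compact sets but eventually grows at unit speed along the
flowline. -/
theorem IsAttractingFunction.posEscaping {x : Γ} (hx : x ∈ A) (s : I) :
    Tendsto (fun t : ℝ≥0 => flow g t (MappingTorus.mk g (x, s))) atTop
      (cocompact (MappingTorus g)) := by
  rw [hasBasis_cocompact.tendsto_right_iff]
  intro K hK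
  obtain ⟨B, hB⟩ := (hK.image h.continuous_fn).bddAbove
  filter_upwards [eventually_ge_atTop ((k : ℝ≥0) + B.toNNReal + 1)] with t ht hmem
  obtain ⟨r, rfl⟩ := exists_add_of_le ht
  have h1 := hB ⟨_, hmem, rfl⟩
  rw [add_assoc, add_assoc, flow_add, flow_natCast, h.fn_flow_mk hA ⟨x, hx, rfl⟩] at h1
  have h2 := h.nonneg (g^[k] x)
  have h3 := s.2.1
  have h4 := Real.le_coe_toNNReal B
  have h5 := r.coe_nonneg
  push_cast at h1
  linarith

theorem IsAttractingFunction.push_flow_eq {M : ℝ} (hM : (k : ℝ) + 1 < M) {z : MappingTorus g}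
    {s t : ℝ≥0} (hs : M ≤ h.fn (flow g s z)) (ht : M ≤ h.fn (flow g t z)) :
    h.push M (flow g s z) = h.push M (flow g t z) := by
  wlog hst : s ≤ t generalizing s t
  · exact (this ht hs (le_of_not_ge hst)).symm
  obtain ⟨r, rfl⟩ := exists_add_of_le hst
  rw [flow_add, h.push_flow hA hM hs]

/-- The point in which an escaping forward flowline meets the level `M` of the attracting
function. -/
noncomputable def IsAttractingFunction.levelPoint (M : ℝ) (z : PosEscaping g) : MappingTorus g :=
  h.push M (flow g (h.exists_lt_fn hA z M).choose z.1)

theorem IsAttractingFunction.levelPoint_eq {M : ℝ} (hM : (k : ℝ) + 1 < M) (z : PosEscaping g)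
    {t : ℝ≥0} (ht : M ≤ h.fn (flow g t z.1)) :
    h.levelPoint hA M z = h.push M (flow g t z.1) :=
  h.push_flow_eq hA hM (h.exists_lt_fn hA z M).choose_spec.le ht

theorem IsAttractingFunction.levelPoint_congr {M : ℝ} (hM : (k : ℝ) + 1 < M)
    {z w : PosEscaping g} {s t : ℝ≥0} (heq : flow g s z.1 = flow g t w.1) :
    h.levelPoint hA M z = h.levelPoint hA M w := by
  obtain ⟨r, hr⟩ := h.exists_lt_fn hA z M
  have h1 : M ≤ h.fn (flow g (r + s) z.1) := by
    rw [flow_add, h.fn_flow hA (hM.trans hr)]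
    exact hr.le.trans (le_add_of_nonneg_right s.coe_nonneg)
  have h2 : flow g (r + s) z.1 = flow g (t + r) w.1 := by
    rw [add_comm, flow_add, heq, flow_add]
  rw [h.levelPoint_eq hA hM z h1, h2, h.levelPoint_eq hA hM w (t := t + r) (h2 ▸ h1)]

/-- The level point of a flowline lies on this flowline. -/
theorem IsAttractingFunction.exists_flow_levelPoint {M : ℝ} (hM : (k : ℝ) + 1 < M)
    (z : PosEscaping g) : ∃ s t : ℝ≥0, flow g s (h.levelPoint hA M z) = flow g t z.1 := by
  obtain ⟨t, ht⟩ := h.exists_lt_fn hA z M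
  obtain ⟨s, hs⟩ := h.flow_push hA hM ht.le
  exact ⟨s, t, by rw [h.levelPoint_eq hA hM z ht.le, hs]⟩

open CompactifiedTorus

/-- The map which pushes the positive boundary of the compactified mapping torus into its
interior. -/
noncomputable def IsAttractingFunction.pushPos {M : ℝ} (hM : (k : ℝ) + 1 < M) :
    CompactifiedTorus g → CompactifiedTorus g
  | CompactifiedTorus.inner z => CompactifiedTorus.inner (h.push M z)
  | pos ξ => CompactifiedTorus.inner (Quotient.lift (h.levelPoint hA M) (by
      rintro _ _ ⟨_, _, heq⟩
      exact h.levelPoint_congr hA hM heq) ξ)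
  | neg ξ => neg ξ

theorem IsAttractingFunction.pushPos_posLimit {M : ℝ} (hM : (k : ℝ) + 1 < M) (z : PosEscaping g) :
    h.pushPos hA hM (posLimit z) = CompactifiedTorus.inner (h.levelPoint hA M z) := rfl

/-- At a positive ideal point, `push` no longer changes once the flowline has passed level `M`. A
sufficiently small neighbourhood of a negative ideal point consists, in `Z_g`, of points at or below
level `M`, which `push` fixes. -/
theorem IsAttractingFunction.continuous_pushPos {M : ℝ} (hM : (k : ℝ) + 1 < M) :
    Continuous (h.pushPos hA hM) := by
  have hpc := h.continuous_push hA hM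
  refine ⟨fun V hV => ⟨hV.1.preimage hpc, ?_, ?_⟩⟩
  · intro z hz
    obtain ⟨t, ht⟩ := h.exists_lt_fn hA z M
    rw [mem_preimage, h.pushPos_posLimit, h.levelPoint_eq hA hM z ht.le] at hz
    have hfc : Continuous fun w : MappingTorus g => flow g t w :=
      continuous_flow.comp (continuous_id.prodMk continuous_const)
    refine ⟨(fun w => flow g t w) ⁻¹' ({w | M < h.fn w} ∩
      h.push M ⁻¹' (CompactifiedTorus.inner ⁻¹' V)), ?_, t, ?_, ?_⟩
    · exact (((isOpen_lt continuous_const h.continuous_fn).inter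
        (hV.1.preimage hpc)).preimage hfc).mem_nhds ⟨ht, hz⟩
    · rintro w ⟨hw1, hw2⟩ r hr
      obtain ⟨r, rfl⟩ := exists_add_of_le hr.le
      change CompactifiedTorus.inner (h.push M (flow g (t + r) w)) ∈ V
      rw [flow_add, h.push_flow hA hM (le_of_lt hw1)]
      exact hw2
    · rintro w ⟨hw1, hw2⟩
      rw [mem_preimage, h.pushPos_posLimit, h.levelPoint_eq hA hM w (le_of_lt hw1)]
      exact hw2
  · intro l hl
    filter_upwards [hV.2.2 l hl] with a ha
    obtain ⟨N, hN, T, h1, h2⟩ := ha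
    set B := h.fn (l.1 a) + 1 with hB
    refine ⟨N ∩ {w | h.fn w < B}, inter_mem hN
      ((isOpen_lt h.continuous_fn continuous_const).mem_nhds (by simp [hB])),
      max T B.toNNReal, ?_, fun l' b hb => h2 l' b hb.1⟩
    rintro w t ht ⟨hw1, hw2⟩
    -- Above level `M` the function would gain `t > B` before reaching the neighbourhood of `l.1 a`,
    -- on which it is less than `B`.
    have hw : h.fn w ≤ M := by
      by_contra hcon
      rw [not_le] at hcon
      rw [mem_ofPred_eq, h.fn_flow hA (hM.trans hcon)] at hw2
      have h3 : (B.toNNReal : ℝ) < t := (le_max_right _ _).trans_lt ht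
      have h4 := Real.le_coe_toNNReal B
      have h5 : (0 : ℝ) ≤ k := Nat.cast_nonneg k
      linarith
    change CompactifiedTorus.inner (h.push M w) ∈ V
    rw [h.push_of_le hA hw]
    exact h1 w t ((le_max_left _ _).trans_lt ht) hw1

end PosFlowlines

/-! ### Null homotopies -/

section NullHomotopies

variable {X Y : Type*} [TopologicalSpace X] [TopologicalSpace Y]

theorem homotopic_refl_iff {x : X} (p : Path x x) : p.Homotopic (Path.refl x) ↔
    ∃ H : C(I × I, X), (∀ t, H (0, t) = p t) ∧ ∀ z ∈ squareSides, H z = x := by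
  constructor
  · rintro ⟨F⟩
    refine ⟨F.toContinuousMap, fun t => F.apply_zero t, ?_⟩
    rintro ⟨a, b⟩ (h | h | h)
    · obtain rfl : a = 1 := h
      exact F.apply_one b
    · obtain rfl : b = 0 := h
      exact F.source a
    · obtain rfl : b = 1 := h
      exact F.target a
  · rintro ⟨H, h0, h1⟩
    exact ⟨{ toFun := H
             map_zero_left := h0
             map_one_left := fun t => h1 _ (Or.inl rfl)
             prop' := fun s t ht => by
               rcases ht with rfl | rfl
               · exact (h1 _ (Or.inr (Or.inl rfl))).trans p.source.symm
               · exact (h1 _ (Or.inr (Or.inr rfl))).trans p.target.symm }⟩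

theorem piOneInjective_iff (f : C(X, Y)) : PiOneInjective f ↔
    ∀ (x : X) (p : Path x x), (p.map f.continuous).Homotopic (Path.refl (f x)) →
      p.Homotopic (Path.refl x) := by
  refine forall_congr' fun x => ?_
  rw [injective_iff_map_eq_one]
  constructor
  · intro h p hp
    exact Path.Homotopic.Quotient.exact (h (FundamentalGroup.fromPath (.mk p))
      (Path.Homotopic.Quotient.eq.2 hp))
  · intro h a
    induction a using Path.Homotopic.Quotient.ind with
    | mk p =>
      intro hp
      exact Path.Homotopic.Quotient.eq.2 (h p (Path.Homotopic.Quotient.exact hp))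

/-- If a `π₁`-injective self map sends a closed path to a null homotopic one after finitely many
iterations, the path is null homotopic. -/
theorem PiOneInjective.homotopic_refl_of_iterate {f : C(X, X)} (hf : PiOneInjective f) (n : ℕ)
    {x : X} (p : Path x x)
    (hp : (p.map (f.continuous.iterate n)).Homotopic (Path.refl (f^[n] x))) :
    p.Homotopic (Path.refl x) := by
  induction n generalizing x with
  | zero => exact hp
  | succ n ih => exact (piOneInjective_iff f).1 hf x p (ih (p.map f.continuous) hp)

theorem homotopic_refl_in_component {B : Set X} {ξ : X} {x : connectedComponentIn B ξ}
    (p : Path x x) (H : C(I × I, X)) (hB : ∀ z, H z ∈ B) (h0 : ∀ t, H (0, t) = p t)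
    (h1 : ∀ z ∈ squareSides, H z = x) : p.Homotopic (Path.refl x) := by
  have hmem : ∀ z, H z ∈ connectedComponentIn B ξ := by
    intro z
    rw [connectedComponentIn_eq x.2]
    refine (isPreconnected_range H.continuous).subset_connectedComponentIn
      ⟨(1, 0), h1 _ (Or.inl rfl)⟩ (range_subset_iff.2 hB) (mem_range_self z)
  refine (homotopic_refl_iff p).2 ⟨⟨fun z => ⟨H z, hmem z⟩, by fun_prop⟩, ?_, ?_⟩
  · exact fun t => Subtype.ext (h0 t)
  · exact fun z hz => Subtype.ext (h1 z hz)

end NullHomotopies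

/-! ### Maps into the mapping torus -/

section MapsIntoTorus

variable {Γ : Type u} [TopologicalSpace Γ] {g : C(Γ, Γ)} {X : Type*} [TopologicalSpace X]

theorem isOpenEmbedding_inner :
    IsOpenEmbedding (CompactifiedTorus.inner : MappingTorus g → CompactifiedTorus g) := by
  refine .of_continuous_injective_isOpenMap ⟨fun V hV => hV.1⟩
    (fun z w h => CompactifiedTorus.inner.inj h) fun O hO => ⟨?_, ?_, ?_⟩
  · rwa [preimage_image_eq _ fun z w h => CompactifiedTorus.inner.inj h]
  · rintro z ⟨w, -, hw⟩
    cases hw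
  · rintro l ⟨w, -, hw⟩
    cases hw

theorem exists_lift_inner (f : C(X, CompactifiedTorus g))
    (hf : ∀ x, ∃ z, f x = CompactifiedTorus.inner z) :
    ∃ f' : C(X, MappingTorus g), ∀ x, f x = CompactifiedTorus.inner (f' x) := by
  choose f' hf' using hf
  refine ⟨⟨f', ?_⟩, hf'⟩
  rw [isOpenEmbedding_inner.isInducing.continuous_iff]
  exact f.continuous.congr hf'

/-- After time `m - h x` the height is the integer `m`, which is level zero; `G` is continuous
because `Γ` is embedded in `Z_g` as this level. -/
theorem exists_level_zero (f : C(X, MappingTorus g)) (h : C(X, ℝ))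
    (hh : ∀ x, (h x : AddCircle (1 : ℝ)) = torusHeight (f x)) {m : ℕ} (hm : ∀ x, h x ≤ m) :
    ∃ G : C(X, Γ), ∀ x, MappingTorus.mk g (G x, 0) = flow g ((m : ℝ) - h x).toNNReal (f x) := by
  have key : ∀ x, ∃ y, flow g ((m : ℝ) - h x).toNNReal (f x) = MappingTorus.mk g (y, 0) := by
    intro x
    apply exists_mk_zero_of_torusHeight
    rw [torusHeight_flow, Real.coe_toNNReal _ (sub_nonneg.2 (hm x)), ← hh, ← AddCircle.coe_add,
      add_sub_cancel, AddCircle.coe_eq_zero_iff]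
    exact ⟨m, by simp⟩
  choose G hG using key
  refine ⟨⟨G, continuous_of_mk_zero (g := g) ?_⟩, fun x => (hG x).symm⟩
  refine (continuous_flow.comp (f.continuous.prodMk (continuous_real_toNNReal.comp
    (continuous_const.sub h.continuous)))).congr hG

/-- The integer `m` is a common height above the whole square, and `d` bounds the time needed to
flow up to it. -/
theorem exists_square_height (H : C(I × I, MappingTorus g)) {q : MappingTorus g}
    (hq : ∀ z ∈ squareSides, H z = q) :
    ∃ (h : C(I × I, ℝ)) (r : ℝ) (m d : ℕ), (∀ z, (h z : AddCircle (1 : ℝ)) = torusHeight (H z)) ∧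
      (∀ z ∈ squareSides, h z = r) ∧ (∀ z, h z ≤ m) ∧ ∀ z, m - h z ≤ d := by
  obtain ⟨r, hr⟩ := QuotientAddGroup.mk_surjective (torusHeight q)
  have h1 : ((1 : I), (0 : I)) ∈ squareSides := Or.inl rfl
  obtain ⟨h, h0, hh⟩ := exists_lift_square ⟨fun z => torusHeight (H z),
    continuous_torusHeight.comp H.continuous⟩ (1, 0) r (by
      rw [ContinuousMap.coe_mk, hq _ h1]; exact hr)
  obtain ⟨b, hb⟩ := (isCompact_range h.continuous).bddAbove
  obtain ⟨a, ha⟩ := (isCompact_range h.continuous).bddBelow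
  obtain ⟨m, hm⟩ := exists_nat_ge b
  obtain ⟨d, hd⟩ := exists_nat_ge (m - a)
  refine ⟨h, r, m, d, hh, ?_, fun z => (hb (mem_range_self z)).trans hm, fun z => ?_⟩
  · exact lift_eq_of_isPreconnected h.continuous isPreconnected_squareSides
      (fun z hz => by rw [hh, ContinuousMap.coe_mk, hq z hz]; exact hr.symm) h1 h0
  · linarith [ha (mem_range_self z)]

end MapsIntoTorus

/-! ### Cells far out -/

section DeepCells

variable {Γ : Type u} [TopologicalSpace Γ] [T2Space Γ] [CWComplex (univ : Set Γ)]

/-- Finitely many cells meet the compact frontier of `B`, and a deep point lies in none of them. A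
connected cell that meets `B` but not its frontier is contained in `B`. -/
theorem IsGraph.exists_cellC_subset (hΓ : IsGraph Γ) {B : Set Γ} (hB : IsOpen B)
    (hfr : IsCompact (frontier B)) {D : ℕ → Set Γ} (hDB : ∀ n, D n ⊆ B)
    (hesc : ∀ K, IsCompact K → ∃ n, Disjoint (D n) K) :
    ∃ n, ∀ x ∈ D n, ∀ c : AnyCell Γ, x ∈ cellC c → cellC c ⊆ B := by
  obtain ⟨n, hn⟩ := hesc (⋃ c ∈ {c : AnyCell Γ | (cellC c ∩ frontier B).Nonempty}, cellC c)
    (Finite.isCompact_biUnion (hΓ.finite_cellC_inter hfr) fun c _ => isCompact_cellC c)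
  refine ⟨n, fun x hx c hc => ?_⟩
  have hdisj : Disjoint (cellC c) (frontier B) := by
    rw [Set.disjoint_iff_inter_eq_empty, ← not_nonempty_iff_eq_empty]
    intro hne
    exact Set.disjoint_left.1 hn hx (mem_biUnion (show c ∈ {c : AnyCell Γ |
      (cellC c ∩ frontier B).Nonempty} from hne) hc)
  refine (isPreconnected_cellC c).subset_left_of_subset_union hB
    (isClosed_closure (s := B)).isOpen_compl (disjoint_compl_right_iff_subset.2 subset_closure)
    (fun y hy => ?_) ⟨x, hc, hDB n hx⟩
  by_contra hcon
  rw [mem_union, not_or, notMem_compl_iff] at hcon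
  exact Set.disjoint_left.1 hdisj hy ⟨hcon.2, fun h => hcon.1 (interior_subset h)⟩

end DeepCells

/-! ### Pushing the boundary into the mapping torus -/

section Push

variable {Γ : Type u} [TopologicalSpace Γ] {g : C(Γ, Γ)}
variable {A R : Set Γ} {S χ T ψ : Γ → ℝ} {k k' : ℕ}
variable (h : IsAttractingFunction g A S χ k) (hA : IsAttractingRegion g A)
variable (h' : IsRepellingFunction g R T ψ k') (hR : IsRepellingRegion g R)

open CompactifiedTorus

theorem exists_pushed {X : Type*} [TopologicalSpace X] {M M' : ℝ} (hM : (k : ℝ) + 1 < M)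
    (hM' : (k' : ℝ) ≤ M') (H : C(X, CompactifiedTorus g)) :
    ∃ H' : C(X, MappingTorus g), ∀ x,
      h'.pushNeg hR hM' (h.pushPos hA hM (H x)) = CompactifiedTorus.inner (H' x) := by
  refine exists_lift_inner ⟨fun x => h'.pushNeg hR hM' (h.pushPos hA hM (H x)),
    (h'.continuous_pushNeg hR hM').comp ((h.continuous_pushPos hA hM).comp H.continuous)⟩
    fun x => ?_
  rcases hx : H x with z | ξ | ξ
  · exact ⟨_, by simp only [ContinuousMap.coe_mk, hx]; rfl⟩
  · exact ⟨_, by simp only [ContinuousMap.coe_mk, hx]; rfl⟩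
  · exact ⟨_, by simp only [ContinuousMap.coe_mk, hx]; rfl⟩

include h hA in
-- Far along an escaping flowline the attracting function exceeds `k + 1`, and such points lie over
-- forward iterates of points of `A`.
theorem IsAttractingFunction.exists_iterate_mem {z : PosEscaping g} {x : Γ} {s t : ℝ≥0}
    (heq : flow g s (MappingTorus.mk g (x, 0)) = flow g t z.1) : ∃ n, g^[n] x ∈ A := by
  obtain ⟨r, hr⟩ := h.exists_lt_fn hA z (k + 1)
  have h1 := h.fn_flow hA hr t
  rw [← flow_add, add_comm r t, flow_add, ← heq, ← flow_add] at h1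
  obtain ⟨n, s', -, -, hfl⟩ := flow_eq_mk_iterate (g := g) x 0 (s + r)
  rw [hfl] at h1
  have h2 : (k : ℝ) + 1 < S (g^[n] x) + s' * χ (g^[n] x) := by
    rw [← h.fn_mk, h1]
    exact hr.trans_le (le_add_of_nonneg_right t.coe_nonneg)
  obtain ⟨i, y, hy, -, hiy⟩ := h.exists_iterate_eq_of_lt hA h2
  refine ⟨n, ?_⟩
  rw [← hiy]
  have hsub : g^[k] '' A ⊆ A := by simpa using hA.antitone (Nat.zero_le k)
  exact hA.mapsTo.iterate i (hsub hy)

/-- The ideal point in which the flowline starting in a point of the attracting region ends. -/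
def IsAttractingFunction.limitPoint (x : A) : CompactifiedTorus g :=
  posLimit ⟨MappingTorus.mk g (x, 0), h.posEscaping hA x.2 0⟩

theorem IsAttractingFunction.continuous_limitPoint : Continuous (h.limitPoint hA) := by
  rw [continuous_iff_continuousAt]
  intro x
  rw [ContinuousAt, tendsto_def]
  intro V hV
  obtain ⟨V', hVV, hV', hx⟩ := mem_nhds_iff.1 hV
  obtain ⟨N, hN, -, -, h2⟩ := hV'.2.1 _ hx
  have hc : Continuous fun x : A => MappingTorus.mk g (x, 0) :=
    MappingTorus.continuous_mk.comp (by fun_prop)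
  filter_upwards [hc.continuousAt.preimage_mem_nhds hN] with y hy
  exact hVV (h2 _ hy)

end Push

/-! ### Null homotopies of loops in the positive boundary -/

section PosBoundary

variable {Γ : Type u} [TopologicalSpace Γ] [T2Space Γ] [CWComplex (univ : Set Γ)] {g : C(Γ, Γ)}
variable {A R : Set Γ} {S χ T ψ : Γ → ℝ} {k k' : ℕ}

open CompactifiedTorus

set_option maxHeartbeats 400000 in
theorem IsGraph.exists_square_posBoundary (hΓ : IsGraph Γ) (hA : IsAttractingRegion g A)
    (h : IsAttractingFunction g A S χ k) (hR : IsRepellingRegion g R)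
    (h' : IsRepellingFunction g R T ψ k') (H : C(I × I, CompactifiedTorus g))
    {w : CompactifiedTorus g} (hpos : ∀ t, H (0, t) ∈ posBoundary g)
    (hw : ∀ z ∈ squareSides, H z = w) :
    ∃ H' : C(I × I, CompactifiedTorus g), (∀ t, H' (0, t) = H (0, t)) ∧
      (∀ z ∈ squareSides, H' z = w) ∧ ∀ z, H' z ∈ posBoundary g := by
  have hM : (k : ℝ) + 1 < k + 2 := by linarith
  obtain ⟨H₁, hH₁⟩ := exists_pushed h hA h' hR hM (le_refl (k' : ℝ)) H
  have hs0 : ((0 : I), (0 : I)) ∈ squareSides := Or.inr (Or.inl rfl)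
  have hH₁c : ∀ z ∈ squareSides, H₁ z = H₁ (0, 0) := fun z hz =>
    CompactifiedTorus.inner.inj (by rw [← hH₁, ← hH₁, hw z hz, hw _ hs0])
  obtain ⟨η, r, m, -, hη, hηr, hηm, -⟩ := exists_square_height H₁ hH₁c
  obtain ⟨G, hG⟩ := exists_level_zero H₁ η hη hηm
  have hGc : ∀ z ∈ squareSides, G z = G (0, 0) := fun z hz =>
    MappingTorus.mk_zero_injective (g := g) (by
      rw [hG, hG, hH₁c z hz, hηr z hz, hηr _ hs0])
  -- Both pushes and the flow up to the integer height move points along flowlines, so the flowline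
  -- of `(G (0, t), 0)` merges with the one ending in `H (0, t)`.
  have hmeet : ∀ t : I, ∃ z : PosEscaping g, H (0, t) = posLimit z ∧ ∃ a b : ℝ≥0,
      flow g a (MappingTorus.mk g (G (0, t), 0)) = flow g b z.1 := by
    intro t
    obtain ⟨ξ, hξ⟩ := hpos t
    obtain ⟨z, rfl⟩ := Quotient.exists_rep ξ
    refine ⟨z, hξ.symm, ?_⟩
    have h1 := hH₁ (0, t)
    rw [← hξ] at h1
    have h2 : h'.push k' (h.levelPoint hA (k + 2) z) = H₁ (0, t) := CompactifiedTorus.inner.inj h1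
    obtain ⟨a, b, hab⟩ := h.exists_flow_levelPoint hA hM z
    rw [hG, ← h2]
    unfold IsRepellingFunction.push
    generalize ((m : ℝ) - η (0, t)).toNNReal = p
    generalize (h'.fn (h.levelPoint hA (k + 2) z) - k').toNNReal = q
    refine ⟨a, b + (q + p), ?_⟩
    rw [← flow_add, ← flow_add, show q + (p + a) = a + (q + p) by ring, flow_add, hab, ← flow_add]
  obtain ⟨j, hj⟩ := hΓ.exists_cellC_subset hA.isOpen hA.isCompact_frontier
    (D := fun n => g^[n] '' A) (fun n => by simpa using hA.antitone (Nat.zero_le n)) hA.escape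
  -- Each orbit enters `A` and stays there; compactness of the interval gives one `n` for all `t`.
  -- The further `j` iterates reach cells contained in `A`.
  obtain ⟨n, hn⟩ : ∃ n, ∀ t : I, g^[n] (G (0, t)) ∈ A := by
    have hcov : (univ : Set I) ⊆ ⋃ n, {t | g^[n] (G (0, t)) ∈ A} := by
      intro t _
      obtain ⟨z, -, a, b, hab⟩ := hmeet t
      obtain ⟨n, hn⟩ := h.exists_iterate_mem hA hab
      exact mem_iUnion.2 ⟨n, hn⟩
    have hmono : Monotone fun n => {t : I | g^[n] (G (0, t)) ∈ A} := by
      refine monotone_nat_of_le_succ fun n t ht => ?_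
      rw [mem_ofPred_eq, Function.iterate_succ_apply']
      exact hA.mapsTo ht
    obtain ⟨n, hn⟩ := isCompact_univ.elim_directed_cover _
      (fun n => hA.isOpen.preimage ((g.continuous.iterate n).comp
        (G.continuous.comp (by fun_prop)))) hcov hmono.directed_le
    exact ⟨n, fun t => hn (mem_univ t)⟩
  let G₁ : C(I × I, Γ) := ⟨fun z => g^[j + n] (G z), (g.continuous.iterate _).comp G.continuous⟩
  have hG₁ : ∀ t : I, G₁ (0, t) ∈ ⋃ c ∈ {c : AnyCell Γ | cellC c ⊆ A}, cellC c := by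
    intro t
    obtain ⟨c, hc⟩ := exists_mem_cellO (G₁ (0, t))
    have hmem : G₁ (0, t) ∈ g^[j] '' A :=
      ⟨_, hn t, (Function.iterate_add_apply (⇑g) j n (G (0, t))).symm⟩
    exact mem_biUnion (show c ∈ {c : AnyCell Γ | cellC c ⊆ A} from
      hj _ hmem c (cellO_subset_cellC c hc)) (cellO_subset_cellC c hc)
  have hG₁c : ∀ z ∈ squareSides, G₁ z = G₁ (0, 0) := fun z hz =>
    congrArg g^[j + n] (hGc z hz)
  obtain ⟨G₂, hG₂, hG₂S⟩ := hΓ.exists_square_in_subgraph (hΓ.isSubgraph_biUnion _) G₁ (by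
    rintro ⟨a, b⟩ (hz | hz)
    · obtain rfl : a = 0 := hz
      exact hG₁ b
    · rw [hG₁c _ hz]
      exact hG₁ 0)
  have hG₂A : ∀ z, G₂ z ∈ A := fun z => by
    obtain ⟨c, hc, hz⟩ := mem_iUnion₂.1 (hG₂S z)
    exact hc hz
  let H₂ : C(I × I, CompactifiedTorus g) := ⟨fun z => h.limitPoint hA ⟨G₂ z, hG₂A z⟩,
    (h.continuous_limitPoint hA).comp (G₂.continuous.subtype_mk _)⟩
  have hH₂ : ∀ t, H₂ (0, t) = H (0, t) := by
    intro t
    obtain ⟨z, hz, a, b, hab⟩ := hmeet t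
    rw [hz]
    change pos _ = pos _
    congr 1
    refine Quotient.sound ⟨a, b + (j + n : ℕ), ?_⟩
    change flow g a (MappingTorus.mk g (G₂ (0, t), 0)) = _
    rw [hG₂ _ (Or.inl rfl), flow_add, ← hab, ← flow_add, add_comm, flow_add, flow_natCast]
    rfl
  refine ⟨H₂, hH₂, fun z hz => ?_, fun z => ⟨_, rfl⟩⟩
  rw [← hw _ hs0, ← hH₂ 0]
  change h.limitPoint hA _ = h.limitPoint hA _
  congr 2
  rw [hG₂ _ (Or.inr hz), hG₂ _ (Or.inl rfl), hG₁c z hz]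

end PosBoundary

/-! ### Flowlines emanating from negative ideal points -/

section BackwardOrbits

variable {Γ : Type u} {g : Γ → Γ}

theorem iterate_backward {y : ℕ → Γ} (hy : ∀ n, g (y (n + 1)) = y n) (i n : ℕ) :
    g^[i] (y (n + i)) = y n := by
  induction i generalizing n with
  | zero => rfl
  | succ i ih => rw [Function.iterate_succ_apply, ← add_assoc, hy, ih]

/-- The complete flowline through the points `(y n, 0)`, where `y` is a backward orbit. -/
noncomputable def backwardFlowline (g : Γ → Γ) (y : ℕ → Γ) (a : ℝ) : MappingTorus g :=
  -- The number `⌈-a⌉₊` is the least `n` with `a + n ≥ 0`; `backwardFlowline_eq` shows that any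
  -- larger `n` gives the same point.
  flow g (a + ⌈-a⌉₊).toNNReal (MappingTorus.mk g (y ⌈-a⌉₊, 0))

theorem backwardFlowline_eq {y : ℕ → Γ} (hy : ∀ n, g (y (n + 1)) = y n) {a : ℝ} {n : ℕ}
    (hn : 0 ≤ a + n) :
    backwardFlowline g y a = flow g (a + n).toNNReal (MappingTorus.mk g (y n, 0)) := by
  have key : ∀ m i : ℕ, 0 ≤ a + m → flow g (a + (m + i : ℕ)).toNNReal
      (MappingTorus.mk g (y (m + i), 0)) =
        flow g (a + m).toNNReal (MappingTorus.mk g (y m, 0)) := by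
    intro m i hm
    have h1 : (a + (m + i : ℕ)).toNNReal = i + (a + m).toNNReal := by
      rw [← Real.toNNReal_natCast, ← Real.toNNReal_add (Nat.cast_nonneg i) hm]
      congr 1
      push_cast
      ring
    rw [h1, flow_add, flow_natCast, iterate_backward hy]
  have hc : 0 ≤ a + ⌈-a⌉₊ := by linarith [Nat.le_ceil (-a)]
  have hle : ⌈-a⌉₊ ≤ n := Nat.ceil_le.2 (by linarith)
  obtain ⟨i, rfl⟩ := Nat.exists_eq_add_of_le hle
  exact (key _ i hc).symm

theorem backwardFlowline_neg {y : ℕ → Γ} (hy : ∀ n, g (y (n + 1)) = y n) (n : ℕ) :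
    backwardFlowline g y (-n) = MappingTorus.mk g (y n, 0) := by
  rw [backwardFlowline_eq hy (n := n) (by simp)]
  simp [flow_zero]

theorem backwardFlowline_add {y : ℕ → Γ} (hy : ∀ n, g (y (n + 1)) = y n) (a : ℝ) (s : ℝ≥0) :
    backwardFlowline g y (a + s) = flow g s (backwardFlowline g y a) := by
  have hc : 0 ≤ a + ⌈-a⌉₊ := by linarith [Nat.le_ceil (-a)]
  have hs := s.coe_nonneg
  rw [backwardFlowline_eq hy hc, backwardFlowline_eq hy (n := ⌈-a⌉₊) (by linarith), ← flow_add]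
  congr 1
  ext
  rw [NNReal.coe_add, Real.coe_toNNReal _ hc, Real.coe_toNNReal _ (by linarith)]
  ring

end BackwardOrbits

/-! ### From points with backward orbits to negative ideal points -/

section SourcePoints

variable {Γ : Type u} [TopologicalSpace Γ] {g : C(Γ, Γ)}
variable {R : Set Γ} {T ψ : Γ → ℝ} {k : ℕ}

theorem IsRepellingRegion.inducing_iterate (hR : IsRepellingRegion g R) (n : ℕ) {O : Set Γ}
    (hO : IsOpen O) : ∃ V, IsOpen V ∧ ∀ y ∈ g^[n] ⁻¹' R, g^[n] y ∈ V ↔ y ∈ O := by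
  induction n generalizing O with
  | zero => exact ⟨O, hO, fun y _ => Iff.rfl⟩
  | succ n ih =>
    obtain ⟨V₁, hV₁, h1⟩ := hR.inducing O hO
    obtain ⟨V, hV, h2⟩ := ih hV₁
    refine ⟨V, hV, fun y hy => ?_⟩
    rw [Function.iterate_succ_apply, h2 (g y) hy]
    exact h1 y (hR.antitone (Nat.zero_le (n + 1)) hy)

theorem IsRepellingRegion.eq_of_iterate_eq (hR : IsRepellingRegion g R) {n : ℕ} {x y : Γ}
    (hx : g^[n] x ∈ R) (heq : g^[n] x = g^[n] y) : x = y := by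
  induction n with
  | zero => exact heq
  | succ n ih =>
    have hy : g^[n + 1] y ∈ R := heq ▸ hx
    rw [Function.iterate_succ_apply'] at hx hy heq
    rw [Function.iterate_succ_apply'] at heq
    exact ih (hR.preimage hx) (hR.injOn (hR.preimage hx) (hR.preimage hy) heq)

variable (h : IsRepellingFunction g R T ψ k) (hR : IsRepellingRegion g R)
include h hR

theorem IsRepellingFunction.flow_injective {z z' : MappingTorus g} {t : ℝ≥0}
    (hz : (k : ℝ) < h.fn (flow g t z)) (heq : flow g t z = flow g t z') : z = z' := by
  obtain ⟨x, s, hs, rfl⟩ := z.exists_rep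
  obtain ⟨x', s', hs', rfl⟩ := z'.exists_rep
  obtain ⟨n, τ, hτ, hst, hfl⟩ := flow_eq_mk_iterate (g := g) x s t
  obtain ⟨n', τ', hτ', hst', hfl'⟩ := flow_eq_mk_iterate (g := g) x' s' t
  rw [hfl, h.fn_mk] at hz
  rw [hfl, hfl'] at heq
  obtain ⟨hg, rfl⟩ := MappingTorus.mk_eq_mk hτ hτ' heq
  have h0 := s.2.1
  have h0' := s'.2.1
  -- The end heights agree and both starting heights lie in `[0, 1)`, so the numbers of iterates
  -- differ by less than one.
  have h1 : (n : ℝ) < n' + 1 := by linarith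
  have h2 : (n' : ℝ) < n + 1 := by linarith
  have h1' : n < n' + 1 := by exact_mod_cast h1
  have h2' : n' < n + 1 := by exact_mod_cast h2
  obtain rfl : n = n' := by omega
  obtain rfl : s = s' := Subtype.ext (by linarith)
  have hmem := hR.antitone (Nat.zero_le k) (h.lt_of_lt_fn hR hz)
  rw [hR.eq_of_iterate_eq hmem hg]

theorem IsRepellingFunction.flowline_eq {l l' : NegEscaping g} {a b : ℝ}
    (hl : (k : ℝ) < h.fn (l.1 a)) (heq : l.1 a = l'.1 b) (t : ℝ) : l.1 (a + t) = l'.1 (b + t) := by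
  rcases le_total 0 t with ht | ht
  · lift t to ℝ≥0 using ht
    rw [l.2.1, l'.2.1, heq]
  · have h1 := l.eq_flow (a := a + t) (b := a) (by linarith)
    have h2 := l'.eq_flow (a := b + t) (b := b) (by linarith)
    rw [sub_add_cancel_left] at h1 h2
    rw [h1] at hl
    rw [h1, h2] at heq
    exact h.flow_injective hR hl heq

/-- The flowline through a point far out in the repelling region which has a backward orbit. -/
noncomputable def IsRepellingFunction.flowline {y : ℕ → Γ} (hy : ∀ n, g (y (n + 1)) = y n)
    (hy0 : (k : ℝ) < T (y 0)) : NegEscaping g := by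
  refine ⟨backwardFlowline g y, backwardFlowline_add hy, ?_⟩
  have h0 : h.fn (backwardFlowline g y 0) = T (y 0) := by
    have := backwardFlowline_neg hy 0
    rw [Nat.cast_zero, neg_zero] at this
    rw [this, h.fn_mk]
    simp
  rw [hasBasis_cocompact.tendsto_right_iff]
  intro K hK
  obtain ⟨B, hB⟩ := (hK.image h.continuous_fn).bddAbove
  filter_upwards [eventually_le_atBot 0, eventually_lt_atBot (-B)] with a ha haB hmem
  have h1 := hB ⟨_, hmem, rfl⟩
  have h2 := backwardFlowline_add hy a (-a).toNNReal
  rw [Real.coe_toNNReal _ (by linarith), add_neg_cancel] at h2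
  have h3 := h.fn_eq_add hR (z := backwardFlowline g y a) (t := (-a).toNNReal) (by
    rw [← h2, h0]; exact hy0)
  rw [← h2, h0, Real.coe_toNNReal _ (by linarith)] at h3
  have h4 : (0 : ℝ) ≤ k := Nat.cast_nonneg k
  linarith

theorem IsRepellingFunction.flowline_neg {y : ℕ → Γ} (hy : ∀ n, g (y (n + 1)) = y n)
    (hy0 : (k : ℝ) < T (y 0)) (n : ℕ) :
    (h.flowline hR hy hy0).1 (-n) = MappingTorus.mk g (y n, 0) := backwardFlowline_neg hy n

omit h hR in
/-- The points far out in the repelling region which have a backward orbit. -/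
def sources (g : Γ → Γ) (T : Γ → ℝ) (k : ℕ) : Set Γ :=
  {x | (k : ℝ) < T x ∧ ∃ y : ℕ → Γ, y 0 = x ∧ ∀ n, g (y (n + 1)) = y n}

open CompactifiedTorus

/-- The ideal point from which the flowline through a source emanates. -/
noncomputable def IsRepellingFunction.sourcePoint (x : sources g T k) : CompactifiedTorus g :=
  negLimit (h.flowline hR x.2.2.choose_spec.2 (by
    rw [x.2.2.choose_spec.1]
    exact x.2.1))

theorem IsRepellingFunction.exists_sourcePoint_eq (x : sources g T k) :
    ∃ (y : ℕ → Γ) (l : NegEscaping g), y 0 = x ∧ (∀ n, g (y (n + 1)) = y n) ∧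
      h.sourcePoint hR x = negLimit l ∧ ∀ n : ℕ, l.1 (-n) = MappingTorus.mk g (y n, 0) :=
  ⟨_, _, x.2.2.choose_spec.1, x.2.2.choose_spec.2, rfl, h.flowline_neg hR x.2.2.choose_spec.2 _⟩

/-- The flow is injective far out in the repelling region, so two complete flowlines through the
same point there agree for all times. Hence the chosen backward orbit does not matter. -/
theorem IsRepellingFunction.sourcePoint_eq {x : sources g T k} {l : NegEscaping g} {b : ℝ}
    (hl : l.1 b = MappingTorus.mk g (x, 0)) : h.sourcePoint hR x = negLimit l := by
  obtain ⟨y, l', hy0, -, hx, hl'⟩ := h.exists_sourcePoint_eq hR x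
  have h1 := hl' 0
  rw [hy0, ← hl, Nat.cast_zero, neg_zero] at h1
  rw [hx]
  change neg _ = neg _
  congr 1
  refine Quotient.sound ⟨-b, fun t => ?_⟩
  have h2 := h.flowline_eq hR (l := l) (a := b) (by
    rw [hl, h.fn_mk]
    simpa using x.2.1) h1.symm (t - b)
  rw [add_sub_cancel, zero_add] at h2
  exact h2

/-- A neighbourhood of a negative ideal point is controlled only at points far back on the flowline.
Since `g^[n]` is inducing on `g^[n] ⁻¹' R`, sources close to `x` have `n`-th backward points close
to that of `x`. -/
theorem IsRepellingFunction.continuous_sourcePoint : Continuous (h.sourcePoint hR) := by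
  rw [continuous_iff_continuousAt]
  intro x
  rw [ContinuousAt, tendsto_def]
  intro V hV
  obtain ⟨V', hVV, hV', hxV⟩ := mem_nhds_iff.1 hV
  have horb : ∀ {w : sources g T k} {y : ℕ → Γ}, y 0 = w → (∀ n, g (y (n + 1)) = y n) →
      ∀ n, g^[n] (y n) = w ∧ y n ∈ g^[n] ⁻¹' R := by
    intro w y hy0 hy n
    have h1 := iterate_backward hy n 0
    rw [zero_add, hy0] at h1
    refine ⟨h1, ?_⟩
    rw [mem_preimage, h1]
    exact hR.antitone (Nat.zero_le k) (h.mem_of_lt w.2.1)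
  obtain ⟨y, l, hy0, hy, hx, hl⟩ := h.exists_sourcePoint_eq hR x
  rw [hx] at hxV
  have ht : Tendsto (fun n : ℕ => -(n : ℝ)) atTop atBot :=
    tendsto_neg_atTop_atBot.comp tendsto_natCast_atTop_atTop
  obtain ⟨n, N, hN, -, -, h2⟩ := (ht.eventually (hV'.2.2 _ hxV)).exists
  rw [hl] at hN
  obtain ⟨N', hN'N, hN', hyN⟩ := mem_nhds_iff.1 hN
  have hc : Continuous fun x : Γ => MappingTorus.mk g (x, 0) :=
    MappingTorus.continuous_mk.comp (by fun_prop)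
  obtain ⟨O, hO, hON⟩ := hR.inducing_iterate n (hN'.preimage hc)
  have hxO : (x : Γ) ∈ O := by
    rw [← (horb hy0 hy n).1, hON _ (horb hy0 hy n).2]
    exact hyN
  filter_upwards [(hO.preimage continuous_subtype_val).mem_nhds hxO] with w hw
  obtain ⟨v, m, hv0, hv, hwm, hm⟩ := h.exists_sourcePoint_eq hR w
  rw [mem_preimage, ← (horb hv0 hv n).1, hON _ (horb hv0 hv n).2] at hw
  rw [mem_preimage, hwm]
  exact hVV (h2 m (-n) (hN'N (by rw [hm]; exact hw)))

end SourcePoints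

/-! ### Cells all of whose points have backward orbits -/

section SourceCells

variable {Γ : Type u} [TopologicalSpace Γ] [T2Space Γ] [CWComplex (univ : Set Γ)] {g : C(Γ, Γ)}
variable {R : Set Γ} {T ψ : Γ → ℝ} {k : ℕ}

theorem exists_backward_orbit_of_image_eq {f : Γ → Γ} {D : ℕ → Set Γ}
    (hD : ∀ i, f '' D (i + 1) = D i) {w : Γ} (hw : w ∈ D 0) :
    ∃ y : ℕ → Γ, y 0 = w ∧ ∀ n, f (y (n + 1)) = y n := by
  have hstep : ∀ (i : ℕ) (v : D i), ∃ v' : D (i + 1), f v' = v := by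
    rintro i ⟨v, hv⟩
    rw [← hD i] at hv
    obtain ⟨v', hv', rfl⟩ := hv
    exact ⟨⟨v', hv'⟩, rfl⟩
  choose φ hφ using hstep
  let y : (i : ℕ) → D i := fun i => Nat.rec ⟨w, hw⟩ φ i
  exact ⟨fun i => (y i).1, rfl, fun n => hφ n (y n)⟩

/-- The closed cells carrying the points of a backward orbit are mapped onto one another by `g`, so
every point of the cell of `y 0` has a backward orbit through these cells. -/
theorem IsGraph.exists_cellC_subset_sources (hΓ : IsGraph Γ) (hR : IsRepellingRegion g R)
    (h : IsRepellingFunction g R T ψ k) (hgp : IsProperMap g)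
    (hcell : ∀ c : AnyCell Γ, cellC c ⊆ R → ∃ c' : AnyCell Γ, g '' cellO c = cellO c') :
    ∃ N, ∀ y : ℕ → Γ, (∀ n, g (y (n + 1)) = y n) → y 0 ∈ g^[N] ⁻¹' R →
      ∀ c : AnyCell Γ, y 0 ∈ cellO c → cellC c ⊆ sources g T k := by
  -- On this preimage `T ≥ k + 1`, which gives the strict bound `k < T` required of sources.
  set B : Set Γ := g^[k + (k + 1)] ⁻¹' R with hB
  have hBR : B ⊆ R := hR.antitone (Nat.zero_le (k + (k + 1)))
  have hBo : IsOpen B := hR.isOpen.preimage (g.continuous.iterate _)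
  have hBf : IsCompact (frontier B) :=
    ((isProperMap_iterate hgp _).isCompact_preimage hR.isCompact_frontier).of_isClosed_subset
      isClosed_frontier ((g.continuous.iterate _).frontier_preimage_subset R)
  obtain ⟨n, hn⟩ := hΓ.exists_cellC_subset hBo hBf (D := fun n => g^[k + (k + 1) + n] ⁻¹' R)
    (fun n => hR.antitone (Nat.le_add_right _ n)) (fun K hK => by
      obtain ⟨m, hm⟩ := hR.escape K hK
      exact ⟨m, hm.mono_left (hR.antitone (Nat.le_add_left m _))⟩)
  refine ⟨k + (k + 1) + n, fun y hy hy0 c hc => ?_⟩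
  have hyN : ∀ i, y i ∈ g^[k + (k + 1) + n] ⁻¹' R := by
    intro i
    have h1 := iterate_backward hy i 0
    rw [zero_add] at h1
    exact hR.mem_of_iterate_mem (n := i) (h1 ▸ hy0)
  choose d hd using fun i => exists_mem_cellO (y i)
  have hdB : ∀ i, cellC (d i) ⊆ B := fun i =>
    hn _ (hyN i) _ (cellO_subset_cellC _ (hd i))
  have himage : ∀ i, g '' cellC (d (i + 1)) = cellC (d i) := by
    intro i
    obtain ⟨c', hc'⟩ := hcell _ ((hdB (i + 1)).trans hBR)
    have h1 : y i ∈ cellO c' := by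
      rw [← hc', ← hy i]
      exact ⟨_, hd (i + 1), rfl⟩
    rw [image_cellC_eq hc', eq_of_mem_cellO h1 (hd i)]
  obtain rfl := eq_of_mem_cellO hc (hd 0)
  intro w hw
  refine ⟨?_, exists_backward_orbit_of_image_eq (D := fun i => cellC (d i)) himage hw⟩
  have h1 := h.le_of_mem (k + 1) w (hdB 0 hw)
  push_cast at h1
  linarith

end SourceCells

/-! ### Null homotopies of loops in the negative boundary -/

section NegBoundary

variable {Γ : Type u} [TopologicalSpace Γ] [T2Space Γ] [CWComplex (univ : Set Γ)] {g : C(Γ, Γ)}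
variable {A R : Set Γ} {S χ T ψ : Γ → ℝ} {k k' : ℕ}

open CompactifiedTorus

set_option maxHeartbeats 400000 in
theorem IsGraph.exists_square_negBoundary (hΓ : IsGraph Γ) (hA : IsAttractingRegion g A)
    (h : IsAttractingFunction g A S χ k) (hR : IsRepellingRegion g R)
    (h' : IsRepellingFunction g R T ψ k') (hgp : IsProperMap g)
    (hcell : ∀ c : AnyCell Γ, cellC c ⊆ R → ∃ c' : AnyCell Γ, g '' cellO c = cellO c')
    (hinj : PiOneInjective g) (H : C(I × I, CompactifiedTorus g))
    {w : CompactifiedTorus g} (hneg : ∀ t, H (0, t) ∈ negBoundary g)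
    (hw : ∀ z ∈ squareSides, H z = w) :
    ∃ H' : C(I × I, CompactifiedTorus g), (∀ t, H' (0, t) = H (0, t)) ∧
      (∀ z ∈ squareSides, H' z = w) ∧ ∀ z, H' z ∈ negBoundary g := by
  have hM : (k : ℝ) + 1 < k + 2 := by linarith
  have hM' : (k' : ℝ) < k' + 1 := by linarith
  obtain ⟨H₁, hH₁⟩ := exists_pushed h hA h' hR hM hM'.le H
  have hs0 : ((0 : I), (0 : I)) ∈ squareSides := Or.inr (Or.inl rfl)
  have hs1 : ((0 : I), (1 : I)) ∈ squareSides := Or.inr (Or.inr rfl)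
  have hH₁c : ∀ z ∈ squareSides, H₁ z = H₁ (0, 0) := fun z hz =>
    CompactifiedTorus.inner.inj (by rw [← hH₁, ← hH₁, hw z hz, hw _ hs0])
  obtain ⟨η, r, m, d, hη, hηr, hηm, hηd⟩ := exists_square_height H₁ hH₁c
  obtain ⟨G, hG⟩ := exists_level_zero H₁ η hη hηm
  have hGc : ∀ z ∈ squareSides, G z = G (0, 0) := fun z hz =>
    MappingTorus.mk_zero_injective (g := g) (by
      rw [hG, hG, hH₁c z hz, hηr z hz, hηr _ hs0])
  obtain ⟨N, hN⟩ := hΓ.exists_cellC_subset_sources hR h' hgp hcell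
  -- The left side is pushed a second time, to a level deeper by `N + d`. Flowing up to height `m`
  -- costs at most `d`, and the remaining `N` keeps the loop where cells consist of sources.
  have hL : (k' : ℝ) < k' + 1 + (N + d : ℕ) := hM'.trans_le
    (le_add_of_nonneg_right (Nat.cast_nonneg _))
  obtain ⟨f, hf⟩ := exists_pushed h hA h' hR hM hL.le
    ⟨fun t : I => H (0, t), H.continuous.comp (by fun_prop)⟩
  simp only [ContinuousMap.coe_mk] at hf
  choose l hl using fun t => show ∃ l : NegEscaping g, H (0, t) = negLimit l by
    obtain ⟨ξ, hξ⟩ := hneg t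
    obtain ⟨l, rfl⟩ := Quotient.exists_rep ξ
    exact ⟨l, hξ.symm⟩
  have hH₁l : ∀ t, H₁ (0, t) = h'.levelPoint hR (k' + 1) (l t) := by
    intro t
    have h1 := hH₁ (0, t)
    rw [hl] at h1
    exact (CompactifiedTorus.inner.inj h1).symm
  have hfl : ∀ t, f t = h'.levelPoint hR (k' + 1 + (N + d : ℕ)) (l t) := by
    intro t
    have h1 := hf t
    rw [hl] at h1
    exact (CompactifiedTorus.inner.inj h1).symm
  have hfH : ∀ t, flow g (N + d : ℕ) (f t) = H₁ (0, t) := by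
    intro t
    rw [hfl, hH₁l, ← h'.flow_levelPoint hR hM' (N + d : ℕ), NNReal.coe_natCast]
  -- The two pushed sides differ by an integer flow time, so the same real lift `η` of the height
  -- serves for both.
  have hηf : ∀ t, (η (0, t) : AddCircle (1 : ℝ)) = torusHeight (f t) := by
    intro t
    rw [hη, ← hfH, torusHeight_flow, NNReal.coe_natCast, add_eq_left, AddCircle.coe_eq_zero_iff]
    exact ⟨(N + d : ℕ), by simp⟩
  obtain ⟨c, hc⟩ := exists_level_zero f ⟨fun t : I => η (0, t), η.continuous.comp (by fun_prop)⟩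
    hηf (fun t => hηm (0, t))
  simp only [ContinuousMap.coe_mk] at hc
  have hcG : ∀ t, g^[N + d] (c t) = G (0, t) := by
    intro t
    refine MappingTorus.mk_zero_injective (g := g) ?_
    rw [← flow_natCast, hc, hG, ← hfH, ← flow_add, ← flow_add, add_comm]
  have hc1 : c 1 = c 0 := by
    refine MappingTorus.mk_zero_injective (g := g) ?_
    have h1 : f 1 = f 0 := CompactifiedTorus.inner.inj (by rw [← hf, ← hf, hw _ hs0, hw _ hs1])
    rw [hc, hc, h1, hηr _ hs0, hηr _ hs1]
  have hcl : ∀ t, ∃ b, (l t).1 b = MappingTorus.mk g (c t, 0) := by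
    intro t
    obtain ⟨b, hb, -⟩ := h'.exists_levelPoint hR hL (l t)
    rw [hc, hfl, hb, ← (l t).2.1]
    exact ⟨_, rfl⟩
  have hcT : ∀ t, (k' : ℝ) + N < T (c t) := by
    intro t
    obtain ⟨b, hb, hbM⟩ := h'.exists_levelPoint hR hL (l t)
    have h1 : h'.fn (f t) = k' + 1 + (N + d : ℕ) := by rw [hfl, hb, hbM]
    have h2 := hηd (0, t)
    have h3 : (((m : ℝ) - η (0, t)).toNNReal : ℝ) = m - η (0, t) :=
      Real.coe_toNNReal _ (sub_nonneg.2 (hηm _))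
    push_cast at h1
    have h4 : (0 : ℝ) ≤ N := Nat.cast_nonneg N
    have h5 := h'.fn_flow hR (z := f t) (t := ((m : ℝ) - η (0, t)).toNNReal) (by
      rw [h1, h3]; linarith)
    rw [← hc, h'.fn_mk, h1, h3] at h5
    simp only [Icc.coe_zero, zero_mul, sub_zero] at h5
    linarith
  have hcS : ∀ t, c t ∈ ⋃ e ∈ {e : AnyCell Γ | cellC e ⊆ sources g T k'}, cellC e := by
    intro t
    obtain ⟨b, hb⟩ := hcl t
    obtain ⟨y, hy, hyl⟩ := (l t).exists_orbit (a := b) (by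
      rw [hb, torusHeight_mk]; simp)
    have hy0 : y 0 = c t := by
      refine MappingTorus.mk_zero_injective (g := g) ?_
      rw [← hyl, ← hb, Nat.cast_zero, sub_zero]
    obtain ⟨e, he⟩ := exists_mem_cellO (y 0)
    have hmem : y 0 ∈ g^[N] ⁻¹' R := by
      refine hR.antitone (Nat.zero_le k') (h'.mem_of_lt ?_)
      have h1 := h'.sub_le_iterate hR N (y 0)
      have h2 := hcT t
      rw [← hy0] at h2
      linarith
    rw [← hy0]
    exact mem_biUnion (show e ∈ {e : AnyCell Γ | cellC e ⊆ sources g T k'} from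
      hN y hy hmem e he) (cellO_subset_cellC e he)
  let p : Path (c 0) (c 0) := ⟨c, rfl, hc1⟩
  -- The square `G` shows that the image of `c` under `g^[N + d]` is null homotopic; injectivity of
  -- `g` on `π₁` removes the iterates.
  have hp : p.Homotopic (Path.refl (c 0)) := by
    refine hinj.homotopic_refl_of_iterate (N + d) p ((homotopic_refl_iff _).2 ⟨G, ?_, ?_⟩)
    · exact fun t => (hcG t).symm
    · exact fun z hz => (hGc z hz).trans (hcG 0).symm
  obtain ⟨G₁, hG₁, hG₁c⟩ := (homotopic_refl_iff _).1 hp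
  replace hG₁ : ∀ t, G₁ (0, t) = c t := hG₁
  obtain ⟨G₂, hG₂, hG₂S⟩ := hΓ.exists_square_in_subgraph (hΓ.isSubgraph_biUnion _) G₁ (by
    rintro ⟨a, b⟩ (hz | hz)
    · obtain rfl : a = 0 := hz
      rw [hG₁]
      exact hcS b
    · rw [hG₁c _ hz]
      exact hcS 0)
  have hG₂s : ∀ z, G₂ z ∈ sources g T k' := fun z => by
    obtain ⟨e, he, hz⟩ := mem_iUnion₂.1 (hG₂S z)
    exact he hz
  let H₂ : C(I × I, CompactifiedTorus g) := ⟨fun z => h'.sourcePoint hR ⟨G₂ z, hG₂s z⟩,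
    (h'.continuous_sourcePoint hR).comp (G₂.continuous.subtype_mk _)⟩
  have hH₂ : ∀ t, H₂ (0, t) = H (0, t) := by
    intro t
    obtain ⟨b, hb⟩ := hcl t
    rw [hl]
    refine h'.sourcePoint_eq hR (b := b) ?_
    change _ = MappingTorus.mk g (G₂ (0, t), 0)
    rw [hb, hG₂ _ (Or.inl rfl), hG₁]
  refine ⟨H₂, hH₂, fun z hz => ?_, fun z => ⟨_, rfl⟩⟩
  rw [← hw _ hs0, ← hH₂ 0]
  change h'.sourcePoint hR _ = h'.sourcePoint hR _
  congr 2
  rw [hG₂ _ (Or.inr hz), hG₂ _ (Or.inl rfl), hG₁c z hz, hG₁]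

end NegBoundary

end EPGraph

theorem mainTheorem4 {Γ : Type*} [TopologicalSpace Γ] [T2Space Γ] [CWComplex (Set.univ : Set Γ)]
    (hΓ : EPGraph.IsGraph Γ) (hinf : Infinite (EPGraph.AnyCell Γ)) (hconn : ConnectedSpace Γ)
    (hends : Finite (EPGraph.GraphEnd Γ))
    (g : C(Γ, Γ)) (hg : EPGraph.IsEndPeriodic g)
    (hinj : EPGraph.PiOneInjective g)
    (S : Set (EPGraph.CompactifiedTorus g))
    (hS : EPGraph.CompactifiedTorus.IsBoundaryComponent S) :
    EPGraph.PiOneInjective (EPGraph.inclusionMap S) := by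
  have := EPGraph.locallyConnectedSpace_of_cwComplex (Γ := Γ)
  have := hΓ.weaklyLocallyCompactSpace
  have := hΓ.sigmaCompactSpace
  obtain ⟨U, hU, hemb, hedge, p, hp, hdyn⟩ := hg.exists_nhds
  obtain ⟨K, hK, hinjK, hind, hcell, hgp⟩ :=
    hΓ.exists_compact_good hg.isGraphMap hU hemb hedge
  obtain ⟨A, hA⟩ := EPGraph.exists_isAttractingRegion hgp hK hinjK hind hp hdyn
  obtain ⟨R, hR, hRK⟩ := EPGraph.exists_isRepellingRegion hK hinjK hind hgp hp hdyn
  obtain ⟨s, χ, k, h⟩ := hA.exists_flowFunction hgp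
  obtain ⟨T, ψ, k', h'⟩ := hR.exists_flowFunction
  rw [EPGraph.piOneInjective_iff]
  intro x q hq
  obtain ⟨H, hH0, hH1⟩ := (EPGraph.homotopic_refl_iff _).1 hq
  replace hH0 : ∀ t, H (0, t) = q t := hH0
  replace hH1 : ∀ z ∈ EPGraph.squareSides, H z = x := hH1
  rcases hS with ⟨ξ, -, rfl⟩ | ⟨ξ, -, rfl⟩
  · obtain ⟨H', h0, h1, h2⟩ := hΓ.exists_square_posBoundary hA h hR h' H
      (fun t => by rw [hH0]; exact connectedComponentIn_subset _ _ (q t).2) hH1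
    exact EPGraph.homotopic_refl_in_component q H' h2 (fun t => (h0 t).trans (hH0 t)) h1
  · obtain ⟨H', h0, h1, h2⟩ := hΓ.exists_square_negBoundary hA h hR h' hgp
      (fun c hc => hcell c (hc.trans hRK)) hinj H
      (fun t => by rw [hH0]; exact connectedComponentIn_subset _ _ (q t).2) hH1
    exact EPGraph.homotopic_refl_in_component q H' h2 (fun t => (h0 t).trans (hH0 t)) h1
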